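/- A planar tree $T$ is a rooted, locally finite tree whose generations $D_0(T),D_1(T),D_2(T),\dots$ ($D_r(T)$ is the set of vertices at height $r$, i.e. at distance $r$ from the root) are finite ordered sets with order-preserving parent maps $D_{r+1}(T)\to D_r(T)$, and with $|D_0(T)|=|D_1(T)|=1$; isomorphic trees are identified. The size $|T|\in\mathbb N\cup\{\infty\}$ is the number of edges of $T$, $h(T)$ is the maximal height of a vertex of $T$ when $T$ is finite, and for $r\ge 1$, $B_r(T)$ is the subtree spanned by the vertices at distance at most $r$ from the root, so that $|B_r(T)|=\sum_{s=1}^r|D_s(T)|$. The set $\mathcal T$ of planar trees carries the metric $\mathrm{dist}(T,T')=\inf\{1/r : r\ge 1,\ B_r(T)=B_r(T')\}$ and its Borel $\sigma$-algebra. The spine $\chi(T)$ of an infinite tree $T$ is the subtree spanned by the vertices that have infinitely many descendants. Let $\mu>0$, and for $N\ge 1$ let $\nu_N^{(\mu)}$ be the probability measure on $\mathcal T$, supported on $\{T : |T|=N\}$, with $$\nu_N^{(\mu)}(\{T\})=\frac{e^{-\mu h(T)}}{Z_N^{(\mu)}}\quad (|T|=N),\qquad Z_N^{(\mu)}=\sum_{|T|=N}e^{-\mu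 h(T)} .$$ Then $\nu^{(\mu)}_N$ converges weakly as $N\to\infty$ to a (unique) Borel probability measure $\nu^{(\mu)}$ on $\mathcal T$, $\nu^{(\mu)}$-almost every tree is infinite, and $\chi$ is $\nu^{(\mu)}$-a.e. measurable. Let $\tilde\nu^{(\mu)}=\nu^{(\mu)}\circ\chi^{-1}$ be the spine measure, that is, the law of $\chi(T)$ when $T$ has law $\nu^{(\mu)}$, and let $\tilde{\mathbb E}_\mu$ be the expectation with respect to $\tilde\nu^{(\mu)}$. The following hold. 1. For every $r\ge 1$, $|D_r|$ is integrable and $\tilde{\mathbb E}_\mu(|D_r|)=\mu(r-1)+1$. 2. For every $r\ge 1$, $|B_r|$ is integrable and $\tilde{\mathbb E}_\mu(|B_r|)=\tfrac12\mu r(r-1)+r$. 3. $\lim_{r\to\infty}|D_r(T^s)|/r=\mu$ for $\tilde\nu^{(\mu)}$-almost every $T^s$. 4. $\lim_{r\to\infty}|B_r(T^s)|/r^2=\tfrac12\mu$ for $\tilde\nu^{(\mu)}$-almost every $T^s$. -/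

import Mathlib

open MeasureTheory Filter Topology

/-- A locally finite rooted planar tree, given by its generations `D₀, D₁, D₂, …` and its parent
maps. Up to the unique order isomorphism, the finite ordered set `D_r` is `{0, …, width r - 1}` with
its usual order, listed from left to right, and `parent r` is the order preserving parent map from
`D_{r+1}` to `D_r`. The values of `parent r` outside `D_{r+1}` carry no information and are
normalised to be `0`, so that two trees are equal as elements of this type if and only if they are
isomorphic as planar trees. The generations `D₀` (the root) and `D₁` have exactly one vertex. -/
@[ext]
structure PlanarTree where
  width : ℕ → ℕ
  parent : ℕ → ℕ → ℕ
  width_zero : width 0 = 1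
  width_one : width 1 = 1
  parent_lt : ∀ r j, j < width (r + 1) → parent r j < width r
  parent_mono : ∀ r i j, i ≤ j → j < width (r + 1) → parent r i ≤ parent r j
  parent_eq_zero : ∀ r j, width (r + 1) ≤ j → parent r j = 0

namespace PlanarTree

/-- The size `|T|`, the number of edges of `T`. Every vertex `j ∈ D_{r+1}` gives one edge, which
joins it to its parent; the edge is encoded as the pair `(r, j)`. -/
noncomputable def size (T : PlanarTree) : ℕ∞ :=
  {e : ℕ × ℕ | e.2 < T.width (e.1 + 1)}.encard

/-- The height `h(T)` of a finite tree: the largest `r` such that `D_r` is not empty. -/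
noncomputable def height (T : PlanarTree) : ℕ := sSup {r : ℕ | T.width r ≠ 0}

/-- The ball `B_r(T)` of radius `r ≥ 1` around the root, as a planar tree: the subtree of `T`
spanned by the vertices at distance at most `r` from the root. (For `r = 0` it is by convention
the ball of radius `1`, since a planar tree has a root edge.) -/
def ball (r : ℕ) (T : PlanarTree) : PlanarTree where
  width s := if s ≤ max r 1 then T.width s else 0
  parent s j := if s < max r 1 then T.parent s j else 0
  width_zero := by simp [T.width_zero]
  width_one := by simp [T.width_one]
  parent_lt s j h := by
    by_cases hs : s < max r 1
    · rw [if_pos (show s + 1 ≤ max r 1 by omega)] at h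
      rw [if_pos hs, if_pos hs.le]
      exact T.parent_lt s j h
    · rw [if_neg (by omega)] at h
      omega
  parent_mono s i j hij h := by
    by_cases hs : s < max r 1
    · rw [if_pos (show s + 1 ≤ max r 1 by omega)] at h
      rw [if_pos hs, if_pos hs]
      exact T.parent_mono s i j hij h
    · rw [if_neg hs, if_neg hs]
  parent_eq_zero s j h := by
    by_cases hs : s < max r 1
    · rw [if_pos (show s + 1 ≤ max r 1 by omega)] at h
      rw [if_pos hs]
      exact T.parent_eq_zero s j h
    · rw [if_neg hs]

theorem ball_eq_ball_iff (r : ℕ) (T T' : PlanarTree) :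
    ball r T = ball r T' ↔
      (∀ s ≤ max r 1, T.width s = T'.width s) ∧ ∀ s < max r 1, T.parent s = T'.parent s := by
  constructor
  · intro h
    have h1 := congrArg PlanarTree.width h
    have h2 := congrArg PlanarTree.parent h
    constructor
    · intro s hs
      have := congrFun h1 s
      simpa only [ball, if_pos hs] using this
    · intro s hs
      have := congrFun h2 s
      simpa only [ball, if_pos hs] using this
  · rintro ⟨h1, h2⟩
    ext s j
    · simp only [ball]
      split_ifs with hs
      · exact h1 s hs
      · rfl
    · simp only [ball]
      split_ifs with hs
      · exact congrFun (h2 s hs) j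
      · rfl

theorem ball_eq_ball_of_le {r s : ℕ} (hrs : r ≤ s) {T T' : PlanarTree}
    (h : ball s T = ball s T') : ball r T = ball r T' := by
  rw [ball_eq_ball_iff] at h ⊢
  exact ⟨fun q hq => h.1 q (by omega), fun q hq => h.2 q (by omega)⟩

theorem eq_of_forall_ball_eq {T T' : PlanarTree} (h : ∀ r : ℕ, ball r T = ball r T') :
    T = T' := by
  ext s j
  · exact ((ball_eq_ball_iff s T T').1 (h s)).1 s (by omega)
  · exact congrFun (((ball_eq_ball_iff (s + 1) T T').1 (h (s + 1))).2 s (by omega)) j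

/-- The numbers `1 / r`, `r ≥ 1`, such that `T` and `T'` share the ball of radius `r`. -/
def invRadii (T T' : PlanarTree) : Set ℝ :=
  {x : ℝ | ∃ r : ℕ, 1 ≤ r ∧ ball r T = ball r T' ∧ x = 1 / (r : ℝ)}

theorem invRadii_nonempty (T T' : PlanarTree) : (invRadii T T').Nonempty := by
  refine ⟨1 / ((1 : ℕ) : ℝ), 1, le_rfl, ?_, rfl⟩
  rw [ball_eq_ball_iff]
  have hw : ∀ s ≤ max 1 1, T.width s = T'.width s := by
    intro s hs
    have hs' : s = 0 ∨ s = 1 := by omega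
    rcases hs' with rfl | rfl
    · rw [T.width_zero, T'.width_zero]
    · rw [T.width_one, T'.width_one]
  refine ⟨hw, ?_⟩
  intro s hs
  obtain rfl : s = 0 := by omega
  have key : ∀ (S : PlanarTree) (j : ℕ), S.parent 0 j = 0 := by
    intro S j
    by_cases hj : j < S.width (0 + 1)
    · have := S.parent_lt 0 j hj
      rw [S.width_zero] at this
      omega
    · exact S.parent_eq_zero 0 j (by omega)
  funext j
  rw [key T, key T']

theorem invRadii_pos {T T' : PlanarTree} {x : ℝ} (hx : x ∈ invRadii T T') : 0 < x := by
  obtain ⟨r, hr, -, rfl⟩ := hx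
  have : (0 : ℝ) < r := by exact_mod_cast hr
  positivity

theorem invRadii_bddBelow (T T' : PlanarTree) : BddBelow (invRadii T T') :=
  ⟨0, fun _ hx => (invRadii_pos hx).le⟩

theorem invRadii_comm (T T' : PlanarTree) : invRadii T T' = invRadii T' T := by
  ext x
  exact ⟨fun ⟨r, h1, h2, h3⟩ => ⟨r, h1, h2.symm, h3⟩, fun ⟨r, h1, h2, h3⟩ => ⟨r, h1, h2.symm, h3⟩⟩

/-- The metric `dist(T, T') = inf {1 / r | r ≥ 1, B_r(T) = B_r(T')}` on planar trees. -/
noncomputable instance : MetricSpace PlanarTree where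
  dist T T' := sInf (invRadii T T')
  dist_self T := by
    refine le_antisymm (le_of_forall_pos_le_add fun ε hε => ?_)
      (le_csInf (invRadii_nonempty T T) fun _ hx => (invRadii_pos hx).le)
    obtain ⟨n, hn⟩ := exists_nat_one_div_lt hε
    refine (csInf_le (invRadii_bddBelow T T)
      (⟨n + 1, by omega, rfl, rfl⟩ : 1 / ((n + 1 : ℕ) : ℝ) ∈ invRadii T T)).trans ?_
    push_cast
    linarith
  dist_comm T T' := by
    show sInf (invRadii T T') = sInf (invRadii T' T)
    rw [invRadii_comm]
  dist_triangle T T' T'' := by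
    show sInf (invRadii T T'') ≤ sInf (invRadii T T') + sInf (invRadii T' T'')
    have key : ∀ a ∈ invRadii T T', ∀ b ∈ invRadii T' T'', sInf (invRadii T T'') ≤ a + b := by
      intro a ha b hb
      have ha0 := invRadii_pos ha
      have hb0 := invRadii_pos hb
      obtain ⟨r, hr, hab, rfl⟩ := ha
      obtain ⟨s, hs, hbc, rfl⟩ := hb
      rcases le_total r s with h | h
      · have := csInf_le (invRadii_bddBelow T T'')
          (⟨r, hr, hab.trans (ball_eq_ball_of_le h hbc), rfl⟩ : 1 / (r : ℝ) ∈ invRadii T T'')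
        linarith
      · have := csInf_le (invRadii_bddBelow T T'')
          (⟨s, hs, (ball_eq_ball_of_le h hab).trans hbc, rfl⟩ : 1 / (s : ℝ) ∈ invRadii T T'')
        linarith
    have h1 : ∀ a ∈ invRadii T T', sInf (invRadii T T'') - a ≤ sInf (invRadii T' T'') :=
      fun a ha => le_csInf (invRadii_nonempty T' T'') fun b hb => by
        have := key a ha b hb
        linarith
    have h2 : sInf (invRadii T T'') - sInf (invRadii T' T'') ≤ sInf (invRadii T T') :=
      le_csInf (invRadii_nonempty T T') fun a ha => by
        have := h1 a ha
        linarith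
    linarith
  eq_of_dist_eq_zero {T T'} h := by
    replace h : sInf (invRadii T T') = 0 := h
    refine eq_of_forall_ball_eq fun r => ?_
    have hpos : (0 : ℝ) < 1 / ((r : ℝ) + 1) := by positivity
    obtain ⟨x, ⟨s, hs, hb, rfl⟩, hx⟩ :=
      exists_lt_of_csInf_lt (invRadii_nonempty T T') (h.trans_lt hpos)
    have hs0 : (0 : ℝ) < s := by exact_mod_cast hs
    have hlt : (r : ℝ) + 1 < s := (one_div_lt_one_div hs0 (by positivity)).1 hx
    have hrs : r ≤ s := by
      have : r + 1 < s := by exact_mod_cast hlt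
      omega
    exact ball_eq_ball_of_le hrs hb

/-- Measures on the space of planar trees are Borel measures. -/
noncomputable instance : MeasurableSpace PlanarTree := borel PlanarTree

instance : BorelSpace PlanarTree := ⟨rfl⟩

theorem size_ball (r : ℕ) (hr : 1 ≤ r) (T : PlanarTree) :
    (ball r T).size = ((∑ s ∈ Finset.Icc 1 r, T.width s : ℕ) : ℕ∞) := by
  have hset : {e : ℕ × ℕ | e.2 < (ball r T).width (e.1 + 1)} =
      (((Finset.range r).sigma fun s => Finset.range (T.width (s + 1))).map
        (Equiv.sigmaEquivProd ℕ ℕ).toEmbedding : Finset (ℕ × ℕ)) := by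
    ext ⟨s, j⟩
    by_cases hs : s < r
    · have hm : s + 1 ≤ max r 1 := by omega
      simp only [ball, Set.mem_ofPred_eq, if_pos hm]
      simp [hs]
    · have hm : ¬ s + 1 ≤ max r 1 := by omega
      simp only [ball, Set.mem_ofPred_eq, if_neg hm]
      simp [hs]
  rw [size, hset, Set.encard_coe_eq_coe_finsetCard, Finset.card_map, Finset.card_sigma]
  simp only [Finset.card_range]
  congr 1
  rw [Finset.range_eq_Ico, Finset.sum_Ico_add' (fun s => T.width s) 0 r 1]
  rfl

/-- `T.ancestor r k j` is the ancestor in `D_r` of the vertex `j ∈ D_{r+k}`. -/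
def ancestor (T : PlanarTree) (r : ℕ) : ℕ → ℕ → ℕ
  | 0, j => j
  | k + 1, j => ancestor T r k (T.parent (r + k) j)

/-- The descendants of the vertex `i ∈ D_r`; the pair `(k, j)` stands for `j ∈ D_{r+k+1}`. -/
def descendants (T : PlanarTree) (r i : ℕ) : Set (ℕ × ℕ) :=
  {v : ℕ × ℕ | v.2 < T.width (r + (v.1 + 1)) ∧ T.ancestor r (v.1 + 1) v.2 = i}

/-- The vertex `i ∈ D_r` is of infinite type: it has infinitely many descendants. -/
def IsInfType (T : PlanarTree) (r i : ℕ) : Prop := (T.descendants r i).Infinite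

theorem ancestor_succ_left (T : PlanarTree) (r k j : ℕ) :
    T.ancestor r (k + 1) j = T.parent r (T.ancestor (r + 1) k j) := by
  induction k generalizing j with
  | zero => rfl
  | succ k ih =>
    show T.ancestor r (k + 1) (T.parent (r + (k + 1)) j) =
      T.parent r (T.ancestor (r + 1) k (T.parent (r + 1 + k) j))
    rw [ih, show r + 1 + k = r + (k + 1) by omega]

theorem ancestor_lt (T : PlanarTree) (r k j : ℕ) (hj : j < T.width (r + k)) :
    T.ancestor r k j < T.width r := by
  induction k generalizing j with
  | zero => exact hj
  | succ k ih => exact ih _ (T.parent_lt (r + k) j hj)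

theorem IsInfType.parent {T : PlanarTree} {r i : ℕ} (h : T.IsInfType (r + 1) i) :
    T.IsInfType r (T.parent r i) := by
  have hinj : Function.Injective (fun v : ℕ × ℕ => (v.1 + 1, v.2)) := by
    rintro ⟨a, b⟩ ⟨c, d⟩ h
    simp only [Prod.mk.injEq] at h ⊢
    omega
  refine (Set.Infinite.image hinj.injOn h).mono ?_
  rintro _ ⟨v, ⟨hv1, hv2⟩, rfl⟩
  refine ⟨?_, ?_⟩
  · show v.2 < T.width (r + (v.1 + 1 + 1))
    rw [show r + (v.1 + 1 + 1) = r + 1 + (v.1 + 1) by omega]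
    exact hv1
  · show T.ancestor r (v.1 + 1 + 1) v.2 = T.parent r i
    rw [ancestor_succ_left, hv2]

theorem isInfType_zero {T : PlanarTree} (hT : T.size = ⊤) : T.IsInfType 0 0 := by
  refine (Set.encard_eq_top_iff.1 hT).mono ?_
  rintro v (hv : v.2 < T.width (v.1 + 1))
  have hv' : v.2 < T.width (0 + (v.1 + 1)) := by rwa [Nat.zero_add]
  refine ⟨hv', ?_⟩
  have := T.ancestor_lt 0 _ _ hv'
  rw [T.width_zero] at this
  omega

theorem isInfType_one {T : PlanarTree} (hT : T.size = ⊤) : T.IsInfType 1 0 := by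
  have hfin : ((fun j : ℕ => ((0 : ℕ), j)) '' Set.Iio (T.width 1)).Finite :=
    (Set.finite_Iio _).image _
  have hinf := (Set.encard_eq_top_iff.1 hT).sdiff hfin
  refine Set.Infinite.of_image (fun v : ℕ × ℕ => (v.1 + 1, v.2)) (hinf.mono ?_)
  rintro ⟨a, b⟩ ⟨hv, hn⟩
  replace hv : b < T.width (a + 1) := hv
  cases a with
  | zero => exact absurd ⟨b, hv, rfl⟩ hn
  | succ a =>
    have hv' : b < T.width (1 + (a + 1)) := by rwa [Nat.add_comm 1 (a + 1)]
    refine ⟨(a, b), ⟨hv', ?_⟩, rfl⟩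
    have := T.ancestor_lt 1 _ _ hv'
    rw [T.width_one] at this
    show T.ancestor 1 (a + 1) b = 0
    omega

open Classical in
/-- The spine (backbone) of an infinite tree `T`: the subtree spanned by the vertices of infinite
type. Its generation `r` consists of the vertices of infinite type in `D_r`, which are renumbered
from left to right: `Nat.nth` gives the vertex of `T` with a given new number, and `Nat.count`
gives the new number of a vertex of `T`. -/
noncomputable def infiniteSpine (T : PlanarTree) (hT : T.size = ⊤) : PlanarTree where
  width r := Nat.count (T.IsInfType r) (T.width r)
  parent r j :=
    if j < Nat.count (T.IsInfType (r + 1)) (T.width (r + 1)) then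
      Nat.count (T.IsInfType r) (T.parent r (Nat.nth (T.IsInfType (r + 1)) j))
    else 0
  width_zero := by
    rw [T.width_zero, Nat.count_succ, Nat.count_zero, if_pos (isInfType_zero hT)]
  width_one := by
    rw [T.width_one, Nat.count_succ, Nat.count_zero, if_pos (isInfType_one hT)]
  parent_lt r j h := by
    rw [if_pos h]
    have h1 : Nat.nth (T.IsInfType (r + 1)) j < T.width (r + 1) := Nat.nth_lt_of_lt_count h
    have h2 : T.IsInfType (r + 1) (Nat.nth (T.IsInfType (r + 1)) j) :=
      Nat.nth_mem j fun hf => h.trans_le (Nat.count_le_card hf _)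
    exact Nat.count_strict_mono h2.parent (T.parent_lt r _ h1)
  parent_mono r i j hij h := by
    rw [if_pos h, if_pos (hij.trans_lt h)]
    refine Nat.count_monotone _ (T.parent_mono r _ _ ?_ (Nat.nth_lt_of_lt_count h))
    exact Nat.nth_le_nth' hij fun hf => h.trans_le (Nat.count_le_card hf _)
  parent_eq_zero r j h := if_neg (not_lt.2 h)

open Classical in
/-- The spine map `χ`. On finite trees, where the spine is not defined, it is extended by the
identity. -/
noncomputable def spine (T : PlanarTree) : PlanarTree :=
  if hT : T.size = ⊤ then T.infiniteSpine hT else T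

/-- The partition function `Z_N = ∑_{|T| = N} e^{-μ h(T)}`. -/
noncomputable def partitionFunction (μ : ℝ) (N : ℕ) : ENNReal :=
  ∑' T : {T : PlanarTree // T.size = N}, ENNReal.ofReal (Real.exp (-μ * T.1.height))

/-- The measure on planar trees supported on the trees of size `N ≥ 1`, with
`ν_N({T}) = e^{-μ h(T)} / Z_N` if `|T| = N`. -/
noncomputable def finiteSizeMeasure (μ : ℝ) (N : ℕ) : Measure PlanarTree :=
  Measure.sum fun T : {T : PlanarTree // T.size = N} =>
    (ENNReal.ofReal (Real.exp (-μ * T.1.height)) / partitionFunction μ N) • Measure.dirac T.1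

/-- `ν` is the local limit of the measures `ν_N`: a Borel probability measure to which they
converge weakly as `N → ∞`. -/
def IsLocalLimit (μ : ℝ) (ν : Measure PlanarTree) : Prop :=
  IsProbabilityMeasure ν ∧
    ∀ F : BoundedContinuousFunction PlanarTree ℝ,
      Tendsto (fun N : ℕ => ∫ T, F T ∂(finiteSizeMeasure μ N)) atTop (𝓝 (∫ T, F T ∂ν))

/-- The spine measure: the distribution of the spine `χ(T)`, where `T` has distribution `ν`. -/
noncomputable def spineMeasure (ν : Measure PlanarTree) : Measure PlanarTree :=
  ν.map spine

/-- The number `|D_r(T)|` of vertices at height `r`, as a real number. -/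
def generationSize (r : ℕ) (T : PlanarTree) : ℝ := T.width r

/-- The size `|B_r(T)|` (the number of edges) of the ball of radius `r ≥ 1`, as a real number. -/
noncomputable def ballSize (r : ℕ) (T : PlanarTree) : ℝ := ((ball r T).size.toNat : ℝ)

end PlanarTree

/-! The trees of height at most `p + 1` have the generating function `X T_p`, where `T_0 = 1`
and `T_{p+1} = 1 / (1 - X T_p)`. The coefficients of `T_p` count closed paths in `{0, …, p}` and
are given by a spectral formula; a Riccati equation for `X T_p` then determines the coefficients
of its powers. When `n / (p + 2) ^ 3` converges, the slowest mode `cos (π / (p + 2)) ^ (2 * n)`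
dominates, and control of all differences in `n` makes up for the factors `n` that the Riccati
equation brings in. Summation against `exp (-μ p)` is a Laplace argument around heights of order
`n ^ (1 / 3)`. It shows that the probability, under the measures of fixed size, of a given ball
with `K` vertices on its boundary sphere converges to an explicit multiple of
`∑ i, C(K, i + 1) μ ^ i / i!`.

These limits are the ball probabilities of an explicit random tree with marked vertices. The
child of the root is marked. In each further generation the number of marked vertices grows by
an independent Poisson variable of mean `μ`; every marked vertex has a marked child, and the
unmarked ones have geometric offspring of mean one. The unmarked vertices thus found critical
branching processes, which die out, and almost surely the spine consists of the root and the
marked vertices. Hence `|D_{n+1}|` is, on the spine, `1` plus a sum of `n` independent Poisson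
variables, and the strong law of large numbers applies. -/

section GeneratingFunction

open PowerSeries

variable {R : Type*}

theorem coeff_X_mul_pow_mul_of_lt [CommSemiring R] (f g : R⟦X⟧) {n i : ℕ} (h : n < i) :
    coeff n ((X * f) ^ i * g) = 0 := by
  rw [mul_pow, mul_assoc, coeff_X_pow_mul', if_neg (by omega)]

/-- The geometric series `1 / (1 - X f)`, written without inverses so that it makes sense over a
semiring. -/
noncomputable def geometricSeries [CommSemiring R] (f : R⟦X⟧) : R⟦X⟧ :=
  PowerSeries.mk fun n => ∑ i ∈ Finset.range (n + 1), coeff n ((X * f) ^ i)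

theorem coeff_geometricSeries_of_le [CommSemiring R] (f : R⟦X⟧) {m n : ℕ} (h : n ≤ m) :
    coeff n (geometricSeries f) = coeff n (∑ i ∈ Finset.range (m + 1), (X * f) ^ i) := by
  rw [map_sum, geometricSeries, coeff_mk]
  refine Finset.sum_subset (by simpa using h) fun i _ hi => ?_
  simpa using coeff_X_mul_pow_mul_of_lt f 1 (by simpa using hi)

theorem geometricSeries_eq_one_add [CommSemiring R] (f : R⟦X⟧) :
    geometricSeries f = 1 + X * f * geometricSeries f := by
  ext n
  have truncate : coeff n (X * f * geometricSeries f) =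
      coeff n (X * f * ∑ i ∈ Finset.range (n + 1), (X * f) ^ i) := by
    rw [coeff_mul, coeff_mul]
    refine Finset.sum_congr rfl fun x hx => ?_
    have hx2 := Finset.HasAntidiagonal.mem_antidiagonal.1 hx
    rw [coeff_geometricSeries_of_le f (show x.2 ≤ n by omega)]
  rw [map_add, truncate, coeff_geometricSeries_of_le f n.le_succ, ← map_add, Finset.mul_sum,
    Finset.sum_range_succ' _ (n + 1), add_comm]
  simp only [pow_succ', pow_zero]

theorem eq_sum_pow_mul_add_of_eq_one_add [CommSemiring R] {u v : R} (h : v = 1 + u * v) (m : ℕ) :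
    v = ∑ i ∈ Finset.range m, u ^ i + u ^ m * v := by
  induction m with
  | zero => simp
  | succ m ih =>
    calc v = ∑ i ∈ Finset.range m, u ^ i + u ^ m * v := ih
      _ = ∑ i ∈ Finset.range m, u ^ i + u ^ m * (1 + u * v) := by rw [← h]
      _ = ∑ i ∈ Finset.range (m + 1), u ^ i + u ^ (m + 1) * v := by
        rw [Finset.sum_range_succ]; ring

theorem coeff_mul_eq_sum_of_eq_one_add [CommSemiring R] {f v : R⟦X⟧} (h : v = 1 + X * f * v)
    (n : ℕ) (w : R⟦X⟧) :
    coeff n (v * w) = ∑ i ∈ Finset.range (n + 1), coeff n ((X * f) ^ i * w) := by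
  conv_lhs => rw [eq_sum_pow_mul_add_of_eq_one_add h (n + 1)]
  rw [add_mul, Finset.sum_mul, mul_assoc, map_add, map_sum,
    coeff_X_mul_pow_mul_of_lt _ _ (by omega), add_zero]

theorem map_geometricSeries {S : Type*} [CommSemiring R] [CommSemiring S] (φ : R →+* S)
    (f : R⟦X⟧) : (geometricSeries f).map φ = geometricSeries (f.map φ) := by
  ext n
  simp only [geometricSeries, coeff_map, coeff_mk, map_sum]
  simp only [← coeff_map, map_pow, map_mul, map_X]

/-- The generating function of the descendants, up to `p` generations below it, of one vertex:
`coeff n (treeSeries ℕ p)` is the number of rooted plane trees with `n` edges and height at most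
`p`, and `treeSeries ℕ p ^ K` counts forests of `K` such trees. -/
noncomputable def treeSeries (R : Type*) [CommSemiring R] : ℕ → R⟦X⟧
  | 0 => 1
  | p + 1 => geometricSeries (treeSeries R p)

theorem treeSeries_zero [CommSemiring R] : treeSeries R 0 = 1 := rfl

theorem treeSeries_succ [CommSemiring R] (p : ℕ) :
    treeSeries R (p + 1) = 1 + X * treeSeries R p * treeSeries R (p + 1) :=
  geometricSeries_eq_one_add _

theorem map_treeSeries {S : Type*} [CommSemiring R] [CommSemiring S] (φ : R →+* S) (p : ℕ) :
    (treeSeries R p).map φ = treeSeries S p := by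
  induction p with
  | zero => exact map_one _
  | succ p ih => simp only [treeSeries, map_geometricSeries, ih]

theorem coeff_treeSeries_pow_eq_natCast [CommSemiring R] (p K n : ℕ) :
    coeff n (treeSeries R p ^ K) = (coeff n (treeSeries ℕ p ^ K) : ℕ) := by
  rw [← map_treeSeries (Nat.castRingHom R), ← map_pow, coeff_map, eq_natCast]

theorem treeSeries_succ_mul_one_sub [CommRing R] (p : ℕ) :
    treeSeries R (p + 1) * (1 - X * treeSeries R p) = 1 := by
  linear_combination treeSeries_succ (R := R) p

theorem derivative_treeSeries_succ [CommRing R] (p : ℕ) :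
    derivative R (treeSeries R (p + 1)) =
      treeSeries R (p + 1) ^ 2 * derivative R (X * treeSeries R p) := by
  rw [(derivative R).leibniz_of_mul_eq_one (treeSeries_succ_mul_one_sub p), map_sub,
    Derivation.map_one_eq_zero, zero_sub, smul_neg, neg_smul, neg_neg, smul_eq_mul]

/-- The recursion `X T_{p+1} = X / (1 - X T_p)` iterates a Möbius map whose fixed points are the
roots of `y² - y + X`; hence a Riccati equation in which `p` is merely a coefficient. -/
theorem treeSeries_riccati [CommRing R] (p : ℕ) :
    X * (4 * X - 1) * derivative R (X * treeSeries R p) =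
      2 * X * (X * treeSeries R p) - X + (p + 2 : R⟦X⟧) *
        ((X * treeSeries R p) ^ 2 - X * treeSeries R p + X) := by
  induction p with
  | zero =>
    rw [treeSeries_zero, mul_one, derivative_X]
    push_cast
    ring
  | succ p ih =>
    have hinv := treeSeries_succ_mul_one_sub (R := R) p
    have hderiv : derivative R (X * treeSeries R (p + 1)) = treeSeries R (p + 1) +
        X * (treeSeries R (p + 1) ^ 2 * derivative R (X * treeSeries R p)) := by
      rw [Derivation.leibniz, derivative_X, derivative_treeSeries_succ, smul_eq_mul, smul_eq_mul]
      ring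
    rw [hderiv]
    generalize X * treeSeries R p = x at *
    generalize treeSeries R (p + 1) = v at *
    push_cast
    linear_combination X * v ^ 2 * ih +
      ((p + 2 : R⟦X⟧) * X * (1 - v * x) - 2 * X ^ 2 * v) * hinv

end GeneratingFunction

section PathCount

open PowerSeries Real

theorem two_mul_sin_half_mul_sum_cos (a : ℝ) (m : ℕ) :
    2 * sin (a / 2) * ∑ k ∈ Finset.range m, cos ((k + 1 : ℕ) * a) =
      sin (m * a + a / 2) - sin (a / 2) := by
  induction m with
  | zero => simp
  | succ m ih =>
    have shift : (m : ℝ) * a + a / 2 = (m + 1 : ℕ) * a - a / 2 := by push_cast; ring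
    rw [Finset.sum_range_succ, mul_add, ih, shift, sin_sub, sin_add]
    ring

theorem sum_cos_nat_mul_pi_div {M j : ℕ} (hj : 0 < j) (hjM : j < 2 * M) :
    ∑ k ∈ Finset.range M, cos ((k + 1 : ℕ) * (j * π / M)) = ((-1) ^ j - 1) / 2 := by
  have hM : (0 : ℝ) < M := by exact_mod_cast (by omega : 0 < M)
  set a : ℝ := j * π / M with ha
  have hsin : sin (a / 2) ≠ 0 := by
    refine (sin_pos_of_pos_of_lt_pi (by positivity) ?_).ne'
    have hlt : (j : ℝ) < 2 * M := by exact_mod_cast hjM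
    rw [ha, div_div, div_lt_iff₀ (by positivity)]
    nlinarith [pi_pos]
  have hdirichlet := two_mul_sin_half_mul_sum_cos a M
  rw [show (M : ℝ) * a = j * π by rw [ha]; field_simp, sin_add, sin_nat_mul_pi,
    cos_nat_mul_pi] at hdirichlet
  exact mul_left_cancel₀ (mul_ne_zero two_ne_zero hsin) (by linear_combination hdirichlet)

/-- For `i + 2 ≤ M`, the number of nearest neighbour paths of length `t` from `0` to `i` in
`{0, …, M - 2}`, given by the spectral decomposition of the adjacency matrix of that path graph. -/
noncomputable def pathCount (M i t : ℕ) : ℝ :=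
  2 / M * ∑ k ∈ Finset.range M, sin ((k + 1 : ℕ) * (π / M)) *
    sin ((k + 1 : ℕ) * ((i + 1) * π / M)) * (2 * cos ((k + 1 : ℕ) * (π / M))) ^ t

theorem pathCount_zero {M i : ℕ} (hi : i + 2 ≤ M) :
    pathCount M i 0 = if i = 0 then 1 else 0 := by
  have hM : (M : ℝ) ≠ 0 := by exact_mod_cast (by omega : M ≠ 0)
  have product_to_sum : ∀ k : ℕ, sin ((k + 1 : ℕ) * (π / M)) *
      sin ((k + 1 : ℕ) * ((i + 1) * π / M)) * (2 * cos ((k + 1 : ℕ) * (π / M))) ^ 0 =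
      (cos ((k + 1 : ℕ) * (i * π / M)) - cos ((k + 1 : ℕ) * ((i + 2 : ℕ) * π / M))) / 2 := by
    intro k
    have hsub : ((k + 1 : ℕ) : ℝ) * (i * π / M) =
      (k + 1 : ℕ) * ((i + 1) * π / M) - (k + 1 : ℕ) * (π / M) := by ring
    have hadd : ((k + 1 : ℕ) : ℝ) * ((i + 2 : ℕ) * π / M) =
      (k + 1 : ℕ) * ((i + 1) * π / M) + (k + 1 : ℕ) * (π / M) := by push_cast; ring
    rw [hsub, hadd, cos_sub, cos_add]
    ring
  rw [pathCount, Finset.sum_congr rfl fun k _ => product_to_sum k, ← Finset.sum_div,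
    Finset.sum_sub_distrib, sum_cos_nat_mul_pi_div (j := i + 2) (by omega) (by omega)]
  split_ifs with hi0
  · subst hi0
    simp [hM]
  · rw [sum_cos_nat_mul_pi_div (by omega) (by omega), pow_add]
    simp

theorem pathCount_eq_zero {M i : ℕ} (hi : i + 1 = M) (t : ℕ) : pathCount M i t = 0 := by
  have hangle : ((i : ℝ) + 1) * π / M = π := by
    rw [← hi]
    push_cast
    field_simp
  rw [pathCount, Finset.sum_eq_zero, mul_zero]
  intro k _
  rw [hangle, sin_nat_mul_pi]
  simp

theorem pathCount_succ_succ (M i t : ℕ) :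
    pathCount M (i + 1) (t + 1) = pathCount M i t + pathCount M (i + 2) t := by
  simp only [pathCount]
  rw [← mul_add, ← Finset.sum_add_distrib]
  congr 1
  refine Finset.sum_congr rfl fun k _ => ?_
  have hsub : ((k + 1 : ℕ) : ℝ) * ((i + 1) * π / M) =
      (k + 1 : ℕ) * (((i + 1 : ℕ) + 1) * π / M) - (k + 1 : ℕ) * (π / M) := by push_cast; ring
  have hadd : ((k + 1 : ℕ) : ℝ) * (((i + 2 : ℕ) + 1) * π / M) =
      (k + 1 : ℕ) * (((i + 1 : ℕ) + 1) * π / M) + (k + 1 : ℕ) * (π / M) := by push_cast; ring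
  rw [hsub, hadd, sin_sub, sin_add]
  ring

theorem pathCount_zero_succ (M t : ℕ) : pathCount M 0 (t + 1) = pathCount M 1 t := by
  simp only [pathCount]
  congr 1
  refine Finset.sum_congr rfl fun k _ => ?_
  have hsimple : ((k + 1 : ℕ) : ℝ) * (((0 : ℕ) + 1) * π / M) = (k + 1 : ℕ) * (π / M) := by
    push_cast; ring
  have hdouble : ((k + 1 : ℕ) : ℝ) * (((1 : ℕ) + 1) * π / M) = 2 * ((k + 1 : ℕ) * (π / M)) := by
    push_cast; ring
  rw [hsimple, hdouble, sin_two_mul]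
  ring

/-- The generating function, by length, of the paths counted by `pathCount M i`. -/
noncomputable def pathSeries (M i : ℕ) : ℝ⟦X⟧ := PowerSeries.mk (pathCount M i)

theorem pathSeries_succ {M i : ℕ} (h : i + 3 ≤ M) :
    pathSeries M (i + 1) = X * pathSeries M i + X * pathSeries M (i + 2) := by
  ext t
  cases t with
  | zero => simp [pathSeries, pathCount_zero (show i + 1 + 2 ≤ M by omega)]
  | succ t => simp [pathSeries, coeff_succ_X_mul, pathCount_succ_succ]

theorem pathSeries_zero {M : ℕ} (h : 2 ≤ M) : pathSeries M 0 = 1 + X * pathSeries M 1 := by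
  ext t
  cases t with
  | zero => simp [pathSeries, pathCount_zero (show 0 + 2 ≤ M by omega)]
  | succ t => simp [pathSeries, coeff_succ_X_mul, pathCount_zero_succ, coeff_one]

theorem pathSeries_eq_zero {M i : ℕ} (h : i + 1 = M) : pathSeries M i = 0 := by
  ext t
  simp [pathSeries, pathCount_eq_zero h]

theorem expand_treeSeries_succ (p : ℕ) :
    expand 2 two_ne_zero (treeSeries ℝ (p + 1)) =
      1 + X ^ 2 * expand 2 two_ne_zero (treeSeries ℝ p) *
        expand 2 two_ne_zero (treeSeries ℝ (p + 1)) := by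
  conv_lhs => rw [treeSeries_succ]
  simp

/-- Last passage decomposition: a path reaching `i + 1` is a path to `i`, a last step upwards, and
an excursion above `i + 1`, which is coded by a tree with half as many edges as it has steps. -/
theorem pathSeries_succ_eq_X_mul (a : ℕ) : ∀ i : ℕ,
    pathSeries (a + i + 3) (i + 1) =
      X * expand 2 two_ne_zero (treeSeries ℝ a) * pathSeries (a + i + 3) i := by
  induction a with
  | zero =>
    intro i
    rw [pathSeries_succ (by omega), pathSeries_eq_zero (i := i + 2) (by omega)]
    simp [treeSeries_zero]
  | succ a ih =>
    intro i
    have hnext := ih (i + 1)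
    rw [show a + (i + 1) + 3 = a + 1 + i + 3 by omega] at hnext
    have hstep := pathSeries_succ (show i + 3 ≤ a + 1 + i + 3 by omega)
    rw [hnext] at hstep
    linear_combination (expand 2 two_ne_zero (treeSeries ℝ (a + 1))) * hstep -
      pathSeries (a + 1 + i + 3) (i + 1) * expand_treeSeries_succ a

theorem pathSeries_zero_eq_expand_treeSeries (p : ℕ) :
    pathSeries (p + 2) 0 = expand 2 two_ne_zero (treeSeries ℝ p) := by
  have hzero := pathSeries_zero (show 2 ≤ p + 2 by omega)
  cases p with
  | zero => rw [hzero, pathSeries_eq_zero (by norm_num), treeSeries_zero]; simp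
  | succ p =>
    rw [pathSeries_succ_eq_X_mul p 0] at hzero
    linear_combination (expand 2 two_ne_zero (treeSeries ℝ (p + 1))) * hzero -
      pathSeries (p + 3) 0 * expand_treeSeries_succ p

theorem coeff_treeSeries (p n : ℕ) : coeff n (treeSeries ℝ p) = pathCount (p + 2) 0 (2 * n) := by
  rw [← coeff_expand_mul 2 two_ne_zero, ← pathSeries_zero_eq_expand_treeSeries, pathSeries,
    coeff_mk]

end PathCount

section ForestWeight

open PowerSeries

theorem treeSeries_pow_riccati {R : Type*} [CommRing R] (p K : ℕ) :
    X * (4 * X - 1) * derivative R ((X * treeSeries R p) ^ (K + 1)) = (K + 1 : R⟦X⟧) *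
      (2 * (X * (X * treeSeries R p) ^ (K + 1)) - X * (X * treeSeries R p) ^ K +
        (p + 2 : R⟦X⟧) * ((X * treeSeries R p) ^ (K + 2) - (X * treeSeries R p) ^ (K + 1) +
          X * (X * treeSeries R p) ^ K)) := by
  rw [Derivation.leibniz_pow]
  simp only [smul_eq_mul, nsmul_eq_mul, Nat.add_sub_cancel]
  push_cast
  linear_combination ((K + 1 : R⟦X⟧) * (X * treeSeries R p) ^ K) * treeSeries_riccati (R := R) p

theorem coeff_X_mul_four_X_sub_one_mul_derivative {R : Type*} [CommRing R] (f : R⟦X⟧) (m : ℕ) :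
    coeff (m + 2) (X * (4 * X - 1) * derivative R f) =
      4 * (((m : R) + 1) * coeff (m + 1) f) - ((m : R) + 2) * coeff (m + 2) f := by
  have hC : (4 : R⟦X⟧) = C (4 : R) := (map_ofNat _ 4).symm
  rw [show X * (4 * X - 1) * derivative R f = X * (4 * (X * derivative R f) - derivative R f) by
    ring, hC, coeff_succ_X_mul, map_sub, coeff_C_mul, coeff_succ_X_mul, coeff_derivative,
    coeff_derivative]
  push_cast
  ring

theorem coeff_treeSeries_pow_recurrence {R : Type*} [CommRing R] (p K m : ℕ) :
    4 * (((m : R) + 1) * coeff (m + 1) ((X * treeSeries R p) ^ (K + 1))) -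
        ((m : R) + 2) * coeff (m + 2) ((X * treeSeries R p) ^ (K + 1)) =
      ((K : R) + 1) * (2 * coeff (m + 1) ((X * treeSeries R p) ^ (K + 1)) -
        coeff (m + 1) ((X * treeSeries R p) ^ K) +
        ((p : R) + 2) * (coeff (m + 2) ((X * treeSeries R p) ^ (K + 2)) -
          coeff (m + 2) ((X * treeSeries R p) ^ (K + 1)) +
          coeff (m + 1) ((X * treeSeries R p) ^ K))) := by
  have hK : (K + 1 : R⟦X⟧) = C (K + 1 : R) := by simp
  have hp : (p + 2 : R⟦X⟧) = C (p + 2 : R) := by simp [map_ofNat]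
  have h2 : (2 : R⟦X⟧) = C (2 : R) := (map_ofNat _ 2).symm
  rw [← coeff_X_mul_four_X_sub_one_mul_derivative, treeSeries_pow_riccati, hK, hp, coeff_C_mul,
    map_add, map_sub, coeff_C_mul, map_add, map_sub, coeff_succ_X_mul, h2, coeff_C_mul,
    coeff_succ_X_mul]

/-- The coefficient of `X ^ n` in `treeSeries ℝ p ^ K`, which grows like `4 ^ n`, normalised by
`4 ^ (n + K)`; the additional factor `4 ^ K` makes `forestWeight_add` an exact convolution. -/
noncomputable def forestWeight (K n p : ℕ) : ℝ :=
  (1 / 4) ^ (n + K) * coeff n (treeSeries ℝ p ^ K)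

theorem forestWeight_nonneg (K n p : ℕ) : 0 ≤ forestWeight K n p := by
  rw [forestWeight, coeff_treeSeries_pow_eq_natCast]
  positivity

theorem forestWeight_zero (n p : ℕ) : forestWeight 0 n p = if n = 0 then 1 else 0 := by
  rw [forestWeight, pow_zero, coeff_one]
  split_ifs with h <;> simp [h]

theorem forestWeight_add (K L n p : ℕ) :
    forestWeight (K + L) n p = ∑ x ∈ Finset.HasAntidiagonal.antidiagonal n,
      forestWeight K x.1 p * forestWeight L x.2 p := by
  simp only [forestWeight]
  rw [pow_add (treeSeries ℝ p), coeff_mul, Finset.mul_sum]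
  refine Finset.sum_congr rfl fun x hx => ?_
  rw [← Finset.HasAntidiagonal.mem_antidiagonal.1 hx]
  ring

theorem coeff_X_mul_treeSeries_pow (K m p : ℕ) :
    coeff (m + K) ((X * treeSeries ℝ p) ^ K) = 4 ^ (m + K) * forestWeight K m p := by
  rw [mul_pow, coeff_X_pow_mul, forestWeight, ← mul_assoc, ← mul_pow]
  norm_num

theorem forestWeight_recurrence (K n p : ℕ) :
    (n + K + 1) * forestWeight (K + 1) n p - (n + K + 2) * forestWeight (K + 1) (n + 1) p =
      (K + 1) * (forestWeight (K + 1) n p / 2 - forestWeight K (n + 1) p / 4 +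
        (p + 2) * (forestWeight (K + 2) n p - forestWeight (K + 1) (n + 1) p +
          forestWeight K (n + 1) p / 4)) := by
  have hrec := coeff_treeSeries_pow_recurrence (R := ℝ) p K (n + K)
  have c₁ := coeff_X_mul_treeSeries_pow (K + 1) n p
  have c₂ := coeff_X_mul_treeSeries_pow (K + 1) (n + 1) p
  have c₃ := coeff_X_mul_treeSeries_pow K (n + 1) p
  have c₄ := coeff_X_mul_treeSeries_pow (K + 2) n p
  rw [show n + (K + 1) = n + K + 1 by ring] at c₁
  rw [show n + 1 + (K + 1) = n + K + 2 by ring] at c₂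
  rw [show n + 1 + K = n + K + 1 by ring] at c₃
  rw [show n + (K + 2) = n + K + 2 by ring] at c₄
  rw [c₁, c₂, c₃, c₄, pow_succ (4 : ℝ) (n + K + 1)] at hrec
  refine mul_left_cancel₀ (show (4 : ℝ) ^ (n + K + 1) ≠ 0 by positivity) ?_
  push_cast at hrec
  linear_combination hrec / 4

theorem forestWeight_add_two (K n p : ℕ) :
    forestWeight (K + 2) n p = forestWeight (K + 1) (n + 1) p - forestWeight K (n + 1) p / 4 +
      1 / (p + 2) * (-((n + K + 2) * (forestWeight (K + 1) (n + 1) p - forestWeight (K + 1) n p) +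
        forestWeight (K + 1) n p) / (K + 1) - forestWeight (K + 1) n p / 2 +
        forestWeight K (n + 1) p / 4) := by
  have hp : (p : ℝ) + 2 ≠ 0 := by positivity
  have hK : (K : ℝ) + 1 ≠ 0 := by positivity
  field_simp
  linear_combination (-8) * forestWeight_recurrence K n p

end ForestWeight

section CosineBounds

open Real

theorem antitoneOn_exp_sq_div_two_mul_cos :
    AntitoneOn (fun x : ℝ => exp (x ^ 2 / 2) * cos x) (Set.Icc 0 (π / 2)) := by
  refine antitoneOn_of_deriv_nonpos (convex_Icc _ _) (by fun_prop) (by fun_prop) fun y hy => ?_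
  rw [interior_Icc] at hy
  have hderiv : HasDerivAt (fun x : ℝ => exp (x ^ 2 / 2) * cos x)
      (exp (y ^ 2 / 2) * (2 * y / 2) * cos y + exp (y ^ 2 / 2) * (-sin y)) y := by
    refine HasDerivAt.mul (HasDerivAt.exp ?_) (hasDerivAt_cos y)
    simpa using (hasDerivAt_pow 2 y).div_const 2
  have hcos : 0 < cos y := cos_pos_of_mem_Ioo ⟨by linarith [hy.1, pi_pos], hy.2⟩
  have hle_sin : y * cos y < sin y := by
    rw [← lt_div_iff₀ hcos, ← tan_eq_sin_div_cos]
    exact lt_tan hy.1 hy.2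
  rw [hderiv.deriv]
  nlinarith [exp_pos (y ^ 2 / 2)]

theorem cos_le_exp_neg_sq_div_two {x : ℝ} (h0 : 0 ≤ x) (h1 : x ≤ π / 2) :
    cos x ≤ exp (-x ^ 2 / 2) := by
  have hle := antitoneOn_exp_sq_div_two_mul_cos ⟨le_rfl, by positivity⟩ ⟨h0, h1⟩ h0
  norm_num at hle
  rwa [neg_div, exp_neg, ← one_div, le_div_iff₀ (exp_pos _), mul_comm]

theorem cos_sq_le_cos_sq {x a : ℝ} (ha : 0 ≤ a) (h1 : a ≤ x) (h2 : x ≤ π - a) :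
    cos x ^ 2 ≤ cos a ^ 2 := by
  refine sq_le_sq.2 (le_trans (abs_le.2 ⟨?_, ?_⟩) (le_abs_self _))
  · rw [← cos_pi_sub]
    exact cos_le_cos_of_nonneg_of_le_pi (by linarith) (by linarith) h2
  · exact cos_le_cos_of_nonneg_of_le_pi ha (by linarith) h1

theorem pi_div_add_two_le_pi_div_two (p : ℕ) : π / (p + 2) ≤ π / 2 := by
  gcongr
  linarith [p.cast_nonneg (α := ℝ)]

theorem cos_sq_pow_le_exp {x : ℝ} (h0 : 0 ≤ x) (h1 : x ≤ π / 2) (n : ℕ) :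
    (cos x ^ 2) ^ n ≤ exp (-(n * x ^ 2)) := by
  have hcos : 0 ≤ cos x := cos_nonneg_of_mem_Icc ⟨by linarith [pi_pos], h1⟩
  calc (cos x ^ 2) ^ n ≤ (exp (-x ^ 2 / 2) ^ 2) ^ n := by
        gcongr
        exact cos_le_exp_neg_sq_div_two h0 h1
    _ = exp (-(n * x ^ 2)) := by
      rw [← exp_nat_mul, ← exp_nat_mul]
      congr 1
      push_cast
      ring

theorem cos_sq_le_cos_sq_pi_div {p k : ℕ} (hk : k ≤ p) :
    cos ((k + 1) * (π / (p + 2))) ^ 2 ≤ cos (π / (p + 2)) ^ 2 := by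
  have ha : 0 < π / ((p : ℝ) + 2) := by positivity
  have hpa : ((p : ℝ) + 2) * (π / (p + 2)) = π := by field_simp
  have hk' : (k : ℝ) ≤ p := by exact_mod_cast hk
  exact cos_sq_le_cos_sq ha.le (by nlinarith [k.cast_nonneg (α := ℝ)]) (by nlinarith)

end CosineBounds

section ForestWeightBounds

open Real

theorem forestWeight_one (n p : ℕ) :
    forestWeight 1 n p = 1 / (2 * (p + 2)) * ∑ k ∈ Finset.range (p + 1),
      sin ((k + 1) * (π / (p + 2))) ^ 2 * (cos ((k + 1) * (π / (p + 2))) ^ 2) ^ n := by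
  have hp : (p : ℝ) + 2 ≠ 0 := by positivity
  have hlast : sin ((p + 1 + 1 : ℕ) * (π / (p + 2 : ℕ))) = 0 := by
    rw [← sin_pi]
    congr 1
    push_cast
    field_simp
    ring
  rw [forestWeight, pow_one, coeff_treeSeries, pathCount, Finset.sum_range_succ, hlast, zero_mul,
    zero_mul, add_zero, ← mul_assoc, Finset.mul_sum, Finset.mul_sum]
  refine Finset.sum_congr rfl fun k _ => ?_
  have hangle : ((k + 1 : ℕ) : ℝ) * (((0 : ℕ) + 1) * π / (p + 2 : ℕ)) =
      (k + 1) * (π / (p + 2)) := by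
    push_cast; ring
  have h4 : (4 : ℝ) ^ n ≠ 0 := by positivity
  rw [hangle]
  push_cast
  rw [mul_pow, pow_mul, pow_mul, pow_succ, one_div, inv_pow]
  norm_num
  field_simp
  norm_num

theorem forestWeight_one_le (n p : ℕ) :
    forestWeight 1 n p ≤ exp (-(n * (π / (p + 2)) ^ 2)) := by
  have hsum : ∑ k ∈ Finset.range (p + 1), sin ((k + 1) * (π / (p + 2))) ^ 2 *
      (cos ((k + 1) * (π / (p + 2))) ^ 2) ^ n ≤
        ((p + 1 : ℕ) : ℝ) * (cos (π / (p + 2)) ^ 2) ^ n := by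
    rw [← nsmul_eq_mul]
    refine (Finset.sum_le_card_nsmul _ _ ((cos (π / (p + 2)) ^ 2) ^ n) fun k hk => ?_).trans_eq
      (by rw [Finset.card_range])
    have hcos := cos_sq_le_cos_sq_pi_div (Nat.lt_succ_iff.1 (Finset.mem_range.1 hk))
    exact (mul_le_of_le_one_left (by positivity) (sin_sq_le_one _)).trans
      (pow_le_pow_left₀ (sq_nonneg _) hcos n)
  rw [forestWeight_one]
  calc _ ≤ 1 / (2 * ((p : ℝ) + 2)) * (((p + 1 : ℕ) : ℝ) * (cos (π / (p + 2)) ^ 2) ^ n) := by gcongr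
    _ = ((p + 1) / (2 * ((p : ℝ) + 2))) * (cos (π / (p + 2)) ^ 2) ^ n := by push_cast; ring
    _ ≤ 1 * (cos (π / (p + 2)) ^ 2) ^ n := by
      gcongr
      rw [div_le_one (by positivity)]
      linarith [p.cast_nonneg (α := ℝ)]
    _ ≤ _ := by
      rw [one_mul]
      exact cos_sq_pow_le_exp (by positivity) (pi_div_add_two_le_pi_div_two p) n

theorem forestWeight_le (K n p : ℕ) :
    forestWeight K n p ≤ (n + 1) ^ K * exp (-(n * (π / (p + 2)) ^ 2)) := by
  induction K generalizing n with
  | zero =>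
    rw [forestWeight_zero]
    split_ifs with h
    · simp [h]
    · positivity
  | succ K ih =>
    rw [forestWeight_add, pow_succ', mul_assoc]
    have hterm : ∀ x ∈ Finset.HasAntidiagonal.antidiagonal n,
        forestWeight K x.1 p * forestWeight 1 x.2 p ≤
          ((n : ℝ) + 1) ^ K * exp (-(n * (π / (p + 2)) ^ 2)) := by
      intro x hx
      have hx' := Finset.HasAntidiagonal.mem_antidiagonal.1 hx
      have hx₁ : (x.1 : ℝ) ≤ n := by exact_mod_cast (by omega : x.1 ≤ n)
      have hexp : exp (-(n * (π / ((p : ℝ) + 2)) ^ 2)) =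
          exp (-(x.1 * (π / (p + 2)) ^ 2)) * exp (-(x.2 * (π / (p + 2)) ^ 2)) := by
        rw [← exp_add, ← hx']
        congr 1
        push_cast
        ring
      rw [hexp, ← mul_assoc]
      refine mul_le_mul ((ih x.1).trans ?_) (forestWeight_one_le x.2 p)
        (forestWeight_nonneg _ _ _) (by positivity)
      gcongr
    refine (Finset.sum_le_card_nsmul _ _ _ hterm).trans_eq ?_
    rw [Finset.Nat.card_antidiagonal, nsmul_eq_mul]
    push_cast
    ring

end ForestWeightBounds

section ForwardDifference

open fwdDiff

variable {R : Type*} [CommRing R]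

theorem fwdDiff_iter_geometric (j : ℕ) (a : R) (n : ℕ) :
    Δ_[1] ^[j] (fun n : ℕ => a ^ n) n = (a - 1) ^ j * a ^ n := by
  induction j generalizing n with
  | zero => simp
  | succ j ih => simp only [Function.iterate_succ_apply', fwdDiff, ih]; ring

theorem fwdDiff_iter_natCast_mul (j : ℕ) (f : ℕ → R) (n : ℕ) :
    Δ_[1] ^[j] (fun n : ℕ => n * f n) n = n * Δ_[1] ^[j] f n + j * Δ_[1] ^[j - 1] f (n + 1) := by
  induction j generalizing n with
  | zero => simp
  | succ j ih =>
    rw [Function.iterate_succ_apply', fwdDiff, ih, ih]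
    cases j with
    | zero => simp [fwdDiff]; ring
    | succ j =>
      simp only [Nat.add_sub_cancel, Function.iterate_succ_apply', fwdDiff]
      push_cast
      ring

end ForwardDifference

section ScalingLimit

open Real fwdDiff

/-- The contribution to `forestWeight 1 n p` of the frequencies `π / (p + 2)` and
`π - π / (p + 2)`, the two slowest modes in the spectral formula `forestWeight_one`. -/
noncomputable def leadingMode (n p : ℕ) : ℝ :=
  1 / (p + 2) * sin (π / (p + 2)) ^ 2 * (cos (π / (p + 2)) ^ 2) ^ n

/-- The regime `n → ∞`, `n / (p + 2) ^ 3 → ρ`, as a filter on the pairs `(n, p)`: the heights `p`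
that contribute to trees with `n` edges are of order `n ^ (1 / 3)`. -/
noncomputable def cubicRegime (ρ : ℝ) : Filter (ℕ × ℕ) :=
  comap (fun x : ℕ × ℕ => x.1) atTop ⊓ comap (fun x : ℕ × ℕ => (x.1 : ℝ) / (x.2 + 2) ^ 3) (𝓝 ρ)

theorem tendsto_fst_cubicRegime (ρ : ℝ) :
    Tendsto (fun x : ℕ × ℕ => x.1) (cubicRegime ρ) atTop :=
  tendsto_comap.mono_left inf_le_left

theorem tendsto_ratio_cubicRegime (ρ : ℝ) :
    Tendsto (fun x : ℕ × ℕ => (x.1 : ℝ) / (x.2 + 2) ^ 3) (cubicRegime ρ) (𝓝 ρ) :=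
  tendsto_comap.mono_left inf_le_right

theorem tendsto_snd_cubicRegime {ρ : ℝ} (hρ : 0 < ρ) :
    Tendsto (fun x : ℕ × ℕ => (x.2 : ℝ) + 2) (cubicRegime ρ) atTop := by
  rw [tendsto_atTop]
  intro b
  have hratio := (tendsto_ratio_cubicRegime ρ).eventually
    (gt_mem_nhds (show ρ < 2 * ρ by linarith))
  have hfst := (tendsto_natCast_atTop_atTop (R := ℝ)).comp (tendsto_fst_cubicRegime ρ)
  filter_upwards [hratio, hfst.eventually_ge_atTop (2 * ρ * |b| ^ 3)] with x hx hxb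
  have hM : (0 : ℝ) < (x.2 : ℝ) + 2 := by positivity
  rw [div_lt_iff₀ (by positivity)] at hx
  have hcube : |b| ^ 3 < ((x.2 : ℝ) + 2) ^ 3 :=
    lt_of_mul_lt_mul_left (hxb.trans_lt hx) (by positivity)
  exact (le_abs_self b).trans (lt_of_pow_lt_pow_left₀ 3 hM.le hcube).le

theorem tendsto_inv_snd_cubicRegime {ρ : ℝ} (hρ : 0 < ρ) :
    Tendsto (fun x : ℕ × ℕ => 1 / ((x.2 : ℝ) + 2)) (cubicRegime ρ) (𝓝 0) := by
  simp only [one_div]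
  exact (tendsto_snd_cubicRegime hρ).inv_tendsto_atTop

/-- `f n p` is asymptotic to `ℓ` times the leading mode in the cubic regime, together with all its
iterated differences in `n`: these behave as those of `exp (-n π² / (p + 2)²)`. Control of the
differences is what allows one to multiply by `n`. -/
def IsModeLike (ρ ℓ : ℝ) (f : ℕ → ℕ → ℝ) : Prop :=
  ∀ j : ℕ, Tendsto (fun x : ℕ × ℕ => ((x.2 : ℝ) + 2) ^ (2 * j) *
    Δ_[1] ^[j] (f · x.2) x.1 / leadingMode x.1 x.2) (cubicRegime ρ) (𝓝 ((-π ^ 2) ^ j * ℓ))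

variable {ρ ℓ ℓ' : ℝ} {f g : ℕ → ℕ → ℝ}

theorem IsModeLike.add (hf : IsModeLike ρ ℓ f) (hg : IsModeLike ρ ℓ' g) :
    IsModeLike ρ (ℓ + ℓ') fun n p => f n p + g n p := by
  intro j
  convert (hf j).add (hg j) using 1
  · ext x
    have hadd := congrFun (fwdDiff_iter_add 1 (f · x.2) (g · x.2) j) x.1
    rw [Pi.add_apply] at hadd
    rw [← add_div, ← mul_add, ← hadd]
    rfl
  · ring_nf

theorem IsModeLike.mul_left (hf : IsModeLike ρ ℓ f) {c : ℕ → ℝ} {a : ℝ}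
    (hc : Tendsto (fun x : ℕ × ℕ => c x.2) (cubicRegime ρ) (𝓝 a)) :
    IsModeLike ρ (a * ℓ) fun n p => c p * f n p := by
  intro j
  convert hc.mul (hf j) using 1
  · ext x
    have hsmul := congrFun (fwdDiff_iter_const_smul 1 (c x.2) (f · x.2) j) x.1
    rw [Pi.smul_apply, smul_eq_mul] at hsmul
    rw [← mul_div_assoc, mul_left_comm, ← hsmul]
    rfl
  · ring_nf

theorem IsModeLike.const_mul (hf : IsModeLike ρ ℓ f) (a : ℝ) :
    IsModeLike ρ (a * ℓ) fun n p => a * f n p :=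
  hf.mul_left tendsto_const_nhds

theorem IsModeLike.tendsto_pow_mul_fwdDiff (hρ : 0 < ρ) (hf : IsModeLike ρ ℓ f) {i j : ℕ}
    (hij : i < 2 * j) :
    Tendsto (fun x : ℕ × ℕ => ((x.2 : ℝ) + 2) ^ i * Δ_[1] ^[j] (f · x.2) x.1 /
      leadingMode x.1 x.2) (cubicRegime ρ) (𝓝 0) := by
  have hlim := ((tendsto_inv_snd_cubicRegime hρ).pow (2 * j - i)).mul (hf j)
  rw [zero_pow (by omega), zero_mul] at hlim
  refine hlim.congr fun x => ?_
  have hpow : ((x.2 : ℝ) + 2) ^ (2 * j) = (x.2 + 2) ^ i * (x.2 + 2) ^ (2 * j - i) := by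
    rw [← pow_add]
    congr 1
    omega
  rw [hpow, one_div, inv_pow]
  field_simp

theorem IsModeLike.comp_succ (hρ : 0 < ρ) (hf : IsModeLike ρ ℓ f) :
    IsModeLike ρ ℓ fun n p => f (n + 1) p := by
  intro j
  have hlim := (hf j).add (hf.tendsto_pow_mul_fwdDiff hρ (show 2 * j < 2 * (j + 1) by omega))
  rw [add_zero] at hlim
  refine hlim.congr fun x => ?_
  rw [fwdDiff_iter_comp_add 1 (f · x.2), Function.iterate_succ_apply', fwdDiff]
  ring

theorem IsModeLike.comp_add (hρ : 0 < ρ) (hf : IsModeLike ρ ℓ f) (s : ℕ) :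
    IsModeLike ρ ℓ fun n p => f (n + s) p := by
  induction s with
  | zero => exact hf
  | succ s ih => simpa only [Nat.add_right_comm _ 1 s, ← Nat.add_assoc] using ih.comp_succ hρ

theorem IsModeLike.diff_div (hρ : 0 < ρ) (hf : IsModeLike ρ ℓ f) :
    IsModeLike ρ 0 fun n p => 1 / ((p : ℝ) + 2) * (f (n + 1) p - f n p) := by
  simpa only [zero_mul, neg_one_mul, neg_add_cancel, ← sub_eq_add_neg] using
    ((hf.comp_succ hρ).add (hf.const_mul (-1))).mul_left (c := fun p => 1 / ((p : ℝ) + 2))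
      (tendsto_inv_snd_cubicRegime hρ)

theorem IsModeLike.natCast_mul_diff_div (hρ : 0 < ρ) (hf : IsModeLike ρ ℓ f) :
    IsModeLike ρ (-π ^ 2 * ρ * ℓ)
      fun n p => 1 / ((p : ℝ) + 2) * (n * (f (n + 1) p - f n p)) := by
  intro j
  have hmain := (tendsto_ratio_cubicRegime ρ).mul (hf (j + 1))
  have hlower := ((tendsto_inv_snd_cubicRegime hρ).mul ((hf.comp_succ hρ) j)).const_mul (j : ℝ)
  convert hmain.add hlower using 1
  · ext x
    have hM : (x.2 : ℝ) + 2 ≠ 0 := by positivity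
    have hsmul := congrFun (fwdDiff_iter_const_smul 1 (1 / ((x.2 : ℝ) + 2))
      (fun n : ℕ => n * Δ_[1] (f · x.2) n) j) x.1
    rw [Pi.smul_apply, smul_eq_mul, fwdDiff_iter_natCast_mul] at hsmul
    refine (congrArg (fun t => (x.2 + 2 : ℝ) ^ (2 * j) * t / leadingMode x.1 x.2) hsmul).trans ?_
    rw [fwdDiff_iter_comp_add 1 (f · x.2), ← Function.iterate_succ_apply,
      ← Function.iterate_succ_apply]
    cases j with
    | zero =>
      simp only [mul_zero, pow_zero, one_div, Nat.succ_eq_add_one, zero_add, Function.iterate_one,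
        Nat.cast_zero, zero_tsub, zero_mul, add_zero, one_mul, mul_one, Function.iterate_zero,
        id_eq]
      field_simp
    | succ j =>
      simp only [Nat.add_sub_cancel, Nat.succ_eq_add_one]
      field_simp
      ring
  · rw [zero_mul, mul_zero, add_zero, pow_succ]
    ring_nf

theorem tendsto_mul_sin_cubicRegime (hρ : 0 < ρ) :
    Tendsto (fun x : ℕ × ℕ => ((x.2 : ℝ) + 2) * sin (π / (x.2 + 2))) (cubicRegime ρ) (𝓝 π) := by
  have hangle : Tendsto (fun x : ℕ × ℕ => π / ((x.2 : ℝ) + 2)) (cubicRegime ρ) (𝓝 0) := by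
    simpa [div_eq_mul_inv] using (tendsto_inv_snd_cubicRegime hρ).const_mul π
  have hsinc : Tendsto (fun x : ℕ × ℕ => π * sinc (π / ((x.2 : ℝ) + 2))) (cubicRegime ρ)
      (𝓝 (π * sinc 0)) := ((continuous_sinc.tendsto 0).comp hangle).const_mul π
  rw [sinc_zero, mul_one] at hsinc
  refine hsinc.congr fun x => ?_
  rw [sinc_of_ne_zero (by positivity)]
  field_simp

theorem leadingMode_pos {p : ℕ} (hp : 1 ≤ p) (n : ℕ) : 0 < leadingMode n p := by
  have hp' : (1 : ℝ) ≤ p := by exact_mod_cast hp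
  have hpos : 0 < π / ((p : ℝ) + 2) := by positivity
  have hlt : π / ((p : ℝ) + 2) < π / 2 := by
    gcongr
    linarith
  have hsin := sin_pos_of_pos_of_lt_pi hpos (by linarith [pi_pos])
  have hcos := cos_pos_of_mem_Ioo ⟨by linarith [pi_pos], hlt⟩
  rw [leadingMode]
  positivity

theorem fwdDiff_iter_forestWeight_one (j n p : ℕ) :
    Δ_[1] ^[j] (forestWeight 1 · p) n = 1 / (2 * (p + 2)) * ∑ k ∈ Finset.range (p + 1),
      sin ((k + 1) * (π / (p + 2))) ^ 2 * (-sin ((k + 1) * (π / (p + 2))) ^ 2) ^ j *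
        (cos ((k + 1) * (π / (p + 2))) ^ 2) ^ n := by
  have hmodes : (forestWeight 1 · p) = (1 / (2 * ((p : ℝ) + 2))) • ∑ k ∈ Finset.range (p + 1),
      sin ((k + 1) * (π / (p + 2))) ^ 2 •
        fun n : ℕ => (cos ((k + 1) * (π / (p + 2))) ^ 2) ^ n := by
    ext n
    simp [forestWeight_one]
  rw [hmodes, fwdDiff_iter_const_smul, fwdDiff_iter_finsetSum, Pi.smul_apply, Finset.sum_apply,
    smul_eq_mul]
  congr 1
  refine Finset.sum_congr rfl fun k _ => ?_
  rw [fwdDiff_iter_const_smul, Pi.smul_apply, fwdDiff_iter_geometric, smul_eq_mul, cos_sq']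
  ring

theorem fwdDiff_iter_forestWeight_one_sub (j n p : ℕ) :
    Δ_[1] ^[j] (forestWeight 1 · (p + 1)) n -
        (-sin (π / ((p + 1 : ℕ) + 2)) ^ 2) ^ j * leadingMode n (p + 1) =
      1 / (2 * ((p + 1 : ℕ) + 2)) * ∑ k ∈ Finset.range p,
        sin ((k + 2) * (π / ((p + 1 : ℕ) + 2))) ^ 2 *
          (-sin ((k + 2) * (π / ((p + 1 : ℕ) + 2))) ^ 2) ^ j *
            (cos ((k + 2) * (π / ((p + 1 : ℕ) + 2))) ^ 2) ^ n := by
  rw [fwdDiff_iter_forestWeight_one, Finset.sum_range_succ, Finset.sum_range_succ', leadingMode]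
  set a : ℝ := π / ((p + 1 : ℕ) + 2) with ha
  have hlast : ((p + 1 : ℕ) + 1 : ℝ) * a = π - a := by
    rw [ha]
    field_simp
    ring
  rw [hlast, sin_pi_sub, cos_pi_sub, neg_sq]
  push_cast
  simp only [add_assoc, one_add_one_eq_two, zero_add, one_mul]
  generalize (Finset.sum (Finset.range p) _ : ℝ) = S
  field_simp
  ring

theorem cos_two_mul_le_cos_pow_three {a : ℝ} (ha : 0 ≤ cos a) : cos (2 * a) ≤ cos a ^ 3 := by
  rw [cos_two_mul]
  nlinarith [mul_nonneg (sub_nonneg.2 (cos_le_one a))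
    (show 0 ≤ 1 + cos a - cos a ^ 2 by nlinarith [cos_le_one a])]

theorem cos_two_mul_sq_pow_le {a : ℝ} (ha : 0 ≤ a) (ha' : 2 * a ≤ π / 2) (n : ℕ) :
    (cos (2 * a) ^ 2) ^ n ≤ exp (-(2 * n * a ^ 2)) * (cos a ^ 2) ^ n := by
  have hcos : 0 ≤ cos a := cos_nonneg_of_mem_Icc ⟨by linarith [pi_pos], by linarith⟩
  have hcos_two : 0 ≤ cos (2 * a) := cos_nonneg_of_mem_Icc ⟨by linarith [pi_pos], ha'⟩
  calc (cos (2 * a) ^ 2) ^ n ≤ ((cos a ^ 3) ^ 2) ^ n := by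
        gcongr
        exact cos_two_mul_le_cos_pow_three hcos
    _ = (cos a ^ 2) ^ (2 * n) * (cos a ^ 2) ^ n := by ring
    _ ≤ exp (-((2 * n : ℕ) * a ^ 2)) * (cos a ^ 2) ^ n := by
      gcongr
      exact cos_sq_pow_le_exp ha (by linarith) _
    _ = exp (-(2 * n * a ^ 2)) * (cos a ^ 2) ^ n := by push_cast; rfl

theorem two_le_mul_sin_pi_div (p : ℕ) : 2 ≤ ((p : ℝ) + 2) * sin (π / (p + 2)) := by
  have hjordan := mul_le_sin (x := π / ((p : ℝ) + 2)) (by positivity)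
    (pi_div_add_two_le_pi_div_two p)
  calc (2 : ℝ) = (p + 2) * (2 / π * (π / (p + 2))) := by field_simp
    _ ≤ _ := by gcongr

theorem exp_mul_cos_sq_pow_le_leadingMode (p n : ℕ) (t : ℝ) :
    exp t * (cos (π / (p + 2)) ^ 2) ^ n ≤ (p + 2) ^ 3 * exp t * leadingMode n p := by
  have hone : 1 ≤ ((p : ℝ) + 2) ^ 2 * sin (π / (p + 2)) ^ 2 := by
    nlinarith [two_le_mul_sin_pi_div p]
  calc exp t * (cos (π / (p + 2)) ^ 2) ^ n
      ≤ (((p : ℝ) + 2) ^ 2 * sin (π / (p + 2)) ^ 2) *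
          (exp t * (cos (π / (p + 2)) ^ 2) ^ n) :=
        le_mul_of_one_le_left (by positivity) hone
    _ = _ := by
      rw [leadingMode]
      field_simp

theorem abs_fwdDiff_iter_forestWeight_one_sub_le {p : ℕ} (hp : 2 ≤ p) (j n : ℕ) :
    |Δ_[1] ^[j] (forestWeight 1 · p) n - (-sin (π / (p + 2)) ^ 2) ^ j * leadingMode n p| ≤
      ((p + 2) ^ 3 * exp (-(2 * n * (π / (p + 2)) ^ 2))) * leadingMode n p := by
  obtain ⟨q, rfl⟩ : ∃ q, p = q + 1 := ⟨p - 1, by omega⟩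
  refine le_trans ?_ (exp_mul_cos_sq_pow_le_leadingMode (q + 1) n _)
  rw [fwdDiff_iter_forestWeight_one_sub]
  set a : ℝ := π / ((q + 1 : ℕ) + 2) with ha
  have ha_pos : 0 < a := by positivity
  have hpa : ((q : ℝ) + 3) * a = π := by
    rw [ha]
    field_simp
    push_cast
    ring
  have hq : (1 : ℝ) ≤ q := by exact_mod_cast (by omega : 1 ≤ q)
  have ha_le : 2 * a ≤ π / 2 := by nlinarith
  have hmode : ∀ k ∈ Finset.range q, |sin ((k + 2) * a) ^ 2 * (-sin ((k + 2) * a) ^ 2) ^ j *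
      (cos ((k + 2) * a) ^ 2) ^ n| ≤ exp (-(2 * n * a ^ 2)) * (cos a ^ 2) ^ n := by
    intro k hk
    have hk' : (k : ℝ) + 1 ≤ q := by exact_mod_cast Finset.mem_range.1 hk
    have hcos : cos ((k + 2) * a) ^ 2 ≤ cos (2 * a) ^ 2 :=
      cos_sq_le_cos_sq (by linarith) (by nlinarith [k.cast_nonneg (α := ℝ)]) (by nlinarith)
    rw [abs_mul, abs_mul, abs_pow (-_), abs_neg, abs_of_nonneg (sq_nonneg (sin _)),
      abs_of_nonneg (pow_nonneg (sq_nonneg (cos _)) n)]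
    calc _ ≤ 1 * 1 ^ j * (cos (2 * a) ^ 2) ^ n := by
          gcongr <;> exact sin_sq_le_one _
      _ ≤ _ := by simpa using cos_two_mul_sq_pow_le ha_pos.le ha_le n
  rw [abs_mul, abs_of_nonneg (by positivity)]
  calc _ ≤ 1 / (2 * (((q + 1 : ℕ) : ℝ) + 2)) *
        (q * (exp (-(2 * n * a ^ 2)) * (cos a ^ 2) ^ n)) := by
        gcongr
        refine (Finset.abs_sum_le_sum_abs _ _).trans
          ((Finset.sum_le_card_nsmul _ _ _ hmode).trans_eq ?_)
        rw [Finset.card_range, nsmul_eq_mul]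
    _ = (q / (2 * (((q + 1 : ℕ) : ℝ) + 2))) * (exp (-(2 * n * a ^ 2)) * (cos a ^ 2) ^ n) := by ring
    _ ≤ _ := by
      refine mul_le_of_le_one_left (by positivity) ?_
      rw [div_le_one (by positivity)]
      push_cast
      linarith

theorem tendsto_pow_mul_exp_cubicRegime (hρ : 0 < ρ) (m : ℕ) :
    Tendsto (fun x : ℕ × ℕ => ((x.2 : ℝ) + 2) ^ m * exp (-(2 * x.1 * (π / (x.2 + 2)) ^ 2)))
      (cubicRegime ρ) (𝓝 0) := by
  have hexp : Tendsto (fun t : ℝ => t ^ (m : ℝ) * exp (-(π ^ 2 * ρ) * t)) atTop (𝓝 0) :=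
    tendsto_rpow_mul_exp_neg_mul_atTop_nhds_zero _ _ (by positivity)
  refine squeeze_zero' (Eventually.of_forall fun x => by positivity) ?_
    (hexp.comp (tendsto_snd_cubicRegime hρ))
  filter_upwards [(tendsto_ratio_cubicRegime ρ).eventually
    (lt_mem_nhds (show ρ / 2 < ρ by linarith))] with x hx
  rw [lt_div_iff₀ (by positivity)] at hx
  simp only [Function.comp, rpow_natCast]
  gcongr
  rw [neg_mul, neg_le_neg_iff, div_pow, ← mul_div_assoc, le_div_iff₀ (by positivity)]
  nlinarith [sq_pos_of_pos pi_pos]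

theorem isModeLike_forestWeight_one (hρ : 0 < ρ) :
    IsModeLike ρ 1 fun n p => forestWeight 1 n p := by
  intro j
  have hleading : Tendsto (fun x : ℕ × ℕ => ((x.2 : ℝ) + 2) ^ (2 * j) *
      (-sin (π / (x.2 + 2)) ^ 2) ^ j) (cubicRegime ρ) (𝓝 ((-π ^ 2) ^ j * 1)) := by
    rw [mul_one]
    refine (((tendsto_mul_sin_cubicRegime hρ).pow 2).neg.pow j).congr fun x => ?_
    rw [pow_mul, ← mul_pow]
    ring
  refine tendsto_of_tendsto_of_dist hleading (squeeze_zero'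
    (Eventually.of_forall fun x => dist_nonneg) ?_ (tendsto_pow_mul_exp_cubicRegime hρ (2 * j + 3)))
  filter_upwards [(tendsto_snd_cubicRegime hρ).eventually_ge_atTop 4] with x hx
  have hp : 2 ≤ x.2 := by exact_mod_cast (by linarith : (2 : ℝ) ≤ x.2)
  have hpos := leadingMode_pos (show 1 ≤ x.2 by omega) x.1
  have hfactor : ((x.2 : ℝ) + 2) ^ (2 * j) * Δ_[1] ^[j] (forestWeight 1 · x.2) x.1 /
      leadingMode x.1 x.2 - ((x.2 : ℝ) + 2) ^ (2 * j) * (-sin (π / (x.2 + 2)) ^ 2) ^ j =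
      (x.2 + 2) ^ (2 * j) * ((Δ_[1] ^[j] (forestWeight 1 · x.2) x.1 -
        (-sin (π / (x.2 + 2)) ^ 2) ^ j * leadingMode x.1 x.2) / leadingMode x.1 x.2) := by
    field_simp
  rw [dist_comm, dist_eq, hfactor, abs_mul, abs_of_pos (by positivity), abs_div, abs_of_pos hpos,
    pow_add, mul_assoc]
  gcongr
  exact (div_le_iff₀ hpos).2 (abs_fwdDiff_iter_forestWeight_one_sub_le hp j x.1)

theorem isModeLike_forestWeight_zero : IsModeLike ρ 0 fun n p => forestWeight 0 n p := by
  intro j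
  rw [mul_zero]
  refine tendsto_const_nhds.congr' ?_
  filter_upwards [(tendsto_fst_cubicRegime ρ).eventually_ge_atTop 1] with x hx
  have hzero : ∀ j n, 1 ≤ n → Δ_[1] ^[j] (forestWeight 0 · x.2) n = 0 := by
    intro j
    induction j with
    | zero =>
      exact fun n hn => by
        rw [Function.iterate_zero_apply, forestWeight_zero, if_neg (by omega)]
    | succ j ih =>
      exact fun n hn => by
        rw [Function.iterate_succ_apply', fwdDiff, ih _ (by omega), ih _ hn, sub_zero]
  rw [hzero j x.1 hx, mul_zero, zero_div]

/-- The Laguerre-type polynomial `∑_{i ≥ 1} C(K, i) a ^ (i - 1) / (i - 1)!`: up to the factor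
`2 / 2 ^ K`, the limit of `forestWeight K` relative to the leading mode. -/
noncomputable def laguerreSum (a : ℝ) (K : ℕ) : ℝ :=
  ∑ i ∈ Finset.range K, (K.choose (i + 1) : ℝ) * (a ^ i / (i.factorial : ℝ))

theorem laguerreSum_eq {a : ℝ} {K m : ℕ} (h : K ≤ m) : laguerreSum a K =
    ∑ i ∈ Finset.range m, (K.choose (i + 1) : ℝ) * (a ^ i / (i.factorial : ℝ)) := by
  refine Finset.sum_subset (by simpa using h) fun i _ hi => ?_
  rw [Nat.choose_eq_zero_of_lt (by simpa [Nat.lt_succ_iff] using hi), Nat.cast_zero, zero_mul]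

theorem choose_second_difference (K i : ℕ) :
    ((K + 2).choose (i + 1) : ℝ) - 2 * (K + 1).choose (i + 1) + K.choose (i + 1) =
      i * (K + 1).choose i / (K + 1) := by
  have hK : (K : ℝ) + 1 ≠ 0 := by positivity
  have hpascal : ∀ m : ℕ, ((m + 1).choose (i + 1) : ℝ) = m.choose i + m.choose (i + 1) :=
    fun m => by exact_mod_cast Nat.choose_succ_succ m i
  rw [hpascal (K + 1), hpascal K, eq_div_iff hK]
  cases i with
  | zero =>
    push_cast
    simp only [Nat.choose_zero_right, Nat.choose_one_right]
    push_cast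
    ring
  | succ i =>
    have hpascal' : ((K + 1).choose (i + 1) : ℝ) = K.choose i + K.choose (i + 1) := by
      exact_mod_cast Nat.choose_succ_succ K i
    have habsorb : ((K : ℝ) + 1) * K.choose i = (K + 1).choose (i + 1) * (i + 1) := by
      exact_mod_cast Nat.add_one_mul_choose_eq K i
    push_cast
    linear_combination habsorb + (K + 1) * hpascal'

theorem div_mul_laguerreSum (a : ℝ) (K : ℕ) :
    a / (K + 1) * laguerreSum a (K + 1) =
      ∑ i ∈ Finset.range (K + 2), ((i : ℝ) * (K + 1).choose i / (K + 1)) *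
        (a ^ i / (i.factorial : ℝ)) := by
  have hK : (K : ℝ) + 1 ≠ 0 := by positivity
  rw [Finset.sum_range_succ', laguerreSum, Finset.mul_sum]
  simp only [Nat.cast_zero, zero_mul, zero_div, add_zero]
  refine Finset.sum_congr rfl fun i _ => ?_
  rw [Nat.factorial_succ]
  push_cast
  field_simp
  ring

theorem laguerreSum_add_two (a : ℝ) (K : ℕ) :
    laguerreSum a (K + 2) = (2 + a / (K + 1)) * laguerreSum a (K + 1) - laguerreSum a K := by
  rw [add_mul, div_mul_laguerreSum, laguerreSum, laguerreSum_eq (show K + 1 ≤ K + 2 by omega),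
    laguerreSum_eq (show K ≤ K + 2 by omega), Finset.mul_sum, ← Finset.sum_add_distrib,
    ← Finset.sum_sub_distrib]
  refine Finset.sum_congr rfl fun i _ => ?_
  rw [← choose_second_difference]
  ring

theorem isModeLike_forestWeight (hρ : 0 < ρ) (K : ℕ) :
    IsModeLike ρ (2 / 2 ^ K * laguerreSum (2 * π ^ 2 * ρ) K) fun n p => forestWeight K n p := by
  induction K using Nat.twoStepInduction with
  | zero => simpa [laguerreSum] using isModeLike_forestWeight_zero
  | one => simpa [laguerreSum] using isModeLike_forestWeight_one hρ
  | more K ihK ihK1 =>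
    have hK : (K : ℝ) + 1 ≠ 0 := by positivity
    have hinv := tendsto_inv_snd_cubicRegime hρ
    have hterms := (((((ihK1.comp_succ hρ).add ((ihK.comp_succ hρ).const_mul (-1 / 4))).add
      ((ihK1.natCast_mul_diff_div hρ).const_mul (-1 / (K + 1)))).add
      ((ihK1.diff_div hρ).const_mul (-(K + 2) / (K + 1)))).add
      ((ihK1.mul_left (c := fun p => 1 / ((p : ℝ) + 2)) hinv).const_mul (-1 / (K + 1) - 1 / 2))).add
      (((ihK.comp_succ hρ).mul_left (c := fun p => 1 / ((p : ℝ) + 2)) hinv).const_mul (1 / 4))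
    convert hterms using 1
    · rw [laguerreSum_add_two]
      field_simp
      ring
    · ext n p
      have hp : (p : ℝ) + 2 ≠ 0 := by positivity
      rw [forestWeight_add_two]
      field_simp
      ring

end ScalingLimit

section Laplace

open Real

variable {μ : ℝ}

/-- The height `s`, solving `μ s³ = 2 π² n`, at which the exponent `μ s + n (π / s)²` of the
Laplace sums over heights is minimal; the minimum is `3 μ s / 2`. -/
noncomputable def saddleHeight (μ : ℝ) (n : ℕ) : ℝ :=
  (2 * π ^ 2 * n / μ) ^ (1 / 3 : ℝ)

theorem mul_saddleHeight_pow_three (hμ : 0 < μ) (n : ℕ) :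
    μ * saddleHeight μ n ^ 3 = 2 * π ^ 2 * n := by
  rw [saddleHeight, ← rpow_natCast, ← rpow_mul (by positivity)]
  norm_num
  field_simp

theorem tendsto_saddleHeight (hμ : 0 < μ) : Tendsto (saddleHeight μ) atTop atTop :=
  (tendsto_rpow_atTop (by norm_num)).comp <|
    (tendsto_natCast_atTop_atTop.const_mul_atTop (by positivity)).atTop_div_const hμ

theorem exists_exponent_gap {ε : ℝ} (hμ : 0 < μ) (hε : 0 < ε) :
    ∃ κ > 0, ∀ s M : ℝ, 0 < s → 0 < M → ε * s ≤ |M - s| →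
      3 / 2 * μ * s + κ * (s + M) ≤ μ * M + μ * s ^ 3 / (2 * M ^ 2) := by
  set A := 1 / ε + 1 with hA
  set B := 2 / ε + 1 with hB
  refine ⟨μ / (A * B), by positivity, fun s M hs hM hsM => ?_⟩
  set d := |M - s| with hd
  have hs_le : s ≤ d / ε := by rwa [le_div_iff₀ hε, mul_comm]
  have hM_le : M - s ≤ d := le_abs_self _
  have hprod : M * (s + M) ≤ A * B * d ^ 2 := by
    calc M * (s + M) ≤ (d / ε + d) * (2 * (d / ε) + d) :=
          mul_le_mul (by linarith) (by linarith) (by positivity) (by positivity)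
      _ = A * B * d ^ 2 := by rw [hA, hB]; ring
  have hgap : μ / (A * B) * (s + M) ≤ μ * d ^ 2 / M := by
    rw [div_mul_eq_mul_div, div_le_div_iff₀ (by positivity) hM]
    calc μ * (s + M) * M = μ * (M * (s + M)) := by ring
      _ ≤ μ * (A * B * d ^ 2) := by gcongr
      _ = μ * d ^ 2 * (A * B) := by ring
  have hexcess : μ * M + μ * s ^ 3 / (2 * M ^ 2) - 3 / 2 * μ * s =
      μ * d ^ 2 / M + μ * d ^ 2 * s / (2 * M ^ 2) := by
    rw [hd, sq_abs]
    field_simp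
    ring
  have hnonneg : 0 ≤ μ * d ^ 2 * s / (2 * M ^ 2) := by positivity
  linarith

theorem exists_exp_mul_exp_le {ε : ℝ} (hμ : 0 < μ) (hε : 0 < ε) :
    ∃ κ > 0, ∀ n p : ℕ, 0 < saddleHeight μ n →
      ε * saddleHeight μ n ≤ |p + 2 - saddleHeight μ n| →
        exp (-μ * p) * exp (-(n * (π / (p + 2)) ^ 2)) ≤
          exp (2 * μ) * exp (-((3 / 2 * μ + κ) * saddleHeight μ n)) * exp (-κ * p) := by
  obtain ⟨κ, hκ, hgap⟩ := exists_exponent_gap hμ hε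
  refine ⟨κ, hκ, fun n p hs hp => ?_⟩
  have hM : (0 : ℝ) < p + 2 := by positivity
  have hexponent := hgap _ _ hs hM hp
  rw [mul_saddleHeight_pow_three hμ, show 2 * π ^ 2 * n / (2 * ((p : ℝ) + 2) ^ 2) =
    n * (π / (p + 2)) ^ 2 by field_simp] at hexponent
  rw [← exp_add, ← exp_add, ← exp_add]
  refine exp_le_exp.2 ?_
  linarith

theorem exp_neg_le_one_sub {u : ℝ} (hu : u ≤ 1 / 2) : exp (-(u + 2 * u ^ 2)) ≤ 1 - u := by
  have hpos : 0 < 1 - u := by linarith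
  rw [← le_log_iff_exp_le hpos]
  refine le_trans ?_ (one_sub_inv_le_log_of_pos hpos)
  rw [← one_div, le_sub_iff_add_le, ← le_sub_iff_add_le', div_le_iff₀ hpos]
  nlinarith [mul_nonneg (sq_nonneg u) (show 0 ≤ 1 - 2 * u by linarith)]

theorem leadingMode_nonneg (n p : ℕ) : 0 ≤ leadingMode n p := by
  rw [leadingMode]
  positivity

theorem leadingMode_le (n p : ℕ) : leadingMode n p ≤ exp (-(n * (π / (p + 2)) ^ 2)) := by
  have hinv : 1 / ((p : ℝ) + 2) ≤ 1 := by
    rw [div_le_one (by positivity)]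
    linarith [p.cast_nonneg (α := ℝ)]
  rw [leadingMode]
  calc _ ≤ 1 * 1 * exp (-(n * (π / (p + 2)) ^ 2)) := by
        gcongr
        · exact sin_sq_le_one _
        · exact cos_sq_pow_le_exp (by positivity) (pi_div_add_two_le_pi_div_two p) n
    _ = _ := by ring

theorem le_leadingMode {n p : ℕ} (hp : 4 ≤ p) :
    4 / ((p : ℝ) + 2) ^ 3 * exp (-(n * (π / (p + 2)) ^ 2 + 2 * (n * (π / (p + 2)) ^ 4))) ≤
      leadingMode n p := by
  have hp' : (4 : ℝ) ≤ p := by exact_mod_cast hp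
  have hM : (0 : ℝ) < p + 2 := by positivity
  have hsin : 2 / ((p : ℝ) + 2) ≤ sin (π / (p + 2)) := by
    rw [div_le_iff₀' hM]
    exact two_le_mul_sin_pi_div p
  set a : ℝ := π / (p + 2) with ha
  have ha_pos : 0 < a := by positivity
  have ha_sq : a ^ 2 ≤ 1 / 2 := by
    have ha_le : a ≤ 0.7 := by
      rw [ha, div_le_iff₀ hM]
      linarith [pi_lt_d2]
    nlinarith
  have hcos : exp (-(a ^ 2 + 2 * (a ^ 2) ^ 2)) ≤ cos a ^ 2 := by
    refine (exp_neg_le_one_sub ha_sq).trans ?_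
    rw [cos_sq']
    gcongr
    · exact le_trans (by positivity) hsin
    · exact sin_le ha_pos.le
  rw [leadingMode, ← ha]
  calc _ = 1 / ((p : ℝ) + 2) * (2 / (p + 2)) ^ 2 * exp (-(a ^ 2 + 2 * (a ^ 2) ^ 2)) ^ n := by
        rw [← exp_nat_mul, show -(n * a ^ 2 + 2 * (n * a ^ 4)) =
          n * -(a ^ 2 + 2 * (a ^ 2) ^ 2) by ring]
        field_simp
        norm_num
    _ ≤ _ := by gcongr

theorem summable_exp_neg_mul {b : ℝ} (hb : 0 < b) : Summable fun p : ℕ => exp (-b * p) := by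
  simpa only [mul_comm] using summable_exp_nat_mul_iff.2 (neg_lt_zero.2 hb)

theorem summable_exp_neg_mul_mul {b B : ℝ} (hb : 0 < b) {f : ℕ → ℝ} (hf : ∀ p, |f p| ≤ B) :
    Summable fun p : ℕ => exp (-b * p) * f p := by
  refine ((summable_exp_neg_mul hb).mul_right B).of_norm_bounded fun p => ?_
  rw [norm_mul, norm_of_nonneg (exp_pos _).le]
  exact mul_le_mul_of_nonneg_left (hf p) (exp_pos _).le

theorem summable_leadingMode (hμ : 0 < μ) (n : ℕ) :
    Summable fun p : ℕ => exp (-μ * p) * leadingMode n p := by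
  refine summable_exp_neg_mul_mul (B := 1) hμ fun p => ?_
  rw [abs_of_nonneg (leadingMode_nonneg n p)]
  exact (leadingMode_le n p).trans (exp_le_one_iff.2 (neg_nonpos.2 (by positivity)))

theorem tsum_leadingMode_pos (hμ : 0 < μ) (n : ℕ) :
    0 < ∑' p : ℕ, exp (-μ * p) * leadingMode n p :=
  (summable_leadingMode hμ n).tsum_pos
    (fun p => mul_nonneg (exp_pos _).le (leadingMode_nonneg n p)) 1
    (mul_pos (exp_pos _) (leadingMode_pos le_rfl n))

theorem exponent_le_of_saddleHeight_le {n p : ℕ} (hμ : 0 < μ) (hs : 1 ≤ saddleHeight μ n)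
    (hle : saddleHeight μ n ≤ p + 2) (hlt : p + 2 < saddleHeight μ n + 1) :
    μ * p + (n * (π / (p + 2)) ^ 2 + 2 * (n * (π / (p + 2)) ^ 4)) ≤
      3 / 2 * μ * saddleHeight μ n + μ * π ^ 2 := by
  have hcube := mul_saddleHeight_pow_three hμ n
  set s := saddleHeight μ n
  have hsq : n * (π / (p + 2)) ^ 2 ≤ 1 / 2 * μ * s := by
    calc n * (π / (p + 2)) ^ 2 ≤ n * (π / s) ^ 2 := by gcongr
      _ = 1 / 2 * μ * s := by
        field_simp
        linear_combination (-1) * hcube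
  have hfourth : 2 * (n * (π / (p + 2)) ^ 4) ≤ μ * π ^ 2 := by
    calc 2 * (n * (π / (p + 2)) ^ 4) ≤ 2 * (n * (π / s) ^ 4) := by gcongr
      _ = μ * π ^ 2 / s := by
        field_simp
        linear_combination (-1) * hcube
      _ ≤ μ * π ^ 2 := div_le_self (by positivity) hs
  have hlinear : μ * p ≤ μ * s := by
    gcongr
    linarith
  linarith

theorem le_tsum_leadingMode {n : ℕ} (hμ : 0 < μ) (hs : 6 ≤ saddleHeight μ n) :
    exp (-(3 / 2 * μ * saddleHeight μ n + μ * π ^ 2)) / (2 * saddleHeight μ n ^ 3) ≤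
      ∑' p : ℕ, exp (-μ * p) * leadingMode n p := by
  obtain ⟨p, hp⟩ : ∃ p, ⌈saddleHeight μ n⌉₊ = p + 2 := by
    refine Nat.exists_eq_add_of_le' (Nat.cast_le (α := ℝ).1 ?_)
    push_cast
    linarith [Nat.le_ceil (saddleHeight μ n)]
  have hle : saddleHeight μ n ≤ p + 2 := by exact_mod_cast hp ▸ Nat.le_ceil (saddleHeight μ n)
  have hlt : (p + 2 : ℝ) < saddleHeight μ n + 1 := by
    exact_mod_cast hp ▸ Nat.ceil_lt_add_one (show 0 ≤ saddleHeight μ n by linarith)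
  have hp_four : 4 ≤ p := by
    rify
    linarith
  have hexponent := exponent_le_of_saddleHeight_le hμ (by linarith) hle hlt
  set s := saddleHeight μ n
  have hcube : ((p : ℝ) + 2) ^ 3 ≤ 8 * s ^ 3 := by
    calc ((p : ℝ) + 2) ^ 3 ≤ (2 * s) ^ 3 := by
          gcongr
          linarith
      _ = 8 * s ^ 3 := by ring
  refine le_trans ?_ ((summable_leadingMode hμ n).le_tsum p fun i _ =>
    mul_nonneg (exp_pos _).le (leadingMode_nonneg n i))
  calc exp (-(3 / 2 * μ * s + μ * π ^ 2)) / (2 * s ^ 3)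
      = 4 / (8 * s ^ 3) * exp (-(3 / 2 * μ * s + μ * π ^ 2)) := by field_simp; norm_num
    _ ≤ 4 / ((p : ℝ) + 2) ^ 3 *
        exp (-(μ * p + (n * (π / (p + 2)) ^ 2 + 2 * (n * (π / (p + 2)) ^ 4)))) := by gcongr
    _ = exp (-μ * p) * (4 / ((p : ℝ) + 2) ^ 3 *
        exp (-(n * (π / (p + 2)) ^ 2 + 2 * (n * (π / (p + 2)) ^ 4)))) := by
      rw [neg_add (μ * (p : ℝ)), exp_add, neg_mul]
      ring
    _ ≤ exp (-μ * p) * leadingMode n p := by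
      gcongr
      exact le_leadingMode hp_four

theorem tendsto_pow_mul_exp_div_tsum_leadingMode {κ : ℝ} (hμ : 0 < μ) (hκ : 0 < κ) (a : ℕ) :
    Tendsto (fun n : ℕ => ((n : ℝ) + 1) ^ a * exp (-((3 / 2 * μ + κ) * saddleHeight μ n)) /
      ∑' p : ℕ, exp (-μ * p) * leadingMode n p) atTop (𝓝 0) := by
  set c := 2 * (μ / π ^ 2) ^ a * exp (μ * π ^ 2)
  have hlim : Tendsto (fun n => c * (saddleHeight μ n ^ ((3 * a + 3 : ℕ) : ℝ) *
      exp (-κ * saddleHeight μ n))) atTop (𝓝 0) := by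
    simpa using ((tendsto_rpow_mul_exp_neg_mul_atTop_nhds_zero ((3 * a + 3 : ℕ) : ℝ) κ hκ).comp
      (tendsto_saddleHeight hμ)).const_mul c
  refine squeeze_zero' (Eventually.of_forall fun n =>
    div_nonneg (by positivity) (tsum_leadingMode_pos hμ n).le) ?_ hlim
  filter_upwards [(tendsto_saddleHeight hμ).eventually_ge_atTop 6, eventually_ge_atTop 1]
    with n hs hn
  have hcube := mul_saddleHeight_pow_three hμ n
  have hlower := le_tsum_leadingMode hμ hs
  set s := saddleHeight μ n
  have : 0 < s := by linarith
  have hn_le : (n : ℝ) + 1 ≤ μ / π ^ 2 * s ^ 3 := by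
    have hn_one : (1 : ℝ) ≤ n := by exact_mod_cast hn
    have hn_eq : μ / π ^ 2 * s ^ 3 = 2 * n := by
      field_simp
      linear_combination hcube
    linarith
  calc _ ≤ (μ / π ^ 2 * s ^ 3) ^ a * exp (-((3 / 2 * μ + κ) * s)) /
        (exp (-(3 / 2 * μ * s + μ * π ^ 2)) / (2 * s ^ 3)) := by gcongr
    _ = c * (s ^ (3 * a + 3) * (exp (-((3 / 2 * μ + κ) * s)) /
        (exp (-(3 / 2 * μ * s + μ * π ^ 2)) * exp (μ * π ^ 2)))) := by
      simp only [c]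
      field_simp
      ring
    _ = _ := by
      rw [← exp_add, ← exp_sub, rpow_natCast]
      ring_nf

theorem exists_window_of_eventually_cubicRegime {P : ℕ × ℕ → Prop} (hμ : 0 < μ)
    (hP : ∀ᶠ x in cubicRegime (μ / (2 * π ^ 2)), P x) :
    ∃ ε > 0, ∀ᶠ n : ℕ in atTop, ∀ p : ℕ,
      |p + 2 - saddleHeight μ n| < ε * saddleHeight μ n → P (n, p) := by
  rw [cubicRegime, eventually_inf] at hP
  obtain ⟨s, hs, s', hs', hss⟩ := hP
  obtain ⟨u, hu, hus⟩ := mem_comap.1 hs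
  obtain ⟨u', hu', hus'⟩ := mem_comap.1 hs'
  have hcont : ContinuousAt (fun x : ℝ => μ / (2 * π ^ 2) / x ^ 3) 1 :=
    continuousAt_const.div (by fun_prop) (by norm_num)
  rw [ContinuousAt, one_pow, div_one] at hcont
  obtain ⟨ε, hε, hball⟩ := Metric.mem_nhds_iff.1 (hcont hu')
  refine ⟨ε, hε, ?_⟩
  filter_upwards [hu, (tendsto_saddleHeight hμ).eventually_gt_atTop 0] with n hn hpos p hp
  refine hss (n, p) ⟨hus hn, hus' ?_⟩
  have hratio : ((p : ℝ) + 2) / saddleHeight μ n ∈ Metric.ball 1 ε := by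
    rwa [Metric.mem_ball, dist_eq, div_sub_one hpos.ne', abs_div, abs_of_pos hpos,
      div_lt_iff₀ hpos]
  have hball_mem := hball hratio
  simp only [Set.mem_preimage] at hball_mem ⊢
  convert hball_mem using 1
  rw [div_pow]
  field_simp
  linear_combination (-1) * mul_saddleHeight_pow_three hμ n

section ModeComparison

variable {ℓ C : ℝ} {a : ℕ} {f : ℕ → ℕ → ℝ}

theorem eventually_abs_sub_le_mul_leadingMode {ρ η : ℝ} (hρ : 0 < ρ) (hη : 0 < η)
    (hlim : Tendsto (fun x : ℕ × ℕ => f x.1 x.2 / leadingMode x.1 x.2) (cubicRegime ρ) (𝓝 ℓ)) :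
    ∀ᶠ x in cubicRegime ρ, |f x.1 x.2 - ℓ * leadingMode x.1 x.2| ≤ η * leadingMode x.1 x.2 := by
  filter_upwards [Metric.tendsto_nhds.1 hlim η hη,
    (tendsto_snd_cubicRegime hρ).eventually_ge_atTop 3] with x hx hx_snd
  have hmode : 0 < leadingMode x.1 x.2 := by
    refine leadingMode_pos ?_ _
    rify
    linarith
  rw [dist_eq, div_sub' hmode.ne', abs_div, abs_of_pos hmode, div_lt_iff₀ hmode,
    mul_comm _ ℓ] at hx
  exact hx.le

theorem abs_sub_mul_leadingMode_le {n p : ℕ}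
    (hf : |f n p| ≤ C * ((n + 1) ^ a * exp (-(n * (π / (p + 2)) ^ 2)))) :
    |f n p - ℓ * leadingMode n p| ≤
      (C + |ℓ|) * ((n + 1) ^ a * exp (-(n * (π / (p + 2)) ^ 2))) := by
  have hmode : |ℓ * leadingMode n p| ≤
      |ℓ| * ((n + 1) ^ a * exp (-(n * (π / (p + 2)) ^ 2))) := by
    rw [abs_mul, abs_of_nonneg (leadingMode_nonneg n p)]
    gcongr
    refine (leadingMode_le n p).trans (le_mul_of_one_le_left (exp_pos _).le ?_)
    exact one_le_pow₀ (by linarith [n.cast_nonneg (α := ℝ)])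
  rw [add_mul]
  exact (abs_sub _ _).trans (add_le_add hf hmode)

theorem exists_eventually_exp_mul_abs_sub_le {η : ℝ} (hμ : 0 < μ) (hη : 0 < η)
    (hf : ∀ n p, |f n p| ≤ C * ((n + 1) ^ a * exp (-(n * (π / (p + 2)) ^ 2))))
    (hlim : Tendsto (fun x : ℕ × ℕ => f x.1 x.2 / leadingMode x.1 x.2)
      (cubicRegime (μ / (2 * π ^ 2))) (𝓝 ℓ)) :
    ∃ κ > 0, ∀ᶠ n : ℕ in atTop, ∀ p : ℕ, exp (-μ * p) * |f n p - ℓ * leadingMode n p| ≤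
      η * (exp (-μ * p) * leadingMode n p) + (C + |ℓ|) * exp (2 * μ) *
        ((n + 1) ^ a * exp (-((3 / 2 * μ + κ) * saddleHeight μ n))) * exp (-κ * p) := by
  have hC : 0 ≤ C := by simpa using (abs_nonneg _).trans (hf 0 0)
  obtain ⟨ε, hε, hwindow⟩ := exists_window_of_eventually_cubicRegime hμ
    (eventually_abs_sub_le_mul_leadingMode (by positivity) hη hlim)
  obtain ⟨κ, hκ, houtside⟩ := exists_exp_mul_exp_le hμ hε
  refine ⟨κ, hκ, ?_⟩
  filter_upwards [hwindow, (tendsto_saddleHeight hμ).eventually_gt_atTop 0] with n hn hpos p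
  have hmode := leadingMode_nonneg n p
  rcases lt_or_ge |p + 2 - saddleHeight μ n| (ε * saddleHeight μ n) with hp | hp
  · calc _ ≤ exp (-μ * p) * (η * leadingMode n p) := by gcongr; exact hn p hp
      _ = η * (exp (-μ * p) * leadingMode n p) := by ring
      _ ≤ _ := le_add_of_nonneg_right (by positivity)
  · calc _ ≤ exp (-μ * p) * ((C + |ℓ|) * ((n + 1) ^ a * exp (-(n * (π / (p + 2)) ^ 2)))) := by
          gcongr
          exact abs_sub_mul_leadingMode_le (hf n p)
      _ = (C + |ℓ|) * (n + 1) ^ a * (exp (-μ * p) * exp (-(n * (π / (p + 2)) ^ 2))) := by ring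
      _ ≤ (C + |ℓ|) * (n + 1) ^ a * (exp (2 * μ) *
          exp (-((3 / 2 * μ + κ) * saddleHeight μ n)) * exp (-κ * p)) :=
        mul_le_mul_of_nonneg_left (houtside n p hpos hp) (by positivity)
      _ = (C + |ℓ|) * exp (2 * μ) *
          ((n + 1) ^ a * exp (-((3 / 2 * μ + κ) * saddleHeight μ n))) * exp (-κ * p) := by ring
      _ ≤ _ := le_add_of_nonneg_left (by positivity)

theorem abs_tsum_div_tsum_leadingMode_sub_le {n : ℕ} {η D κ : ℝ} (hμ : 0 < μ) (hκ : 0 < κ)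
    (hf : Summable fun p : ℕ => exp (-μ * p) * f n p)
    (hle : ∀ p : ℕ, exp (-μ * p) * |f n p - ℓ * leadingMode n p| ≤
      η * (exp (-μ * p) * leadingMode n p) + D * exp (-κ * p)) :
    |(∑' p : ℕ, exp (-μ * p) * f n p) / (∑' p : ℕ, exp (-μ * p) * leadingMode n p) - ℓ| ≤
      η + D * (∑' p : ℕ, exp (-κ * p)) / ∑' p : ℕ, exp (-μ * p) * leadingMode n p := by
  have hmode := summable_leadingMode hμ n
  have hexp := summable_exp_neg_mul hκ
  have hpos := tsum_leadingMode_pos hμ n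
  have hdiff : (∑' p : ℕ, exp (-μ * p) * f n p) -
      (∑' p : ℕ, exp (-μ * p) * leadingMode n p) * ℓ =
      ∑' p : ℕ, exp (-μ * p) * (f n p - ℓ * leadingMode n p) := by
    rw [← tsum_mul_right, ← hf.tsum_sub (hmode.mul_right ℓ)]
    exact tsum_congr fun p => by ring
  rw [div_sub' hpos.ne', hdiff, abs_div, abs_of_pos hpos, ← sub_le_iff_le_add, ← sub_div,
    div_le_iff₀ hpos, sub_le_iff_le_add, ← tsum_mul_left, ← tsum_mul_left,
    ← (hmode.mul_left η).tsum_add (hexp.mul_left D)]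
  refine tsum_of_norm_bounded (E := ℝ) ((hmode.mul_left η).add (hexp.mul_left D)).hasSum fun p => ?_
  rw [norm_mul, norm_of_nonneg (exp_pos _).le]
  exact hle p

theorem tendsto_tsum_div_tsum_leadingMode (hμ : 0 < μ)
    (hf : ∀ n p, |f n p| ≤ C * ((n + 1) ^ a * exp (-(n * (π / (p + 2)) ^ 2))))
    (hlim : Tendsto (fun x : ℕ × ℕ => f x.1 x.2 / leadingMode x.1 x.2)
      (cubicRegime (μ / (2 * π ^ 2))) (𝓝 ℓ)) :
    Tendsto (fun n : ℕ => (∑' p : ℕ, exp (-μ * p) * f n p) /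
      ∑' p : ℕ, exp (-μ * p) * leadingMode n p) atTop (𝓝 ℓ) := by
  have hC : 0 ≤ C := by simpa using (abs_nonneg _).trans (hf 0 0)
  have hsummable (n : ℕ) : Summable fun p : ℕ => exp (-μ * p) * f n p :=
    summable_exp_neg_mul_mul (B := C * (n + 1) ^ a) hμ fun p => (hf n p).trans <|
      mul_le_mul_of_nonneg_left (mul_le_of_le_one_right (by positivity)
        (exp_le_one_iff.2 (neg_nonpos.2 (by positivity)))) hC
  rw [Metric.tendsto_nhds]
  intro η hη
  obtain ⟨κ, hκ, hbound⟩ := exists_eventually_exp_mul_abs_sub_le hμ (half_pos hη) hf hlim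
  have hsmall := (tendsto_pow_mul_exp_div_tsum_leadingMode hμ hκ a).const_mul
    ((C + |ℓ|) * exp (2 * μ) * ∑' p : ℕ, exp (-κ * p))
  rw [mul_zero] at hsmall
  filter_upwards [hbound, hsmall.eventually_lt_const (half_pos hη)] with n hn hn_small
  rw [dist_eq]
  calc _ ≤ _ := abs_tsum_div_tsum_leadingMode_sub_le hμ hκ (hsummable n) hn
    _ < η / 2 + η / 2 := by
      refine add_lt_add_right (lt_of_eq_of_lt ?_ hn_small) _
      ring
    _ = η := add_halves η

end ModeComparison

theorem summable_forestWeight (hμ : 0 < μ) (K n : ℕ) :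
    Summable fun p : ℕ => exp (-μ * p) * forestWeight K n p := by
  refine summable_exp_neg_mul_mul (B := ((n : ℝ) + 1) ^ K) hμ fun p => ?_
  rw [abs_of_nonneg (forestWeight_nonneg K n p)]
  exact (forestWeight_le K n p).trans (mul_le_of_le_one_right (by positivity)
    (exp_le_one_iff.2 (neg_nonpos.2 (by positivity))))

theorem tendsto_tsum_forestWeight_div_tsum_leadingMode (hμ : 0 < μ) (K : ℕ) :
    Tendsto (fun n : ℕ => (∑' p : ℕ, exp (-μ * p) * forestWeight K n p) /
      ∑' p : ℕ, exp (-μ * p) * leadingMode n p) atTop (𝓝 (2 / 2 ^ K * laguerreSum μ K)) := by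
  refine tendsto_tsum_div_tsum_leadingMode (C := 1) (a := K) hμ (fun n p => ?_) ?_
  · rw [abs_of_nonneg (forestWeight_nonneg K n p), one_mul]
    exact forestWeight_le K n p
  · have hmode := isModeLike_forestWeight (ρ := μ / (2 * π ^ 2)) (by positivity) K 0
    rw [mul_div_cancel₀ μ (by positivity)] at hmode
    simpa using hmode

theorem tendsto_tsum_forestWeight_one_add_div_tsum_leadingMode (hμ : 0 < μ) (s : ℕ) :
    Tendsto (fun n : ℕ => (∑' p : ℕ, exp (-μ * p) * forestWeight 1 (n + s) p) /
      ∑' p : ℕ, exp (-μ * p) * leadingMode n p) atTop (𝓝 1) := by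
  have hρ : 0 < μ / (2 * π ^ 2) := by positivity
  refine tendsto_tsum_div_tsum_leadingMode (C := 1) (a := 0) hμ (fun n p => ?_) ?_
  · rw [abs_of_nonneg (forestWeight_nonneg 1 _ p), one_mul, pow_zero, one_mul]
    refine (forestWeight_one_le (n + s) p).trans ?_
    gcongr
    exact Nat.le_add_right n s
  · simpa using (isModeLike_forestWeight_one hρ).comp_add hρ s 0

theorem tendsto_tsum_forestWeight_div (hμ : 0 < μ) (K s : ℕ) :
    Tendsto (fun n : ℕ => (∑' p : ℕ, exp (-μ * p) * forestWeight K n p) /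
      ∑' p : ℕ, exp (-μ * p) * forestWeight 1 (n + s) p) atTop
      (𝓝 (2 / 2 ^ K * laguerreSum μ K)) := by
  have hlim := (tendsto_tsum_forestWeight_div_tsum_leadingMode hμ K).div
    (tendsto_tsum_forestWeight_one_add_div_tsum_leadingMode hμ s) one_ne_zero
  rw [div_one] at hlim
  refine hlim.congr fun n => ?_
  rw [Pi.div_apply, div_div_div_cancel_right₀ (tsum_leadingMode_pos hμ n).ne']

end Laplace

section Lists

theorem tsum_list_eq_nil_add_tsum_cons {α : Type*} (F : List α → ENNReal) :
    ∑' l, F l = F [] + ∑' a, ∑' l, F (a :: l) := by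
  let e : (Unit ⊕ α × List α) ≃ List α :=
    { toFun := fun x => x.elim (fun _ => []) fun y => y.1 :: y.2
      invFun := fun l => match l with
        | [] => Sum.inl ()
        | a :: l => Sum.inr (a, l)
      left_inv := by rintro (_ | ⟨a, l⟩) <;> rfl
      right_inv := by rintro (_ | ⟨a, l⟩) <;> rfl }
  rw [← e.tsum_eq F, Summable.tsum_sum ENNReal.summable ENNReal.summable, ← ENNReal.tsum_prod,
    tsum_fintype]
  simp [e]

/-- The index of the block containing `j`, where consecutive blocks of the lengths listed in `c`
are laid out from left to right. For positions beyond the last block it is the number of blocks. -/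
def blockIndex : List ℕ → ℕ → ℕ
  | [], _ => 0
  | a :: c, j => if j < a then 0 else blockIndex c (j - a) + 1

theorem blockIndex_lt_iff {c : List ℕ} {j : ℕ} (hj : j < c.sum) (i : ℕ) :
    blockIndex c j < i ↔ j < (c.take i).sum := by
  induction c generalizing i j with
  | nil => simp at hj
  | cons a c ih =>
    cases i with
    | zero => simp
    | succ i =>
      rw [List.sum_cons] at hj
      simp only [blockIndex, List.take_succ_cons, List.sum_cons]
      split_ifs with h
      · simp only [Nat.zero_lt_succ, true_iff]
        omega
      · rw [Nat.add_lt_add_iff_right, ih (by omega)]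
        omega

theorem blockIndex_lt_length {c : List ℕ} {j : ℕ} (hj : j < c.sum) :
    blockIndex c j < c.length := by
  rw [blockIndex_lt_iff hj, List.take_length]
  exact hj

theorem blockIndex_mono {c : List ℕ} {i j : ℕ} (hij : i ≤ j) (hj : j < c.sum) :
    blockIndex c i ≤ blockIndex c j := by
  have h := (blockIndex_lt_iff hj (blockIndex c j + 1)).1 (Nat.lt_succ_self _)
  exact Nat.lt_succ_iff.1 ((blockIndex_lt_iff (hij.trans_lt hj) _).2 (hij.trans_lt h))

theorem mem_iff_lt_card_of_forall_le_mem {s : Finset ℕ} (h : ∀ a ∈ s, ∀ b ≤ a, b ∈ s) (j : ℕ) :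
    j ∈ s ↔ j < s.card := by
  constructor
  · intro hj
    have : Finset.range (j + 1) ⊆ s := fun b hb => h j hj b (by simpa [Nat.lt_succ_iff] using hb)
    simpa using Finset.card_le_card this
  · intro hj
    by_contra hn
    have : s ⊆ Finset.range j := fun a ha => by
      rw [Finset.mem_range]
      by_contra hc
      exact hn (h a ha j (not_lt.1 hc))
    have := Finset.card_le_card this
    rw [Finset.card_range] at this
    omega

end Lists

namespace PlanarTree

/-- The number of children of the vertex `i ∈ D_r`; it is `0` if `i` is not a vertex of `D_r`. -/
def childCount (T : PlanarTree) (r i : ℕ) : ℕ :=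
  ((Finset.range (T.width (r + 1))).filter fun j => T.parent r j = i).card

/-- The numbers of children of the vertices of `D_r`, from left to right. These lists, one for each
generation, determine the tree. -/
def code (T : PlanarTree) (r : ℕ) : List ℕ := (List.range (T.width r)).map (T.childCount r)

@[simp]
theorem length_code (T : PlanarTree) (r : ℕ) : (T.code r).length = T.width r := by simp [code]

theorem sum_take_code (T : PlanarTree) (r i : ℕ) : ((T.code r).take i).sum =
    ((Finset.range (T.width (r + 1))).filter fun j => T.parent r j < i).card := by
  rw [code, ← List.map_take, List.take_range]
  change ∑ l ∈ Finset.range (min i (T.width r)), T.childCount r l = _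
  have maps_to_range : Set.MapsTo (T.parent r)
      (((Finset.range (T.width (r + 1))).filter fun j => T.parent r j < i : Finset ℕ) : Set ℕ)
      ((Finset.range (min i (T.width r)) : Finset ℕ) : Set ℕ) := by
    intro j hj
    simp only [Finset.coe_filter, Finset.mem_range, Set.mem_ofPred_eq] at hj
    simp only [Finset.coe_range, Set.mem_Iio, lt_min_iff]
    exact ⟨hj.2, T.parent_lt r j hj.1⟩
  rw [Finset.card_eq_sum_card_fiberwise maps_to_range]
  refine Finset.sum_congr rfl fun l hl => ?_
  rw [Finset.mem_range, lt_min_iff] at hl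
  rw [childCount, Finset.filter_filter]
  congr 1
  ext j
  simp only [Finset.mem_filter]
  constructor
  · rintro ⟨hj, hparent⟩
    exact ⟨hj, by omega, hparent⟩
  · rintro ⟨hj, -, hparent⟩
    exact ⟨hj, hparent⟩

@[simp]
theorem sum_code (T : PlanarTree) (r : ℕ) : (T.code r).sum = T.width (r + 1) := by
  have h := sum_take_code T r (T.width r)
  rw [List.take_of_length_le (by simp), Finset.filter_true_of_mem, Finset.card_range] at h
  · exact h
  · exact fun j hj => T.parent_lt r j (Finset.mem_range.1 hj)

theorem code_zero (T : PlanarTree) : T.code 0 = [1] := by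
  obtain ⟨a, ha⟩ := List.length_eq_one_iff.1 ((T.length_code 0).trans T.width_zero)
  have sum_eq_one := (T.sum_code 0).trans T.width_one
  rw [ha] at sum_eq_one ⊢
  simpa using sum_eq_one

theorem parent_lt_iff (T : PlanarTree) {r j : ℕ} (hj : j < T.width (r + 1)) (i : ℕ) :
    T.parent r j < i ↔ j < ((T.code r).take i).sum := by
  rw [sum_take_code, ← mem_iff_lt_card_of_forall_le_mem]
  · simp [hj]
  · intro a ha b hb
    simp only [Finset.mem_filter, Finset.mem_range] at ha ⊢
    exact ⟨by omega, (T.parent_mono r b a hb ha.1).trans_lt ha.2⟩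

theorem parent_eq_blockIndex (T : PlanarTree) {r j : ℕ} (hj : j < T.width (r + 1)) :
    T.parent r j = blockIndex (T.code r) j := by
  refine eq_of_forall_gt_iff fun i => ?_
  rw [parent_lt_iff T hj, blockIndex_lt_iff (by rwa [sum_code])]

theorem ball_succ_eq_iff (n : ℕ) (T T' : PlanarTree) :
    ball (n + 1) T = ball (n + 1) T' ↔ ∀ s ≤ n, T.code s = T'.code s := by
  rw [ball_eq_ball_iff, show max (n + 1) 1 = n + 1 by omega]
  constructor
  · rintro ⟨hwidth, hparent⟩ s hs
    have childCount_eq : T.childCount s = T'.childCount s := by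
      funext i
      simp only [childCount]
      rw [hwidth (s + 1) (by omega), hparent s (by omega)]
    rw [code, code, hwidth s (by omega), childCount_eq]
  · intro h
    have hwidth : ∀ s ≤ n + 1, T.width s = T'.width s := by
      intro s hs
      cases s with
      | zero => rw [T.width_zero, T'.width_zero]
      | succ s => rw [← sum_code, ← sum_code, h s (by omega)]
    refine ⟨hwidth, fun s hs => ?_⟩
    funext j
    by_cases hj : j < T.width (s + 1)
    · rw [T.parent_eq_blockIndex hj, T'.parent_eq_blockIndex (by rwa [← hwidth (s + 1) (by omega)]),
        h s (by omega)]
    · rw [T.parent_eq_zero s j (by omega),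
        T'.parent_eq_zero s j (by rw [← hwidth (s + 1) (by omega)]; omega)]

/-- The planar tree in which the vertices of `D_r` have, from left to right, the numbers of children
listed in `c r`. -/
def ofCode (c : ℕ → List ℕ) (h0 : c 0 = [1]) (h : ∀ r, (c (r + 1)).length = (c r).sum) :
    PlanarTree where
  width r := (c r).length
  parent r j := if j < (c r).sum then blockIndex (c r) j else 0
  width_zero := by simp [h0]
  width_one := by simp [h, h0]
  parent_lt r j hj := by
    rw [h] at hj
    rw [if_pos hj]
    exact blockIndex_lt_length hj
  parent_mono r i j hij hj := by
    rw [h] at hj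
    rw [if_pos hj, if_pos (by omega)]
    exact blockIndex_mono hij hj
  parent_eq_zero r j hj := by
    rw [h] at hj
    rw [if_neg (by omega)]

theorem code_ofCode (c : ℕ → List ℕ) (h0 : c 0 = [1]) (h : ∀ r, (c (r + 1)).length = (c r).sum)
    (r : ℕ) : (ofCode c h0 h).code r = c r := by
  refine List.eq_of_sum_take_eq (by rw [length_code]; rfl) fun i _ => ?_
  rw [sum_take_code]
  have filter_parent_lt : (Finset.range ((ofCode c h0 h).width (r + 1))).filter
      (fun j => (ofCode c h0 h).parent r j < i) = Finset.range ((c r).take i).sum := by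
    have sum_take_le : ((c r).take i).sum ≤ (c r).sum :=
      (List.take_sublist i (c r)).sum_le_sum (by simp)
    ext j
    simp only [Finset.mem_filter, Finset.mem_range, ofCode, h]
    constructor
    · rintro ⟨hj, hlt⟩
      rwa [if_pos hj, blockIndex_lt_iff hj] at hlt
    · intro hlt
      have hj : j < (c r).sum := by omega
      refine ⟨hj, ?_⟩
      rwa [if_pos hj, blockIndex_lt_iff hj]
  rw [filter_parent_lt, Finset.card_range]

/-- The tree which agrees with `T` up to height `n + 1`, where the vertices at height `n + 1` have
the numbers of children listed in `c`, and which has no vertex at height `n + 3`. -/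
def graft (T : PlanarTree) (n : ℕ) (c : List ℕ) (hc : c.length = T.width (n + 1)) : PlanarTree :=
  ofCode (fun s => if s ≤ n then T.code s else if s = n + 1 then c else
      if s = n + 2 then List.replicate c.sum 0 else [])
    (by simp [code_zero])
    (by
      intro r
      rcases lt_trichotomy r n with hr | hr | hr
      · rw [if_pos (show r + 1 ≤ n by omega), if_pos (show r ≤ n by omega)]
        simp
      · subst hr
        simp [hc]
      · rw [if_neg (show ¬ r + 1 ≤ n by omega), if_neg (show ¬ r + 1 = n + 1 by omega),
          if_neg (show ¬ r ≤ n by omega)]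
        by_cases hr' : r = n + 1
        · rw [if_pos (show r + 1 = n + 2 by omega), if_pos hr', List.length_replicate]
        · rw [if_neg (show ¬ r + 1 = n + 2 by omega), if_neg hr']
          split_ifs <;> simp)

variable {T : PlanarTree} {n : ℕ} {c : List ℕ} {hc : c.length = T.width (n + 1)}

theorem code_graft_of_le {s : ℕ} (hs : s ≤ n) : (T.graft n c hc).code s = T.code s := by
  rw [graft, code_ofCode, if_pos hs]

theorem code_graft_succ : (T.graft n c hc).code (n + 1) = c := by
  rw [graft, code_ofCode]
  simp

theorem width_graft : (T.graft n c hc).width (n + 2) = c.sum := by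
  rw [← sum_code, code_graft_succ]

theorem ball_eq_ball_graft_iff (T' : PlanarTree) :
    ball (n + 2) T' = ball (n + 2) (T.graft n c hc) ↔
      ball (n + 1) T' = ball (n + 1) T ∧ T'.code (n + 1) = c := by
  rw [ball_succ_eq_iff, ball_succ_eq_iff]
  constructor
  · intro h
    refine ⟨fun s hs => ?_, ?_⟩
    · rw [h s (by omega), code_graft_of_le hs]
    · rw [h (n + 1) le_rfl, code_graft_succ]
  · rintro ⟨hcode, hlast⟩ s hs
    rcases Nat.lt_or_ge n s with h | h
    · obtain rfl : s = n + 1 := by omega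
      rw [hlast, code_graft_succ]
    · rw [hcode s h, code_graft_of_le h]

end PlanarTree

section Expansion

open PowerSeries

theorem cast_coeff_pow_mul_eq_tsum {f v : PowerSeries ℕ} (h : v = 1 + X * f * v) (n K : ℕ)
    (w : PowerSeries ℕ) : ((coeff n (v ^ K * w) : ℕ) : ENNReal) =
      ∑' c : List ℕ, if c.length = K then
        ((coeff n ((X * f) ^ c.sum * w) : ℕ) : ENNReal) else 0 := by
  induction K generalizing w with
  | zero =>
    rw [tsum_eq_single []]
    · simp
    · intro c hc
      rw [if_neg]
      simpa using hc
  | succ K ih =>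
    rw [tsum_list_eq_nil_add_tsum_cons, pow_succ', mul_assoc, coeff_mul_eq_sum_of_eq_one_add h]
    have tsum_eq_sum_range : ∑' a : ℕ, ((coeff n ((X * f) ^ a * (v ^ K * w)) : ℕ) : ENNReal) =
        ∑ a ∈ Finset.range (n + 1), ((coeff n ((X * f) ^ a * (v ^ K * w)) : ℕ) : ENNReal) := by
      refine tsum_eq_sum fun a ha => ?_
      rw [coeff_X_mul_pow_mul_of_lt _ _ (by simpa [Nat.lt_succ_iff] using ha), Nat.cast_zero]
    rw [Nat.cast_sum, ← tsum_eq_sum_range]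
    simp only [List.length_nil, (Nat.succ_ne_zero K).symm, if_false, zero_add, List.length_cons,
      Nat.add_right_cancel_iff, List.sum_cons]
    refine tsum_congr fun a => ?_
    rw [show (X * f) ^ a * (v ^ K * w) = v ^ K * ((X * f) ^ a * w) by ring, ih]
    refine tsum_congr fun c => ?_
    rw [show (X * f) ^ c.sum * ((X * f) ^ a * w) = (X * f) ^ (a + c.sum) * w by ring]

theorem tsum_eq_tsum_add_of_forall_lt_eq_zero {M : Type*} [AddCommMonoid M] [TopologicalSpace M]
    {f : ℕ → M} (k : ℕ) (h : ∀ m < k, f m = 0) :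
    ∑' m, f m = ∑' m, f (m + k) := by
  refine ((add_left_injective k).tsum_eq fun m hm => ?_).symm
  refine ⟨m - k, Nat.sub_add_cancel ?_⟩
  by_contra hn
  exact hm (h m (not_le.1 hn))

end Expansion

theorem ofReal_exp_neg_lt_one {μ : ℝ} (hμ : 0 < μ) : ENNReal.ofReal (Real.exp (-μ)) < 1 := by
  rwa [ENNReal.ofReal_lt_one, Real.exp_lt_one_iff, neg_lt_zero]

theorem one_sub_mul_tsum_pow_succ_of_le {q : ENNReal} (hq : q < 1) (k : ℕ) :
    (1 - q) * ∑' m : ℕ, q ^ (m + 1) * (if k ≤ m then 1 else 0) = q ^ (k + 1) := by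
  have shift :
      ∑' m : ℕ, q ^ (m + 1) * (if k ≤ m then 1 else 0) = q ^ (k + 1) * ∑' m : ℕ, q ^ m := by
    rw [← ENNReal.tsum_mul_left, tsum_eq_tsum_add_of_forall_lt_eq_zero k]
    · refine tsum_congr fun m => ?_
      rw [if_pos (by omega), mul_one]
      ring
    · intro m hm
      rw [if_neg (by omega), mul_zero]
  rw [shift, ENNReal.tsum_geometric, mul_left_comm, ENNReal.mul_inv_cancel (tsub_pos_of_lt hq).ne'
    (lt_of_le_of_lt tsub_le_self ENNReal.one_lt_top).ne, mul_one]

namespace PlanarTree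

/-- The number of edges of the ball of radius `n + 1`, as a natural number. The shift by one avoids
the convention `ball 0 T = ball 1 T`. -/
def ballEdges (n : ℕ) (T : PlanarTree) : ℕ := ∑ s ∈ Finset.range (n + 1), T.width (s + 1)

theorem ballEdges_zero (T : PlanarTree) : ballEdges 0 T = 1 := by simp [ballEdges, width_one]

theorem ballEdges_succ (n : ℕ) (T : PlanarTree) :
    ballEdges (n + 1) T = ballEdges n T + T.width (n + 2) := by
  rw [ballEdges, Finset.sum_range_succ]
  rfl

theorem size_ball_succ (n : ℕ) (T : PlanarTree) : (ball (n + 1) T).size = ballEdges n T := by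
  rw [size_ball (n + 1) (by omega), ballEdges, Finset.range_eq_Ico,
    Finset.sum_Ico_add' (fun s => T.width s) 0 (n + 1) 1]
  rfl

/-- The tree has no vertices at height larger than `m + 1`. Unlike `height T ≤ m + 1`, this is also
meaningful for infinite trees, where `height` may be the supremum of an unbounded set. -/
def HeightLE (T : PlanarTree) (m : ℕ) : Prop := ∀ s, m + 1 < s → T.width s = 0

theorem width_succ_eq_zero {T : PlanarTree} {r : ℕ} (h : T.width r = 0) : T.width (r + 1) = 0 := by
  by_contra hn
  have := T.parent_lt r 0 (by omega)
  omega

theorem width_eq_zero_of_le {T : PlanarTree} {r s : ℕ} (hrs : r ≤ s) (h : T.width r = 0) :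
    T.width s = 0 := by
  induction s, hrs using Nat.le_induction with
  | base => exact h
  | succ s _ ih => exact width_succ_eq_zero ih

theorem ball_eq_self {T : PlanarTree} {m : ℕ} (h : T.HeightLE m) : ball (m + 1) T = T := by
  ext s j
  · simp only [ball]
    split_ifs with hs
    · rfl
    · rw [h s (by omega)]
  · simp only [ball]
    split_ifs with hs
    · rfl
    · rw [T.parent_eq_zero s j]
      rw [h (s + 1) (by omega)]
      omega

theorem heightLE_ball (n : ℕ) (T : PlanarTree) : (ball (n + 1) T).HeightLE n := by
  intro s hs
  simp only [ball]
  rw [if_neg (by omega)]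

theorem le_size_of_width_ne_zero {T : PlanarTree} {N r : ℕ} (hT : T.size = N)
    (hr : T.width r ≠ 0) : r ≤ N := by
  have column_subset : (((Finset.range r).map ⟨fun s => (s, 0), fun a b h => (Prod.mk.inj h).1⟩ :
      Finset (ℕ × ℕ)) : Set (ℕ × ℕ)) ⊆ {e : ℕ × ℕ | e.2 < T.width (e.1 + 1)} := by
    intro e he
    simp only [Finset.coe_map, Set.mem_image, Finset.coe_range,
      Set.mem_Iio] at he
    obtain ⟨s, hs, rfl⟩ := he
    refine Nat.pos_of_ne_zero fun h0 => hr ?_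
    exact width_eq_zero_of_le (show s + 1 ≤ r by omega) h0
  have card_le := Set.encard_le_encard column_subset
  rw [Set.encard_coe_eq_coe_finsetCard, Finset.card_map, Finset.card_range, ← size, hT] at card_le
  exact_mod_cast card_le

theorem height_le_iff {T : PlanarTree} {N m : ℕ} (hT : T.size = N) :
    T.height ≤ m + 1 ↔ T.HeightLE m := by
  have hbdd : BddAbove {r : ℕ | T.width r ≠ 0} := ⟨N, fun r hr => le_size_of_width_ne_zero hT hr⟩
  constructor
  · intro h s hs
    by_contra hn
    have : s ≤ T.height := le_csSup hbdd hn
    omega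
  · intro h
    refine csSup_le ⟨0, by simp [T.width_zero]⟩ fun r hr => ?_
    by_contra hn
    exact hr (h r (by omega))

theorem one_le_height {T : PlanarTree} {N : ℕ} (hT : T.size = N) : 1 ≤ T.height :=
  le_csSup (s := {r : ℕ | T.width r ≠ 0}) ⟨N, fun r hr => le_size_of_width_ne_zero hT hr⟩
    (by simp [T.width_one])

open Classical in
/-- The number of trees of size `N` and height at most `m + 1` with a given ball of radius
`n + 1`. -/
noncomputable def treeCount (N m n : ℕ) (T₀ : PlanarTree) : ENNReal :=
  ∑' T : PlanarTree,
    if T.size = N ∧ T.HeightLE m ∧ ball (n + 1) T = ball (n + 1) T₀ then 1 else 0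

theorem width_eq_of_ball_eq {n : ℕ} {T T' : PlanarTree} (h : ball (n + 1) T = ball (n + 1) T')
    {s : ℕ} (hs : s ≤ n + 1) : T.width s = T'.width s :=
  ((ball_eq_ball_iff _ _ _).1 h).1 s (by omega)

theorem ballEdges_eq_of_ball_eq {n : ℕ} {T T' : PlanarTree}
    (h : ball (n + 1) T = ball (n + 1) T') : ballEdges n T = ballEdges n T' :=
  Finset.sum_congr rfl fun s hs => width_eq_of_ball_eq h (by
    have := Finset.mem_range.1 hs
    omega)

theorem ballEdges_graft (n : ℕ) (T : PlanarTree) (c : List ℕ) (hc : c.length = T.width (n + 1)) :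
    ballEdges (n + 1) (T.graft n c hc) = ballEdges n T + c.sum := by
  rw [ballEdges_succ, width_graft,
    ballEdges_eq_of_ball_eq ((ball_eq_ball_graft_iff (T.graft n c hc)).1 rfl).1]

theorem treeCount_self (N n : ℕ) (T₀ : PlanarTree) :
    treeCount N n n T₀ = if ballEdges n T₀ = N then 1 else 0 := by
  have ball_ball : ball (n + 1) (ball (n + 1) T₀) = ball (n + 1) T₀ :=
    ball_eq_self (heightLE_ball n T₀)
  rw [treeCount, tsum_eq_single (ball (n + 1) T₀)]
  · simp only [heightLE_ball, ball_ball, and_true, size_ball_succ, Nat.cast_inj]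
  · intro T hT
    rw [if_neg]
    rintro ⟨-, hheight, hball⟩
    exact hT (by rw [← hball, ball_eq_self hheight])

theorem treeCount_eq_tsum_graft (N m n : ℕ) (T₀ : PlanarTree) :
    treeCount N m n T₀ = ∑' c : List ℕ, if hc : c.length = T₀.width (n + 1) then
      treeCount N m (n + 1) (T₀.graft n c hc) else 0 := by
  classical
  have sum_over_code : treeCount N m n T₀ = ∑' c : List ℕ, ∑' T : PlanarTree,
      if (T.size = N ∧ T.HeightLE m ∧ ball (n + 1) T = ball (n + 1) T₀) ∧
        T.code (n + 1) = c then 1 else 0 := by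
    rw [treeCount, ENNReal.tsum_comm]
    refine tsum_congr fun T => ?_
    rw [tsum_eq_single (T.code (n + 1))]
    · simp
    · intro c hc
      rw [if_neg]
      rintro ⟨-, h⟩
      exact hc h.symm
  rw [sum_over_code]
  refine tsum_congr fun c => ?_
  split_ifs with hc
  · refine tsum_congr fun T => ?_
    simp only [ball_eq_ball_graft_iff, and_assoc]
  · rw [ENNReal.tsum_eq_zero]
    intro T
    rw [if_neg]
    rintro ⟨⟨-, -, h⟩, rfl⟩
    exact hc (by rw [length_code, width_eq_of_ball_eq h le_rfl])

open PowerSeries in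
theorem treeCount_add (N n p : ℕ) (T₀ : PlanarTree) : treeCount N (n + p) n T₀ =
    ((coeff N (X ^ ballEdges n T₀ * treeSeries ℕ p ^ T₀.width (n + 1)) : ℕ) : ENNReal) := by
  induction p generalizing n T₀ with
  | zero =>
    rw [treeSeries_zero, one_pow, mul_one, coeff_X_pow, add_zero, treeCount_self, Nat.cast_ite,
      Nat.cast_one, Nat.cast_zero]
    simp only [eq_comm]
  | succ p ih =>
    rw [treeCount_eq_tsum_graft, mul_comm, cast_coeff_pow_mul_eq_tsum (treeSeries_succ p)]
    refine tsum_congr fun c => ?_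
    split_ifs with hc
    · rw [show n + (p + 1) = n + 1 + p by ring, ih, ballEdges_graft, width_graft]
      congr 2
      ring
    · rfl

theorem treeCount_eq_zero_of_lt {N m n : ℕ} {T₀ : PlanarTree} (h : m < n)
    (hK : T₀.width (n + 1) ≠ 0) : treeCount N m n T₀ = 0 := by
  classical
  rw [treeCount, ENNReal.tsum_eq_zero]
  intro T
  rw [if_neg]
  rintro ⟨-, hheight, hball⟩
  exact hK (by rw [← width_eq_of_ball_eq hball le_rfl, hheight (n + 1) (by omega)])

/-- The trees which agree with `T₀` up to height `n + 1`. These sets form a basis of the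
topology. -/
def cylinder (n : ℕ) (T₀ : PlanarTree) : Set PlanarTree := {T | ball (n + 1) T = ball (n + 1) T₀}

theorem isOpen_cylinder (n : ℕ) (T₀ : PlanarTree) : IsOpen (cylinder n T₀) := by
  rw [Metric.isOpen_iff]
  intro T hT
  refine ⟨1 / ((n : ℝ) + 1), by positivity, fun T' hT' => ?_⟩
  rw [Metric.mem_ball] at hT'
  replace hT' : sInf (invRadii T' T) < 1 / ((n : ℝ) + 1) := hT'
  obtain ⟨x, ⟨s, hs, hb, rfl⟩, hx⟩ := exists_lt_of_csInf_lt (invRadii_nonempty T' T) hT'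
  have hs0 : (0 : ℝ) < s := by exact_mod_cast hs
  have hlt : (n : ℝ) + 1 < s := (one_div_lt_one_div hs0 (by positivity)).1 hx
  have hrs : n + 1 ≤ s := by
    have : n + 1 < s := by exact_mod_cast hlt
    omega
  exact (ball_eq_ball_of_le hrs hb).trans hT

theorem measurableSet_cylinder (n : ℕ) (T₀ : PlanarTree) : MeasurableSet (cylinder n T₀) :=
  (isOpen_cylinder n T₀).measurableSet

theorem exists_cylinder_subset {U : Set PlanarTree} (hU : IsOpen U) {T : PlanarTree} (hT : T ∈ U) :
    ∃ n, cylinder n T ⊆ U := by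
  obtain ⟨ε, hε, hsub⟩ := Metric.isOpen_iff.1 hU T hT
  obtain ⟨n, hn⟩ := exists_nat_one_div_lt hε
  refine ⟨n, fun T' hT' => hsub ?_⟩
  rw [Metric.mem_ball]
  change sInf (invRadii T' T) < ε
  refine lt_of_le_of_lt (csInf_le (invRadii_bddBelow T' T) ⟨n + 1, by omega, hT', rfl⟩) ?_
  push_cast
  exact hn

section FiniteSize

variable (μ : ℝ)

open Classical in
/-- The total weight of the trees of size `N` with a given ball of radius `n + 1`. -/
noncomputable def cylinderWeight (N n : ℕ) (T₀ : PlanarTree) : ENNReal :=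
  ∑' T : PlanarTree, if T.size = N ∧ ball (n + 1) T = ball (n + 1) T₀ then
    ENNReal.ofReal (Real.exp (-μ * T.height)) else 0

theorem partitionFunction_eq (N : ℕ) (T₀ : PlanarTree) :
    partitionFunction μ N = cylinderWeight μ N 0 T₀ := by
  classical
  rw [partitionFunction, cylinderWeight]
  refine (tsum_subtype {T : PlanarTree | T.size = N}
    fun T => ENNReal.ofReal (Real.exp (-μ * T.height))).trans ?_
  refine tsum_congr fun T => ?_
  have ball_one_eq : ball (0 + 1) T = ball (0 + 1) T₀ := by
    rw [ball_succ_eq_iff]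
    intro s hs
    obtain rfl : s = 0 := by omega
    rw [code_zero, code_zero]
  simp [Set.indicator_apply, ball_one_eq]

theorem finiteSizeMeasure_cylinder (N n : ℕ) (T₀ : PlanarTree) :
    finiteSizeMeasure μ N (cylinder n T₀) =
      cylinderWeight μ N n T₀ / partitionFunction μ N := by
  classical
  rw [finiteSizeMeasure, Measure.sum_apply _ (measurableSet_cylinder n T₀), cylinderWeight,
    div_eq_mul_inv, ← ENNReal.tsum_mul_right]
  simp only [Measure.smul_apply, Measure.dirac_apply' _ (measurableSet_cylinder n T₀), smul_eq_mul]
  refine (tsum_subtype {T : PlanarTree | T.size = N} fun T =>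
    ENNReal.ofReal (Real.exp (-μ * T.height)) / partitionFunction μ N *
      (cylinder n T₀).indicator 1 T).trans ?_
  refine tsum_congr fun T => ?_
  simp only [Set.indicator_apply, Set.mem_ofPred_eq, cylinder, Pi.one_apply, div_eq_mul_inv]
  by_cases hsize : T.size = N <;> by_cases hball : ball (n + 1) T = ball (n + 1) T₀ <;>
    simp [hsize, hball]

theorem cylinderWeight_eq_tsum_treeCount {μ : ℝ} (hμ : 0 < μ) (N n : ℕ) (T₀ : PlanarTree) :
    cylinderWeight μ N n T₀ = (1 - ENNReal.ofReal (Real.exp (-μ))) *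
      ∑' m : ℕ, ENNReal.ofReal (Real.exp (-μ)) ^ (m + 1) * treeCount N m n T₀ := by
  classical
  simp only [treeCount, ← ENNReal.tsum_mul_left]
  rw [ENNReal.tsum_comm, cylinderWeight]
  refine tsum_congr fun T => ?_
  by_cases h : T.size = N ∧ ball (n + 1) T = ball (n + 1) T₀
  · obtain ⟨k, hk⟩ : ∃ k, T.height = k + 1 := ⟨T.height - 1, by have := one_le_height h.1; omega⟩
    have heightLE_iff : ∀ m, T.HeightLE m ↔ k ≤ m := fun m => by
      rw [← height_le_iff h.1, hk]
      omega
    simp only [h.1, h.2, heightLE_iff, true_and, and_true, if_true]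
    rw [ENNReal.tsum_mul_left, one_sub_mul_tsum_pow_succ_of_le (ofReal_exp_neg_lt_one hμ),
      ← ENNReal.ofReal_pow (Real.exp_pos _).le, ← Real.exp_nat_mul, hk, mul_comm]
  · rw [if_neg h, eq_comm, ENNReal.tsum_eq_zero]
    intro m
    rw [if_neg, mul_zero, mul_zero]
    rintro ⟨hsize, -, hball⟩
    exact h ⟨hsize, hball⟩

open PowerSeries in
theorem cylinderWeight_eq {μ : ℝ} (hμ : 0 < μ) (k n : ℕ) {T₀ : PlanarTree}
    (hK : T₀.width (n + 1) ≠ 0) : cylinderWeight μ (ballEdges n T₀ + k) n T₀ =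
      (1 - ENNReal.ofReal (Real.exp (-μ))) * ENNReal.ofReal (Real.exp (-μ)) ^ (n + 1) *
        ENNReal.ofReal (4 ^ (k + T₀.width (n + 1)) *
          ∑' p : ℕ, Real.exp (-μ * p) * forestWeight (T₀.width (n + 1)) k p) := by
  set q := ENNReal.ofReal (Real.exp (-μ)) with hq
  set K := T₀.width (n + 1) with width_eq
  rw [cylinderWeight_eq_tsum_treeCount hμ, mul_assoc]
  congr 1
  rw [tsum_eq_tsum_add_of_forall_lt_eq_zero n]
  · rw [← tsum_mul_left, ENNReal.ofReal_tsum_of_nonneg, ← ENNReal.tsum_mul_left]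
    · refine tsum_congr fun p => ?_
      rw [add_comm p n, treeCount_add, add_comm (ballEdges n T₀) k, coeff_X_pow_mul, ← width_eq]
      have coeff_eq : ((coeff k (treeSeries ℕ p ^ K) : ℕ) : ENNReal) =
          ENNReal.ofReal (4 ^ (k + K) * forestWeight K k p) := by
        rw [forestWeight, ← mul_assoc, ← mul_pow, coeff_treeSeries_pow_eq_natCast (R := ℝ)]
        norm_num
      have pow_eq : q ^ (n + p + 1) = q ^ (n + 1) * ENNReal.ofReal (Real.exp (-μ * p)) := by
        rw [hq, ← ENNReal.ofReal_pow (Real.exp_pos _).le, ← ENNReal.ofReal_pow (Real.exp_pos _).le,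
          ← ENNReal.ofReal_mul (by positivity), ← Real.exp_nat_mul, ← Real.exp_nat_mul,
          ← Real.exp_add]
        congr 2
        push_cast
        ring
      rw [coeff_eq, pow_eq, mul_assoc, ← ENNReal.ofReal_mul (Real.exp_pos _).le]
      congr 2
      ring
    · intro p
      have := forestWeight_nonneg K k p
      positivity
    · exact (summable_forestWeight hμ K k).mul_left _
  · intro m hm
    rw [treeCount_eq_zero_of_lt hm hK, mul_zero]

theorem cylinderWeight_eq_zero {N n : ℕ} {T₀ : PlanarTree} (hK : T₀.width (n + 1) = 0)
    (hN : N ≠ ballEdges n T₀) : cylinderWeight μ N n T₀ = 0 := by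
  classical
  rw [cylinderWeight, ENNReal.tsum_eq_zero]
  intro T
  rw [if_neg]
  rintro ⟨hsize, hball⟩
  have hheight : T.HeightLE n := fun s hs =>
    width_eq_zero_of_le hs.le (by rw [width_eq_of_ball_eq hball le_rfl, hK])
  rw [← ball_eq_self hheight, size_ball_succ, ballEdges_eq_of_ball_eq hball] at hsize
  exact hN (by exact_mod_cast hsize.symm)

theorem tsum_forestWeight_one_pos {μ : ℝ} (hμ : 0 < μ) (k : ℕ) :
    0 < ∑' p : ℕ, Real.exp (-μ * p) * forestWeight 1 k p := by
  have forestWeight_pos : 0 < forestWeight 1 k 1 := by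
    rw [forestWeight_one]
    refine mul_pos (by positivity) (Finset.sum_pos' (fun i _ => by positivity) ⟨0, by simp, ?_⟩)
    have angle_eq : ((0 : ℕ) + 1 : ℝ) * (Real.pi / ((1 : ℕ) + 2)) = Real.pi / 3 := by
      push_cast; ring
    rw [angle_eq, Real.cos_pi_div_three, Real.sin_pi_div_three]
    positivity
  exact (summable_forestWeight hμ 1 k).tsum_pos
    (fun p => mul_nonneg (Real.exp_pos _).le (forestWeight_nonneg _ _ _)) 1
    (mul_pos (Real.exp_pos _) forestWeight_pos)

instance : Nonempty PlanarTree :=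
  ⟨ofCode (fun r => if r = 0 then [1] else if r = 1 then [0] else []) rfl fun r => by
    match r with
    | 0 => simp
    | 1 => simp
    | r + 2 => simp⟩

theorem partitionFunction_succ {μ : ℝ} (hμ : 0 < μ) (N : ℕ) :
    partitionFunction μ (N + 1) = (1 - ENNReal.ofReal (Real.exp (-μ))) *
      ENNReal.ofReal (Real.exp (-μ)) * ENNReal.ofReal (4 ^ (N + 1) *
          ∑' p : ℕ, Real.exp (-μ * p) * forestWeight 1 N p) := by
  let T₀ := Classical.arbitrary PlanarTree
  have weight_eq := cylinderWeight_eq hμ N 0 (T₀ := T₀) (by simp [T₀.width_one])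
  rwa [ballEdges_zero, T₀.width_one, zero_add, pow_one, add_comm 1 N,
    ← partitionFunction_eq] at weight_eq

theorem partitionFunction_ne_zero_ne_top {μ : ℝ} (hμ : 0 < μ) (N : ℕ) :
    partitionFunction μ (N + 1) ≠ 0 ∧ partitionFunction μ (N + 1) ≠ ⊤ := by
  have := tsum_forestWeight_one_pos hμ N
  rw [partitionFunction_succ hμ]
  constructor
  · refine mul_ne_zero (mul_ne_zero (tsub_pos_of_lt (ofReal_exp_neg_lt_one hμ)).ne' ?_) ?_
    · simpa using Real.exp_pos _
    · rw [ne_eq, ENNReal.ofReal_eq_zero, not_le]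
      positivity
  · exact ENNReal.mul_ne_top (ENNReal.mul_ne_top
      (lt_of_le_of_lt tsub_le_self ENNReal.one_lt_top).ne ENNReal.ofReal_ne_top)
      ENNReal.ofReal_ne_top

theorem isProbabilityMeasure_finiteSizeMeasure {μ : ℝ} (hμ : 0 < μ) (N : ℕ) :
    IsProbabilityMeasure (finiteSizeMeasure μ (N + 1)) := by
  obtain ⟨h0, htop⟩ := partitionFunction_ne_zero_ne_top hμ N
  constructor
  rw [finiteSizeMeasure, Measure.sum_apply _ MeasurableSet.univ]
  simp only [Measure.smul_apply, measure_univ, smul_eq_mul, mul_one, div_eq_mul_inv]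
  rw [ENNReal.tsum_mul_right]
  exact ENNReal.mul_inv_cancel h0 htop

theorem one_le_ballEdges (n : ℕ) (T : PlanarTree) : 1 ≤ ballEdges n T := by
  rw [ballEdges, Finset.sum_range_succ', zero_add, T.width_one]
  omega

theorem finiteSizeMeasure_add_ballEdges_cylinder {μ : ℝ} (hμ : 0 < μ) (k n : ℕ) {T₀ : PlanarTree}
    (hK : T₀.width (n + 1) ≠ 0) : finiteSizeMeasure μ (k + ballEdges n T₀) (cylinder n T₀) =
      ENNReal.ofReal (Real.exp (-μ) ^ n * (4 ^ T₀.width (n + 1) / 4 ^ ballEdges n T₀) *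
        ((∑' p : ℕ, Real.exp (-μ * p) * forestWeight (T₀.width (n + 1)) k p) /
          ∑' p : ℕ, Real.exp (-μ * p) * forestWeight 1 (k + (ballEdges n T₀ - 1)) p)) := by
  obtain ⟨b, hb⟩ : ∃ b, ballEdges n T₀ = b + 1 := Nat.exists_eq_add_of_le' (one_le_ballEdges n T₀)
  have weight_eq := cylinderWeight_eq hμ k n hK
  have one_sub_ne_zero := (tsub_pos_of_lt (ofReal_exp_neg_lt_one hμ)).ne'
  have exp_ne_zero : ENNReal.ofReal (Real.exp (-μ)) ≠ 0 := by simpa using Real.exp_pos _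
  have := tsum_forestWeight_one_pos hμ (k + b)
  rw [finiteSizeMeasure_cylinder, add_comm k, weight_eq, hb, add_comm (b + 1), ← add_assoc k b 1,
    partitionFunction_succ hμ, Nat.add_sub_cancel, pow_succ', ← mul_assoc,
    mul_assoc (_ * _) (_ ^ n),
    ENNReal.mul_div_mul_left _ _ (mul_ne_zero one_sub_ne_zero exp_ne_zero)
      (ENNReal.mul_ne_top (lt_of_le_of_lt tsub_le_self ENNReal.one_lt_top).ne
        ENNReal.ofReal_ne_top),
    ← ENNReal.ofReal_pow (Real.exp_pos _).le, ← ENNReal.ofReal_mul (by positivity),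
    ← ENNReal.ofReal_div_of_pos (by positivity)]
  congr 1
  field_simp
  ring

theorem tendsto_finiteSizeMeasure_cylinder_of_width_eq_zero (n : ℕ) {T₀ : PlanarTree}
    (hK : T₀.width (n + 1) = 0) :
    Tendsto (fun N => finiteSizeMeasure μ N (cylinder n T₀)) atTop (𝓝 0) := by
  refine tendsto_const_nhds.congr' ?_
  filter_upwards [eventually_gt_atTop (ballEdges n T₀)] with N hN
  rw [finiteSizeMeasure_cylinder, cylinderWeight_eq_zero μ hK hN.ne', ENNReal.zero_div]

theorem tendsto_finiteSizeMeasure_cylinder {μ : ℝ} (hμ : 0 < μ) (n : ℕ) (T₀ : PlanarTree) :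
    Tendsto (fun N => finiteSizeMeasure μ N (cylinder n T₀)) atTop
      (𝓝 (ENNReal.ofReal (Real.exp (-μ) ^ n * (2 ^ (T₀.width (n + 1) + 1) / 4 ^ ballEdges n T₀) *
        laguerreSum μ (T₀.width (n + 1))))) := by
  set K := T₀.width (n + 1) with width_eq
  by_cases hK : K = 0
  · have limit_eq_zero : laguerreSum μ K = 0 := by simp [hK, laguerreSum]
    rw [limit_eq_zero, mul_zero, ENNReal.ofReal_zero]
    exact tendsto_finiteSizeMeasure_cylinder_of_width_eq_zero μ n hK
  have limit_eq :
      Real.exp (-μ) ^ n * (4 ^ K / 4 ^ ballEdges n T₀) * (2 / 2 ^ K * laguerreSum μ K) =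
        Real.exp (-μ) ^ n * (2 ^ (K + 1) / 4 ^ ballEdges n T₀) * laguerreSum μ K := by
    have four_pow : (4 : ℝ) ^ K = 2 ^ K * 2 ^ K := by rw [← mul_pow]; norm_num
    rw [four_pow]
    field_simp
    ring
  rw [← tendsto_add_atTop_iff_nat (ballEdges n T₀), ← limit_eq]
  simp only [finiteSizeMeasure_add_ballEdges_cylinder hμ _ n hK, ← width_eq]
  exact ENNReal.tendsto_ofReal
    ((tendsto_tsum_forestWeight_div hμ K (ballEdges n T₀ - 1)).const_mul _)

end FiniteSize

end PlanarTree

section Words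

open ENNReal

theorem tsum_words_eq_choose (n i : ℕ) :
    ∑' w : List Bool, (if w.length = n ∧ w.count true = i then (1 : ENNReal) else 0) =
      (n.choose i : ℕ) := by
  induction n generalizing i with
  | zero =>
    rw [tsum_eq_single []]
    · cases i <;> simp
    · intro w hw
      rw [if_neg]
      rintro ⟨h, -⟩
      exact hw (List.length_eq_zero_iff.1 h)
  | succ n ih =>
    rw [tsum_list_eq_nil_add_tsum_cons, tsum_fintype, Fintype.sum_bool]
    cases i with
    | zero => simpa using ih 0
    | succ i =>
      have starting_with_true := ih i
      have starting_with_false := ih (i + 1)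
      simp only [List.length_nil, (Nat.succ_ne_zero n).symm, false_and, if_false, zero_add,
        List.length_cons, Nat.add_right_cancel_iff, List.count_cons_self]
        at starting_with_true starting_with_false ⊢
      rw [starting_with_true]
      simp only [List.count_cons_of_ne (show (false : Bool) ≠ true by simp)]
      rw [starting_with_false, Nat.choose_succ_succ]
      push_cast
      rfl

theorem tsum_words_pow (x : ENNReal) (i : ℕ) :
    ∑' w : List Bool, (if w.count true = i then x ^ w.length else 0) =
      ∑' n : ℕ, (n.choose i : ℕ) * x ^ n := by
  simp only [← tsum_words_eq_choose, ← ENNReal.tsum_mul_right]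
  rw [ENNReal.tsum_comm]
  refine tsum_congr fun w => ?_
  rw [tsum_eq_single w.length]
  · by_cases h : w.count true = i <;> simp [h]
  · intro n hn
    rw [if_neg, zero_mul]
    rintro ⟨h, -⟩
    exact hn h.symm

theorem two_inv_eq_ofReal : (2⁻¹ : ENNReal) = ENNReal.ofReal (1 / 2) := by
  rw [one_div, ENNReal.ofReal_inv_of_pos (by norm_num), ENNReal.ofReal_ofNat]

theorem tsum_choose_mul_two_inv_pow (i : ℕ) :
    ∑' n : ℕ, (n.choose i : ℕ) * (2⁻¹ : ENNReal) ^ n = 2 := by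
  have shifted_hasSum := (hasSum_choose_mul_geometric_of_norm_lt_one i
    (show ‖(1 / 2 : ℝ)‖ < 1 by norm_num)).mul_left ((1 / 2) ^ i)
  have sum_eq_two : (1 / 2 : ℝ) ^ i * (1 / (1 - 1 / 2) ^ (i + 1)) = 2 := by
    rw [show (1 - 1 / 2 : ℝ) = 1 / 2 by norm_num]
    field_simp
    ring
  have term_eq : ∀ n : ℕ, (((n + i).choose i : ℕ) : ENNReal) * 2⁻¹ ^ (n + i) =
      ENNReal.ofReal ((1 / 2) ^ i * ((n + i).choose i * (1 / 2) ^ n)) := by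
    intro n
    rw [two_inv_eq_ofReal, ← ENNReal.ofReal_pow (by norm_num), ← ENNReal.ofReal_natCast,
      ← ENNReal.ofReal_mul (by positivity), pow_add]
    congr 1
    ring
  rw [tsum_eq_tsum_add_of_forall_lt_eq_zero i fun m hm => by
      rw [Nat.choose_eq_zero_of_lt hm, Nat.cast_zero, zero_mul],
    tsum_congr term_eq, ← ENNReal.ofReal_tsum_of_nonneg (fun n => by positivity)
    shifted_hasSum.summable, shifted_hasSum.tsum_eq, sum_eq_two, ENNReal.ofReal_ofNat]

/-- The number of compositions of `k` into `j` positive parts, computed by choosing the sum `i < k`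
of all parts but one. -/
def compositionCount : ℕ → ℕ → ℕ
  | 0, k => if k = 0 then 1 else 0
  | j + 1, k => ∑ i ∈ Finset.range k, compositionCount j i

theorem compositionCount_eq_zero {j k : ℕ} (h : k < j) : compositionCount j k = 0 := by
  induction j generalizing k with
  | zero => omega
  | succ j ih =>
    rw [compositionCount]
    exact Finset.sum_eq_zero fun i hi => ih (by have := Finset.mem_range.1 hi; omega)

theorem compositionCount_add (j p : ℕ) : compositionCount j (j + p) = j.multichoose p := by
  induction j generalizing p with
  | zero => cases p <;> simp [compositionCount]
  | succ j ih =>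
    induction p with
    | zero =>
      rw [compositionCount, add_zero, Finset.sum_range_succ, Finset.sum_eq_zero, zero_add]
      · simpa using ih 0
      · exact fun i hi => compositionCount_eq_zero (Finset.mem_range.1 hi)
    | succ p ihp =>
      rw [compositionCount, ← add_assoc, Finset.sum_range_succ, ← compositionCount, ihp,
        show j + 1 + p = j + (p + 1) by ring, ih, Nat.multichoose_succ_succ, add_comm]

/-- The number of children of the vertices whose flag in the first list is set; the second list
contains, for each vertex, the list of its children. -/
def flaggedChildren {α : Type*} : List Bool → List (List α) → ℕ
  | d :: c, w :: e => (if d then w.length else 0) + flaggedChildren c e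
  | _, _ => 0

theorem any_eq_true_iff_count_pos (w : List Bool) : w.any id = true ↔ 0 < w.count true := by
  rw [List.count_pos_iff, List.any_eq_true]
  simp

/-- The marks of the vertices of a generation, given, for each of them, the marks of its children: a
vertex is marked if and only if one of its children is. -/
def parentMarks (e : List (List Bool)) : List Bool := e.map fun w => w.any id

/-- The generating function, in the variable `t`, of the number of children of the flagged vertices
of a generation with flags `c` and marks `s`, where a configuration of children with `n` vertices,
exactly `k` of which are marked, has weight `2⁻ⁿ`. -/
noncomputable def flaggedOffspringSum (t : ENNReal) (c s : List Bool) (k : ℕ) : ENNReal :=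
  ∑' e : List (List Bool), if parentMarks e = s ∧ e.flatten.count true = k then
    2⁻¹ ^ e.flatten.length * t ^ flaggedChildren c e else 0

theorem flaggedOffspringSum_nil (t : ENNReal) (k : ℕ) :
    flaggedOffspringSum t [] [] k = if k = 0 then 1 else 0 := by
  rw [flaggedOffspringSum, tsum_eq_single []]
  · by_cases hk : k = 0 <;> simp [parentMarks, flaggedChildren, hk, eq_comm]
  · intro e he
    rw [if_neg]
    rintro ⟨h, -⟩
    exact he (by simpa [parentMarks] using h)

theorem parentMarks_cons_and_count_iff {w : List Bool} {e : List (List Bool)} {b : Bool}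
    {s : List Bool} {k : ℕ} :
    (parentMarks (w :: e) = b :: s ∧ (w :: e).flatten.count true = k) ↔
      (w.any id = b ∧ w.count true ≤ k) ∧
        (parentMarks e = s ∧ e.flatten.count true = k - w.count true) := by
  simp only [parentMarks, List.map_cons, List.cons.injEq, List.flatten_cons, List.count_append]
  constructor
  · rintro ⟨⟨hb, hs⟩, hk⟩
    exact ⟨⟨hb, by omega⟩, hs, by omega⟩
  · rintro ⟨⟨hb, hle⟩, hs, hk⟩
    exact ⟨⟨hb, hs⟩, by omega⟩

theorem flaggedOffspringSum_cons (t : ENNReal) (d b : Bool) (c s : List Bool) (k : ℕ) :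
    flaggedOffspringSum t (d :: c) (b :: s) k =
      ∑' w : List Bool, if w.any id = b ∧ w.count true ≤ k then
        (2⁻¹ * if d then t else 1) ^ w.length *
          flaggedOffspringSum t c s (k - w.count true) else 0 := by
  rw [flaggedOffspringSum, tsum_list_eq_nil_add_tsum_cons, if_neg (by simp [parentMarks]), zero_add]
  refine tsum_congr fun w => ?_
  simp only [parentMarks_cons_and_count_iff]
  by_cases hw : w.any id = b ∧ w.count true ≤ k
  · rw [if_pos hw, flaggedOffspringSum, ← ENNReal.tsum_mul_left]
    refine tsum_congr fun e => ?_
    by_cases he : parentMarks e = s ∧ e.flatten.count true = k - w.count true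
    · rw [if_pos ⟨hw, he⟩, if_pos he, List.flatten_cons, List.length_append, flaggedChildren]
      cases d <;> simp only [Bool.false_eq_true, if_true, if_false, mul_one] <;> ring
    · rw [if_neg fun h => he h.2, if_neg he, mul_zero]
  · simp only [hw, false_and, if_false, tsum_zero]

theorem tsum_unmarked_words (x : ENNReal) (G : ℕ → ENNReal) (k : ℕ) :
    ∑' w : List Bool, (if w.any id = false ∧ w.count true ≤ k then
      x ^ w.length * G (k - w.count true) else 0) = (1 - x)⁻¹ * G k := by
  have term_eq : ∀ w : List Bool, (if w.any id = false ∧ w.count true ≤ k then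
      x ^ w.length * G (k - w.count true) else 0) =
      (if w.count true = 0 then x ^ w.length else 0) * G k := by
    intro w
    have any_eq_false_iff : w.any id = false ↔ w.count true = 0 := by
      rw [← Bool.not_eq_true, any_eq_true_iff_count_pos, Nat.pos_iff_ne_zero, not_not]
    by_cases hw : w.count true = 0
    · rw [if_pos ⟨any_eq_false_iff.2 hw, by omega⟩, if_pos hw, hw, Nat.sub_zero]
    · rw [if_neg fun h => hw (any_eq_false_iff.1 h.1), if_neg hw, zero_mul]
  rw [tsum_congr term_eq, ENNReal.tsum_mul_right, tsum_words_pow]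
  simp only [Nat.choose_zero_right, Nat.cast_one, one_mul, ENNReal.tsum_geometric]

theorem tsum_marked_words (G : ℕ → ENNReal) (k : ℕ) :
    ∑' w : List Bool, (if w.any id = true ∧ w.count true ≤ k then
      2⁻¹ ^ w.length * G (k - w.count true) else 0) = 2 * ∑ i ∈ Finset.range k, G i := by
  have term_eq : ∀ w : List Bool, (if w.any id = true ∧ w.count true ≤ k then
      2⁻¹ ^ w.length * G (k - w.count true) else 0) =
      ∑ i ∈ Finset.range k, (if w.count true = k - i then 2⁻¹ ^ w.length else 0) * G i := by
    intro w
    simp only [any_eq_true_iff_count_pos]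
    split_ifs with hw
    · rw [Finset.sum_eq_single (k - w.count true)]
      · rw [if_pos (by omega)]
      · intro i hi hne
        rw [Finset.mem_range] at hi
        rw [if_neg (by omega), zero_mul]
      · intro hn
        rw [Finset.mem_range] at hn
        omega
    · refine (Finset.sum_eq_zero fun i hi => ?_).symm
      rw [Finset.mem_range] at hi
      rw [if_neg (by omega), zero_mul]
  rw [tsum_congr term_eq, Summable.tsum_finsetSum fun i _ => ENNReal.summable, Finset.mul_sum]
  refine Finset.sum_congr rfl fun i _ => ?_
  rw [ENNReal.tsum_mul_right, tsum_words_pow, tsum_choose_mul_two_inv_pow]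

theorem flaggedOffspringSum_eq (t : ENNReal) {c s : List Bool}
    (h : List.Forall₂ (fun d b => d = true → b = false) c s) (k : ℕ) :
    flaggedOffspringSum t c s k =
      2 ^ c.count false * (1 - t / 2)⁻¹ ^ c.count true * compositionCount (s.count true) k := by
  have true_ne_false : true ≠ false := Bool.noConfusion
  induction h generalizing k with
  | nil => simp [flaggedOffspringSum_nil, compositionCount]
  | @cons d b c s hdb _ ih =>
    simp only [flaggedOffspringSum_cons, ih]
    let G : ℕ → ENNReal := fun k =>
      2 ^ c.count false * (1 - t / 2)⁻¹ ^ c.count true * compositionCount (s.count true) k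
    cases b with
    | false =>
      rw [tsum_unmarked_words _ G, List.count_cons_of_ne true_ne_false.symm]
      cases d with
      | true =>
        rw [if_pos rfl, mul_comm (2⁻¹ : ENNReal) t, ← div_eq_mul_inv, List.count_cons_self,
          List.count_cons_of_ne true_ne_false]
        ring
      | false =>
        rw [if_neg Bool.false_ne_true, mul_one, ENNReal.one_sub_inv_two, inv_inv,
          List.count_cons_self, List.count_cons_of_ne true_ne_false.symm]
        ring
    | true =>
      obtain rfl : d = false := Bool.eq_false_iff.2 fun hd => true_ne_false (hdb hd)
      simp only [Bool.false_eq_true, if_false, mul_one]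
      rw [tsum_marked_words G, ← Finset.mul_sum, List.count_cons_self, List.count_cons_self,
        List.count_cons_of_ne true_ne_false.symm, compositionCount]
      push_cast
      ring

theorem flaggedChildren_replicate_false {α : Type*} (n : ℕ) (e : List (List α)) :
    flaggedChildren (List.replicate n false) e = 0 := by
  induction n generalizing e with
  | zero => simp [flaggedChildren]
  | succ n ih => cases e <;> simp [List.replicate_succ, flaggedChildren, ih]

end Words

section Offspring

/-- The marks of the vertices of one generation, from left to right; at least one of them is
marked. -/
abbrev MarkedLevel : Type := {s : List Bool // 0 < s.count true}

/-- The possible configurations of children of a marked generation `i.1` if the next generation is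
to have `i.2` marked vertices more: the children of each vertex are listed with their marks, and a
vertex is marked if and only if one of its children is. -/
abbrev MarkedOffspring (i : MarkedLevel × ℕ) : Type :=
  {e : List (List Bool) // parentMarks e = i.1.1 ∧ e.flatten.count true = i.1.1.count true + i.2}

instance (i : MarkedLevel × ℕ) : MeasurableSpace (MarkedOffspring i) := ⊤

/-- The probability of the configuration `e` of children of a generation with marks `s`, given that
the next generation has `p` additional marked vertices. Every child contributes a factor `1 / 2`,
and the normalisation contains the number of ways to distribute the additional marks. -/
noncomputable def offspringWeight (s : List Bool) (p : ℕ) (e : List (List Bool)) : ENNReal :=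
  2⁻¹ ^ e.flatten.length * (2⁻¹ ^ s.length * ((s.count true).multichoose p : ENNReal)⁻¹)

theorem multichoose_pos {j : ℕ} (hj : 0 < j) (p : ℕ) : 0 < j.multichoose p := by
  rw [Nat.multichoose_eq]
  exact Nat.choose_pos (by omega)

open Classical in
theorem tsum_markedOffspring (i : MarkedLevel × ℕ) (F : List (List Bool) → ENNReal) :
    ∑' e : MarkedOffspring i, F e.1 = ∑' e : List (List Bool), if parentMarks e = i.1.1 ∧
      e.flatten.count true = i.1.1.count true + i.2 then F e else 0 := by
  refine (tsum_subtype {e : List (List Bool) | parentMarks e = i.1.1 ∧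
    e.flatten.count true = i.1.1.count true + i.2} F).trans ?_
  refine tsum_congr fun e => ?_
  simp [Set.indicator_apply]

theorem tsum_offspringWeight_mul (t : ENNReal) (i : MarkedLevel × ℕ) {c : List Bool}
    (h : List.Forall₂ (fun d b => d = true → b = false) c i.1.1) :
    ∑' e : MarkedOffspring i, offspringWeight i.1.1 i.2 e.1 * t ^ flaggedChildren c e.1 =
      (2⁻¹ * (1 - t / 2)⁻¹) ^ c.count true := by
  classical
  rw [tsum_markedOffspring i fun e => offspringWeight i.1.1 i.2 e * t ^ flaggedChildren c e]
  have multichoose_mul_inv : ((i.1.1.count true).multichoose i.2 : ENNReal) *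
      ((i.1.1.count true).multichoose i.2 : ENNReal)⁻¹ = 1 :=
    ENNReal.mul_inv_cancel (by exact_mod_cast (multichoose_pos i.1.2 i.2).ne') (by simp)
  have two_pow_mul : (2 : ENNReal) ^ c.count false * 2⁻¹ ^ c.count false = 1 := by
    rw [← mul_pow, ENNReal.mul_inv_cancel (by simp) (by simp), one_pow]
  have term_eq : ∀ e : List (List Bool), (if parentMarks e = i.1.1 ∧
      e.flatten.count true = i.1.1.count true + i.2 then
        offspringWeight i.1.1 i.2 e * t ^ flaggedChildren c e else 0) =
      (if parentMarks e = i.1.1 ∧ e.flatten.count true = i.1.1.count true + i.2 then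
        2⁻¹ ^ e.flatten.length * t ^ flaggedChildren c e else 0) *
      (2⁻¹ ^ i.1.1.length * ((i.1.1.count true).multichoose i.2 : ENNReal)⁻¹) := by
    intro e
    split_ifs
    · rw [offspringWeight]
      ring
    · rw [zero_mul]
  rw [tsum_congr term_eq, ENNReal.tsum_mul_right, ← flaggedOffspringSum, flaggedOffspringSum_eq t h,
    compositionCount_add, ← h.length_eq, ← List.count_false_add_count_true c, pow_add, mul_pow]
  calc _ = (2 ^ c.count false * 2⁻¹ ^ c.count false) *
        (((i.1.1.count true).multichoose i.2 : ENNReal) *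
          ((i.1.1.count true).multichoose i.2 : ENNReal)⁻¹) *
        (2⁻¹ ^ c.count true * (1 - t / 2)⁻¹ ^ c.count true) := by ring
    _ = _ := by rw [two_pow_mul, multichoose_mul_inv, one_mul, one_mul]

theorem tsum_offspringWeight (i : MarkedLevel × ℕ) :
    ∑' e : MarkedOffspring i, offspringWeight i.1.1 i.2 e.1 = 1 := by
  have no_flags : List.Forall₂ (fun d b => d = true → b = false)
      (List.replicate i.1.1.length false) i.1.1 := by
    rw [List.forall₂_iff_get]
    exact ⟨List.length_replicate, fun k _ _ hflag => by simp at hflag⟩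
  simpa [flaggedChildren_replicate_false, List.count_replicate] using
    tsum_offspringWeight_mul 1 i no_flags

/-- The law of the configuration of children of a marked generation, given the number of additional
marked vertices. -/
noncomputable def offspringPMF (i : MarkedLevel × ℕ) : PMF (MarkedOffspring i) :=
  ⟨fun e => offspringWeight i.1.1 i.2 e.1, by
    rw [← tsum_offspringWeight i]
    exact ENNReal.summable.hasSum⟩

end Offspring

section RecursiveChain

open ProbabilityTheory

variable {S W : Type*} [MeasurableSpace W] [MeasurableSpace S] [DiscreteMeasurableSpace S]
  [Countable S]

/-- The states of a system that starts in `s₀` and whose `n`-th step from the state `s` leads to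
`F s (ω n)`. With independent inputs `ω 0, ω 1, …` this is a Markov chain with transitions `F`. -/
def recursiveChain (F : S → W → S) (s₀ : S) (ω : ℕ → W) : ℕ → S
  | 0 => s₀
  | n + 1 => F (recursiveChain F s₀ ω n) (ω n)

theorem measurable_recursiveChain {F : S → W → S} (hF : ∀ s, Measurable (F s)) (s₀ : S) (n : ℕ) :
    Measurable fun ω => recursiveChain F s₀ ω n := by
  induction n with
  | zero => exact measurable_const
  | succ n ih =>
    have hF' : Measurable (Function.uncurry F) := measurable_from_prod_countable_right hF
    exact hF'.comp (ih.prodMk (measurable_pi_apply n))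

theorem exists_recursiveChain_eq_comp_restrict {F : S → W → S} (hF : ∀ s, Measurable (F s))
    (s₀ : S) (n : ℕ) : ∃ g : (Finset.range n → W) → S, Measurable g ∧
      ∀ ω, recursiveChain F s₀ ω n = g fun i => ω i := by
  induction n with
  | zero => exact ⟨fun _ => s₀, measurable_const, fun _ => rfl⟩
  | succ n ih =>
    obtain ⟨g, hg, hchain⟩ := ih
    have hF' : Measurable (Function.uncurry F) := measurable_from_prod_countable_right hF
    refine ⟨fun y => F (g fun i => y ⟨i.1, Finset.range_subset_range.2 (Nat.le_succ n) i.2⟩)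
      (y ⟨n, Finset.self_mem_range_succ n⟩), ?_, fun ω => ?_⟩
    · exact hF'.comp ((hg.comp (measurable_pi_lambda _ fun i => measurable_pi_apply _)).prodMk
        (measurable_pi_apply _))
    · rw [recursiveChain, hchain]

theorem indepFun_recursiveChain {F : S → W → S} (hF : ∀ s, Measurable (F s))
    (s₀ : S) (n : ℕ) (κ : Measure W) [IsProbabilityMeasure κ] :
    IndepFun (fun ω => recursiveChain F s₀ ω n) (fun ω => ω n)
      (Measure.infinitePi fun _ : ℕ => κ) := by
  obtain ⟨g, hg, hchain⟩ := exists_recursiveChain_eq_comp_restrict hF s₀ n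
  have hind : iIndepFun (fun (i : ℕ) (ω : ℕ → W) => ω i) (Measure.infinitePi fun _ : ℕ => κ) :=
    iIndepFun_infinitePi (X := fun _ w => w) fun _ => measurable_id
  simp only [hchain]
  exact (hind.indepFun_finset (Finset.range n) {n} (by simp)
    fun i => measurable_pi_apply i).comp hg
      (measurable_pi_apply (⟨n, Finset.mem_singleton_self n⟩ : ({n} : Finset ℕ)))

end RecursiveChain

section MarkedHistory

open ProbabilityTheory
open scoped NNReal

theorem count_parentMarks_le_count_flatten (e : List (List Bool)) :
    (parentMarks e).count true ≤ e.flatten.count true := by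
  induction e with
  | nil => simp [parentMarks]
  | cons w e ih =>
    have hw := any_eq_true_iff_count_pos w
    rw [parentMarks] at ih ⊢
    rw [List.map_cons, List.flatten_cons, List.count_append, List.count_cons]
    cases hb : w.any id
    · simpa using by omega
    · have := hw.1 hb
      simpa using by omega

/-- The randomness that determines the children of one generation: the number of additional marks,
and a tentative offspring for every possible pair of a marked generation and a number of additional
marks. Drawing all tentative offspring in advance keeps the inputs of different generations
independent. -/
abbrev OffspringInput : Type := ℕ × ((i : MarkedLevel × ℕ) → MarkedOffspring i)

/-- The offspring that the input `w` selects for the marked generation `s`. -/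
def chosenOffspring (s : MarkedLevel) (w : OffspringInput) : MarkedOffspring (s, w.1) :=
  w.2 (s, w.1)

/-- The states of the chain that builds the marked tree: the offspring of the successive
generations, the last one first, together with the marks of the last generation. -/
def MarkedHistory : Type := List (List (List Bool)) × MarkedLevel

instance : MeasurableSpace MarkedHistory := ⊤

instance : DiscreteMeasurableSpace MarkedHistory := ⟨fun _ => trivial⟩

instance : Countable MarkedHistory :=
  inferInstanceAs (Countable (List (List (List Bool)) × MarkedLevel))

/-- The transition of the chain of histories: it appends the offspring selected by `w`. -/
def MarkedHistory.next (h : MarkedHistory) (w : OffspringInput) : MarkedHistory :=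
  ((chosenOffspring h.2 w).1 :: h.1, ⟨(chosenOffspring h.2 w).1.flatten, by
    rw [(chosenOffspring h.2 w).2.2]
    exact Nat.add_pos_left h.2.2 _⟩)

theorem measurable_comp_chosenOffspring (s : MarkedLevel) {α : Type*} [MeasurableSpace α]
    (f : List (List Bool) → α) :
    Measurable fun w : OffspringInput => f (chosenOffspring s w).1 := by
  refine measurable_from_prod_countable_right fun p => ?_
  exact (measurable_from_top (f := fun e : MarkedOffspring (s, p) => f e.1)).comp
    (measurable_pi_apply (s, p))

theorem MarkedHistory.measurable_next (h : MarkedHistory) : Measurable h.next := by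
  classical
  let g : List (List Bool) → MarkedHistory := fun e =>
    if he : 0 < e.flatten.count true then (e :: h.1, ⟨e.flatten, he⟩) else h
  have hnext : h.next = fun w => g (chosenOffspring h.2 w).1 := by
    funext w
    have hpos : 0 < (chosenOffspring h.2 w).1.flatten.count true := (h.next w).2.2
    exact (dif_pos hpos : g (chosenOffspring h.2 w).1 = _).symm
  rw [hnext]
  exact measurable_comp_chosenOffspring h.2 g

/-- The law of the input of one generation: the number of additional marks is Poisson with mean `a`,
and independently every tentative offspring is drawn according to the offspring weights. -/
noncomputable def offspringInputMeasure (a : ℝ≥0) : Measure OffspringInput :=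
  (poissonMeasure a).prod (Measure.infinitePi fun i => (offspringPMF i).toMeasure)

instance (a : ℝ≥0) : IsProbabilityMeasure (offspringInputMeasure a) := by
  rw [offspringInputMeasure]
  infer_instance

theorem offspringInputMeasure_fst_mem_and (a : ℝ≥0) (s : MarkedLevel) (p : ℕ)
    (e : MarkedOffspring (s, p)) :
    offspringInputMeasure a {w | w.1 = p ∧ w.2 (s, p) = e} =
      ENNReal.ofReal (Real.exp (-a) * a ^ p / p.factorial) * offspringWeight s.1 p e.1 := by
  have hprod : {w : OffspringInput | w.1 = p ∧ w.2 (s, p) = e} =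
      ({p} : Set ℕ) ×ˢ
        ((fun f : (i : MarkedLevel × ℕ) → MarkedOffspring i => f (s, p)) ⁻¹' {e}) := by
    ext w
    simp
  have he : MeasurableSet ({e} : Set (MarkedOffspring (s, p))) := trivial
  rw [hprod, offspringInputMeasure, Measure.prod_prod, poissonMeasure_singleton,
    (measurePreserving_eval_infinitePi (fun i => (offspringPMF i).toMeasure)
      (s, p)).measure_preimage he.nullMeasurableSet, PMF.toMeasure_apply_singleton _ _ he]
  rfl

theorem offspringInputMeasure_chosenOffspring_eq (a : ℝ≥0) (s : MarkedLevel)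
    {e : List (List Bool)} (he : parentMarks e = s.1) {p : ℕ}
    (hp : e.flatten.count true = s.1.count true + p) :
    offspringInputMeasure a {w | (chosenOffspring s w).1 = e} =
      ENNReal.ofReal (Real.exp (-a) * a ^ p / p.factorial) * offspringWeight s.1 p e := by
  rw [← offspringInputMeasure_fst_mem_and a s p ⟨e, he, hp⟩]
  congr 1
  ext ⟨q, f⟩
  constructor
  · intro (hchosen : (f (s, q)).1 = e)
    obtain rfl : q = p := by
      have hcount := (f (s, q)).2.2
      rw [hchosen, hp] at hcount
      simpa using hcount.symm
    exact ⟨rfl, Subtype.ext hchosen⟩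
  · rintro ⟨hq, hfe⟩
    obtain rfl : q = p := hq
    exact congrArg Subtype.val hfe

/-- The probability measure that underlies the marked tree: the inputs of the generations are
independent with law `offspringInputMeasure a`. -/
noncomputable def markedTreeMeasure (a : ℝ≥0) : Measure (ℕ → OffspringInput) :=
  Measure.infinitePi fun _ => offspringInputMeasure a

instance (a : ℝ≥0) : IsProbabilityMeasure (markedTreeMeasure a) := by
  rw [markedTreeMeasure]
  infer_instance

/-- The history of the marked tree up to the generation `n + 1`. It starts with a single marked
vertex, the unique vertex of the generation `1`. -/
def markedHistory (ω : ℕ → OffspringInput) (n : ℕ) : MarkedHistory :=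
  recursiveChain MarkedHistory.next ([], ⟨[true], by simp⟩) ω n

theorem measurable_markedHistory (n : ℕ) : Measurable fun ω => markedHistory ω n :=
  measurable_recursiveChain MarkedHistory.measurable_next _ n

theorem indepFun_markedHistory (a : ℝ≥0) (n : ℕ) :
    IndepFun (fun ω => markedHistory ω n) (fun ω => ω n) (markedTreeMeasure a) :=
  indepFun_recursiveChain MarkedHistory.measurable_next _ n _

theorem measurePreserving_eval_markedTreeMeasure (a : ℝ≥0) (n : ℕ) :
    MeasurePreserving (fun ω : ℕ → OffspringInput => ω n) (markedTreeMeasure a)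
      (offspringInputMeasure a) :=
  measurePreserving_eval_infinitePi (fun _ : ℕ => offspringInputMeasure a) n

theorem markedTreeMeasure_history_mem_and (a : ℝ≥0) (n : ℕ) (A : Set MarkedHistory)
    {B : Set OffspringInput} (hB : MeasurableSet B) :
    markedTreeMeasure a {ω | markedHistory ω n ∈ A ∧ ω n ∈ B} =
      markedTreeMeasure a {ω | markedHistory ω n ∈ A} * offspringInputMeasure a B := by
  rw [← (measurePreserving_eval_markedTreeMeasure a n).measure_preimage hB.nullMeasurableSet]
  exact (indepFun_markedHistory a n).measure_inter_preimage_eq_mul A B MeasurableSet.of_discrete hB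

theorem lintegral_markedHistory (a : ℝ≥0) (n : ℕ) {F : MarkedHistory → OffspringInput → ENNReal}
    (hF : ∀ h, Measurable (F h)) :
    ∫⁻ ω, F (markedHistory ω n) (ω n) ∂(markedTreeMeasure a) =
      ∫⁻ ω, ∫⁻ w, F (markedHistory ω n) w ∂(offspringInputMeasure a) ∂(markedTreeMeasure a) := by
  have hhist := measurable_markedHistory n
  have hF' : Measurable (Function.uncurry F) := measurable_from_prod_countable_right hF
  have heval := (measurePreserving_eval_markedTreeMeasure a n).measurable
  have hlaw := (indepFun_iff_map_prod_eq_prod_map_map hhist.aemeasurable heval.aemeasurable).1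
    (indepFun_markedHistory a n)
  rw [(measurePreserving_eval_markedTreeMeasure a n).map_eq] at hlaw
  calc _ = ∫⁻ x, Function.uncurry F x ∂((markedTreeMeasure a).map
        fun ω => (markedHistory ω n, ω n)) := (lintegral_map hF' (hhist.prodMk heval)).symm
    _ = _ := by
      rw [hlaw, lintegral_prod _ hF'.aemeasurable, lintegral_map _ hhist]
      · rfl
      · exact measurable_from_top

theorem lintegral_chosenOffspring (a : ℝ≥0) (s : MarkedLevel) (f : List (List Bool) → ENNReal) :
    ∫⁻ w, f (chosenOffspring s w).1 ∂(offspringInputMeasure a) =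
      ∫⁻ p, ∑' e : MarkedOffspring (s, p), offspringWeight s.1 p e.1 * f e.1
        ∂(poissonMeasure a) := by
  rw [offspringInputMeasure, lintegral_prod _ (measurable_comp_chosenOffspring s f).aemeasurable]
  refine lintegral_congr fun p => ?_
  have hf : Measurable fun e : MarkedOffspring (s, p) => f e.1 := measurable_from_top
  refine ((measurePreserving_eval_infinitePi (fun i => (offspringPMF i).toMeasure)
    (s, p)).lintegral_comp hf).trans ?_
  have hsingleton (e : MarkedOffspring (s, p)) : MeasurableSet ({e} : Set _) := trivial
  have : MeasurableSingletonClass (MarkedOffspring (s, p)) := ⟨hsingleton⟩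
  rw [lintegral_countable']
  refine tsum_congr fun e => ?_
  rw [PMF.toMeasure_apply_singleton _ _ (hsingleton e), mul_comm]
  rfl

/-- The marks of the vertices in the generation `n + 1` of the marked tree. -/
def markedLevel (ω : ℕ → OffspringInput) (n : ℕ) : MarkedLevel := (markedHistory ω n).2

/-- The marks of the children of the vertices in the generation `n + 1` of the marked tree. -/
def markedChildren (ω : ℕ → OffspringInput) (n : ℕ) : List (List Bool) :=
  (chosenOffspring (markedLevel ω n) (ω n)).1

theorem markedHistory_succ (ω : ℕ → OffspringInput) (n : ℕ) :
    (markedHistory ω (n + 1)).1 = markedChildren ω n :: (markedHistory ω n).1 := rfl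

theorem markedLevel_zero (ω : ℕ → OffspringInput) : (markedLevel ω 0).1 = [true] := rfl

theorem markedLevel_succ (ω : ℕ → OffspringInput) (n : ℕ) :
    (markedLevel ω (n + 1)).1 = (markedChildren ω n).flatten := rfl

theorem parentMarks_markedChildren (ω : ℕ → OffspringInput) (n : ℕ) :
    parentMarks (markedChildren ω n) = (markedLevel ω n).1 :=
  (chosenOffspring (markedLevel ω n) (ω n)).2.1

theorem count_markedLevel (ω : ℕ → OffspringInput) (n : ℕ) :
    (markedLevel ω n).1.count true = 1 + ∑ i ∈ Finset.range n, (ω i).1 := by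
  induction n with
  | zero => simp [markedLevel_zero]
  | succ n ih =>
    rw [Finset.sum_range_succ, ← add_assoc, ← ih, markedLevel_succ]
    exact (chosenOffspring (markedLevel ω n) (ω n)).2.2

theorem length_markedChildren (ω : ℕ → OffspringInput) (n : ℕ) :
    (markedChildren ω n).length = (markedLevel ω n).1.length := by
  rw [← parentMarks_markedChildren, parentMarks, List.length_map]

/-- The random tree that realises the local limit: the tree whose generation `n + 2` consists of the
`markedChildren` of the generation `n + 1`, with the marks forgotten. -/
def markedTree (ω : ℕ → OffspringInput) : PlanarTree :=
  PlanarTree.ofCode (fun r => r.casesOn [1] fun n => (markedChildren ω n).map List.length) rfl <| by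
    rintro (_ | n)
    · simp [length_markedChildren, markedLevel_zero]
    · simp [length_markedChildren, markedLevel_succ, List.length_flatten]

theorem code_markedTree_succ (ω : ℕ → OffspringInput) (n : ℕ) :
    (markedTree ω).code (n + 1) = (markedChildren ω n).map List.length := by
  rw [markedTree, PlanarTree.code_ofCode]

theorem width_markedTree_succ (ω : ℕ → OffspringInput) (n : ℕ) :
    (markedTree ω).width (n + 1) = (markedLevel ω n).1.length := by
  rw [← PlanarTree.length_code, code_markedTree_succ, List.length_map, length_markedChildren]

end MarkedHistory

section CylinderProbability

open scoped NNReal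

theorem count_parentMarks_pos {e : List (List Bool)} (h : 0 < e.flatten.count true) :
    0 < (parentMarks e).count true := by
  rw [List.count_pos_iff, List.mem_flatten] at h
  obtain ⟨w, hw, hm⟩ := h
  rw [List.count_pos_iff, parentMarks, List.mem_map]
  exact ⟨w, hw, (any_eq_true_iff_count_pos w).2 (List.count_pos_iff.2 hm)⟩

theorem PlanarTree.mem_cylinder_succ {n : ℕ} {T T₀ : PlanarTree} :
    T ∈ cylinder (n + 1) T₀ ↔ T ∈ cylinder n T₀ ∧ T.code (n + 1) = T₀.code (n + 1) := by
  simp only [cylinder, Set.mem_ofPred_eq, ball_succ_eq_iff]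
  constructor
  · exact fun h => ⟨fun s hs => h s (by omega), h _ le_rfl⟩
  · rintro ⟨hball, hlast⟩ s hs
    rcases Nat.le_succ_iff.1 hs with h | rfl
    · exact hball s h
    · exact hlast

theorem PlanarTree.mem_cylinder_zero (T T₀ : PlanarTree) : T ∈ cylinder 0 T₀ := by
  simp only [cylinder, Set.mem_ofPred_eq, ball_succ_eq_iff]
  intro s hs
  rw [Nat.le_zero.1 hs, code_zero, code_zero]

open PlanarTree

theorem exists_markedTree_mem_cylinder_iff (n : ℕ) (T₀ : PlanarTree) :
    ∃ A : Set (List (List (List Bool))), ∀ ω,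
      markedTree ω ∈ cylinder n T₀ ↔ (markedHistory ω n).1 ∈ A := by
  induction n with
  | zero => exact ⟨Set.univ, fun ω => iff_of_true (mem_cylinder_zero _ _) trivial⟩
  | succ n ih =>
    obtain ⟨A, hA⟩ := ih
    refine ⟨{x | ∃ e l, x = e :: l ∧ l ∈ A ∧ e.map List.length = T₀.code (n + 1)}, fun ω => ?_⟩
    rw [mem_cylinder_succ, hA, code_markedTree_succ, markedHistory_succ]
    constructor
    · exact fun h => ⟨_, _, rfl, h⟩
    · rintro ⟨e, l, hcons, h⟩
      obtain ⟨rfl, rfl⟩ := List.cons.inj hcons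
      exact h

theorem offspringWeight_eq_ofReal {s : List Bool} (hs : 0 < s.count true) (p : ℕ)
    (e : List (List Bool)) : offspringWeight s p e = ENNReal.ofReal ((1 / 2) ^ e.flatten.length *
      ((1 / 2) ^ s.length * ((s.count true).multichoose p : ℝ)⁻¹)) := by
  have hm : (0 : ℝ) < ((s.count true).multichoose p : ℝ) := by
    exact_mod_cast multichoose_pos hs p
  rw [offspringWeight, two_inv_eq_ofReal, ENNReal.ofReal_mul (by positivity),
    ENNReal.ofReal_mul (by positivity), ENNReal.ofReal_pow (by norm_num),
    ENNReal.ofReal_pow (by norm_num), ENNReal.ofReal_inv_of_pos hm, ENNReal.ofReal_natCast]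

theorem multichoose_succ_mul_factorial (i p : ℕ) :
    ((i + 1).multichoose p : ℝ) * (i.factorial * p.factorial) = (i + p).factorial := by
  rw [Nat.multichoose_eq, show i + 1 + p - 1 = i + p by omega, Nat.add_choose,
    Nat.cast_div (Nat.factorial_mul_factorial_dvd_factorial_add i p) (by positivity)]
  push_cast
  field_simp

theorem length_markedLevel_of_mem_cylinder {n : ℕ} {T₀ : PlanarTree} {ω : ℕ → OffspringInput}
    (h : markedTree ω ∈ cylinder n T₀) : (markedLevel ω n).1.length = T₀.width (n + 1) := by
  rw [← width_markedTree_succ]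
  exact width_eq_of_ball_eq h le_rfl

theorem measurableSet_markedTree_mem_cylinder_and_level (n : ℕ) (T₀ : PlanarTree)
    (s : List Bool) :
    MeasurableSet {ω | markedTree ω ∈ cylinder n T₀ ∧ (markedLevel ω n).1 = s} := by
  obtain ⟨A, hA⟩ := exists_markedTree_mem_cylinder_iff n T₀
  simp only [hA]
  exact measurable_markedHistory n
    (MeasurableSet.of_discrete (s := {h : MarkedHistory | h.1 ∈ A ∧ h.2.1 = s}))

theorem markedTree_mem_cylinder_succ_and_level_iff {n : ℕ} {T₀ : PlanarTree}
    {e : List (List Bool)} (hcode : e.map List.length = T₀.code (n + 1)) (ω : ℕ → OffspringInput) :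
    markedTree ω ∈ cylinder (n + 1) T₀ ∧ (markedLevel ω (n + 1)).1 = e.flatten ↔
      markedTree ω ∈ cylinder n T₀ ∧ markedChildren ω n = e := by
  rw [mem_cylinder_succ, code_markedTree_succ, and_assoc, markedLevel_succ, ← hcode,
    List.eq_iff_flatten_eq, and_comm (a := (markedChildren ω n).flatten = _)]

theorem markedTreeMeasure_cylinder_succ_and_level (a : ℝ≥0) {n p : ℕ} {T₀ : PlanarTree}
    {e : List (List Bool)} (hcode : e.map List.length = T₀.code (n + 1))
    (hpos : 0 < (parentMarks e).count true)
    (hp : e.flatten.count true = (parentMarks e).count true + p) :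
    markedTreeMeasure a
        {ω | markedTree ω ∈ cylinder (n + 1) T₀ ∧ (markedLevel ω (n + 1)).1 = e.flatten} =
      markedTreeMeasure a {ω | markedTree ω ∈ cylinder n T₀ ∧ (markedLevel ω n).1 = parentMarks e} *
        (ENNReal.ofReal (Real.exp (-a) * a ^ p / p.factorial) *
          offspringWeight (parentMarks e) p e) := by
  obtain ⟨A, hA⟩ := exists_markedTree_mem_cylinder_iff n T₀
  let s : MarkedLevel := ⟨parentMarks e, hpos⟩
  have hmeas : MeasurableSet {w | (chosenOffspring s w).1 = e} :=
    measurable_comp_chosenOffspring s (fun e' => e' = e)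
      (MeasurableSet.of_discrete (s := {q : Prop | q}))
  have hchildren {ω} (hlevel : (markedLevel ω n).1 = parentMarks e) :
      markedChildren ω n = (chosenOffspring s (ω n)).1 :=
    congrArg (fun s => (chosenOffspring s (ω n)).1) (Subtype.ext hlevel : markedLevel ω n = s)
  have hevent : {ω | markedTree ω ∈ cylinder (n + 1) T₀ ∧
        (markedLevel ω (n + 1)).1 = e.flatten} =
      {ω | markedHistory ω n ∈ {h : MarkedHistory | h.1 ∈ A ∧ h.2.1 = parentMarks e} ∧
        ω n ∈ {w | (chosenOffspring s w).1 = e}} := by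
    ext ω
    refine (markedTree_mem_cylinder_succ_and_level_iff hcode ω).trans ?_
    rw [hA]
    constructor
    · rintro ⟨hmem, rfl⟩
      have hlevel := (parentMarks_markedChildren ω n).symm
      exact ⟨⟨hmem, hlevel⟩, (hchildren hlevel).symm⟩
    · rintro ⟨⟨hmem, hlevel⟩, hchosen⟩
      exact ⟨hmem, (hchildren hlevel).trans hchosen⟩
  rw [hevent, markedTreeMeasure_history_mem_and a n _ hmeas,
    offspringInputMeasure_chosenOffspring_eq a s rfl hp]
  simp only [hA]
  rfl

theorem markedTreeMeasure_cylinder_and_level (a : ℝ≥0) (n : ℕ) (T₀ : PlanarTree) (s : List Bool)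
    (i : ℕ) (hi : s.count true = i + 1) (hlen : s.length = T₀.width (n + 1)) :
    markedTreeMeasure a {ω | markedTree ω ∈ cylinder n T₀ ∧ (markedLevel ω n).1 = s} =
      ENNReal.ofReal (Real.exp (-a) ^ n *
        (2 ^ (T₀.width (n + 1) + 1) / 4 ^ ballEdges n T₀) * (a ^ i / i.factorial)) := by
  induction n generalizing s i with
  | zero =>
    rw [zero_add, width_one] at hlen
    obtain ⟨b, rfl⟩ := List.length_eq_one_iff.1 hlen
    obtain rfl : b = true := by
      by_contra hb
      simp [hb] at hi
    obtain rfl : i = 0 := by simpa using hi.symm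
    have huniv : {ω : ℕ → OffspringInput | markedTree ω ∈ cylinder 0 T₀ ∧
        (markedLevel ω 0).1 = [true]} = Set.univ :=
      Set.eq_univ_of_forall fun ω => ⟨mem_cylinder_zero _ _, markedLevel_zero ω⟩
    rw [ballEdges_zero, zero_add, width_one, huniv, measure_univ]
    norm_num
  | succ n ih =>
    have hsum : s.length = (T₀.code (n + 1)).sum := by rw [hlen, sum_code]
    obtain ⟨e, hcode, rfl⟩ : ∃ e : List (List Bool),
        e.map List.length = T₀.code (n + 1) ∧ e.flatten = s :=
      ⟨_, List.map_splitLengths_length _ _ hsum.ge, List.flatten_splitLengths _ _ hsum.le⟩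
    have hpos : 0 < (parentMarks e).count true := count_parentMarks_pos (by omega)
    obtain ⟨j, hj⟩ : ∃ j, (parentMarks e).count true = j + 1 :=
      ⟨_, (Nat.succ_pred_eq_of_pos hpos).symm⟩
    obtain ⟨p, hp⟩ := Nat.exists_eq_add_of_le (count_parentMarks_le_count_flatten e)
    have hparents : (parentMarks e).length = T₀.width (n + 1) := by
      rw [← length_code, ← hcode, parentMarks, List.length_map, List.length_map]
    obtain rfl : i = j + p := by omega
    have hmultichoose : (((j + 1).multichoose p : ℕ) : ℝ) ≠ 0 := by
      exact_mod_cast (multichoose_pos (Nat.succ_pos j) p).ne'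
    rw [markedTreeMeasure_cylinder_succ_and_level a hcode hpos hp, ih _ j hj hparents,
      offspringWeight_eq_ofReal hpos, ← ENNReal.ofReal_mul (by positivity),
      ← ENNReal.ofReal_mul (by positivity), hlen, hparents, hj, ballEdges_succ,
      ← multichoose_succ_mul_factorial j p]
    congr 1
    rw [show (4 : ℝ) = 2 * 2 by norm_num, mul_pow, mul_pow, show n + 1 + 1 = n + 2 by ring]
    simp only [pow_add, one_div, inv_pow]
    field_simp

theorem markedTreeMeasure_cylinder_and_level_eq_sum (a : ℝ≥0) (n : ℕ) (T₀ : PlanarTree)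
    (s : List Bool) :
    markedTreeMeasure a {ω | markedTree ω ∈ cylinder n T₀ ∧ (markedLevel ω n).1 = s} =
      ∑ i ∈ Finset.range (T₀.width (n + 1)),
        (if s.length = T₀.width (n + 1) ∧ s.count true = i + 1 then 1 else 0) *
          ENNReal.ofReal (Real.exp (-a) ^ n *
            (2 ^ (T₀.width (n + 1) + 1) / 4 ^ ballEdges n T₀) * (a ^ i / i.factorial)) := by
  by_cases hs : s.length = T₀.width (n + 1) ∧ 0 < s.count true
  · obtain ⟨hlen, hpos⟩ := hs
    obtain ⟨i, hi⟩ : ∃ i, s.count true = i + 1 := ⟨_, (Nat.succ_pred_eq_of_pos hpos).symm⟩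
    have hmem : i ∈ Finset.range (T₀.width (n + 1)) := by
      have := List.count_le_length (a := true) (l := s)
      rw [Finset.mem_range]
      omega
    rw [markedTreeMeasure_cylinder_and_level a n T₀ s i hi hlen,
      Finset.sum_eq_single_of_mem i hmem fun j _ hne => by rw [if_neg (by omega), zero_mul],
      if_pos ⟨hlen, hi⟩, one_mul]
  · have hempty : {ω | markedTree ω ∈ cylinder n T₀ ∧ (markedLevel ω n).1 = s} = ∅ := by
      refine Set.eq_empty_of_forall_notMem ?_
      rintro ω ⟨hmem, rfl⟩
      exact hs ⟨length_markedLevel_of_mem_cylinder hmem, (markedLevel ω n).2⟩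
    rw [hempty, measure_empty, Finset.sum_eq_zero fun i _ => by rw [if_neg (by omega), zero_mul]]

theorem markedTreeMeasure_cylinder (a : ℝ≥0) (n : ℕ) (T₀ : PlanarTree) :
    markedTreeMeasure a {ω | markedTree ω ∈ cylinder n T₀} =
      ENNReal.ofReal (Real.exp (-a) ^ n * (2 ^ (T₀.width (n + 1) + 1) / 4 ^ ballEdges n T₀) *
        laguerreSum a (T₀.width (n + 1))) := by
  have hunion : {ω | markedTree ω ∈ cylinder n T₀} =
      ⋃ s : List Bool, {ω | markedTree ω ∈ cylinder n T₀ ∧ (markedLevel ω n).1 = s} := by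
    ext ω
    simp
  have hdisjoint : Pairwise (Function.onFun Disjoint fun s : List Bool =>
      {ω | markedTree ω ∈ cylinder n T₀ ∧ (markedLevel ω n).1 = s}) :=
    fun s s' hne => Set.disjoint_left.2 fun ω hs hs' => hne (hs.2.symm.trans hs'.2)
  rw [hunion, measure_iUnion hdisjoint (measurableSet_markedTree_mem_cylinder_and_level n T₀),
    tsum_congr (markedTreeMeasure_cylinder_and_level_eq_sum a n T₀),
    Summable.tsum_finsetSum fun _ _ => ENNReal.summable, laguerreSum,
    Finset.mul_sum, ENNReal.ofReal_sum_of_nonneg fun i _ => by positivity]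
  refine Finset.sum_congr rfl fun i _ => ?_
  rw [ENNReal.tsum_mul_right, tsum_words_eq_choose, ← ENNReal.ofReal_natCast,
    ← ENNReal.ofReal_mul (by positivity)]
  congr 1
  ring

end CylinderProbability

section LocalLimit

open scoped NNReal

namespace PlanarTree

/-- The sets of trees with a given ball of positive radius. They form a countable π-system and a
basis of the topology, so that both measurability and weak convergence can be tested on them. -/
def cylinders : Set (Set PlanarTree) := {s | ∃ n T₀, s = cylinder n T₀}

theorem countable_cylinders : cylinders.Countable := by
  refine (Set.countable_range fun p : ℕ × List (List ℕ) =>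
    {T : PlanarTree | (List.range (p.1 + 1)).map T.code = p.2}).mono ?_
  rintro _ ⟨n, T₀, rfl⟩
  refine ⟨(n, (List.range (n + 1)).map T₀.code), ?_⟩
  ext T
  simp only [cylinder, Set.mem_ofPred_eq, ball_succ_eq_iff]
  rw [List.map_inj_left]
  simp only [List.mem_range, Nat.lt_succ_iff]

theorem mem_cylinder_self (n : ℕ) (T : PlanarTree) : T ∈ cylinder n T := rfl

theorem isTopologicalBasis_cylinders : TopologicalSpace.IsTopologicalBasis cylinders := by
  refine TopologicalSpace.isTopologicalBasis_of_isOpen_of_nhds ?_ fun T U hT hU => ?_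
  · rintro _ ⟨n, T₀, rfl⟩
    exact isOpen_cylinder n T₀
  · obtain ⟨n, hn⟩ := exists_cylinder_subset hU hT
    exact ⟨_, ⟨n, T, rfl⟩, mem_cylinder_self n T, hn⟩

instance : SecondCountableTopology PlanarTree :=
  isTopologicalBasis_cylinders.secondCountableTopology countable_cylinders

theorem isPiSystem_cylinders : IsPiSystem cylinders := by
  rintro _ ⟨n, T₁, rfl⟩ _ ⟨m, T₂, rfl⟩ ⟨T, hT₁, hT₂⟩
  refine ⟨max n m, T, ?_⟩
  ext T'
  simp only [cylinder, Set.mem_inter_iff, Set.mem_ofPred_eq, ball_succ_eq_iff] at hT₁ hT₂ ⊢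
  constructor
  · rintro ⟨hT'₁, hT'₂⟩ s hs
    rcases le_max_iff.1 hs with h | h
    · rw [hT'₁ s h, hT₁ s h]
    · rw [hT'₂ s h, hT₂ s h]
  · intro hT'
    exact ⟨fun s hs => by rw [hT' s (le_max_of_le_left hs), hT₁ s hs],
      fun s hs => by rw [hT' s (le_max_of_le_right hs), hT₂ s hs]⟩

theorem measurable_of_cylinder {α : Type*} [MeasurableSpace α] {f : α → PlanarTree}
    (h : ∀ n T₀, MeasurableSet {x | f x ∈ cylinder n T₀}) : Measurable f := by
  change @Measurable α PlanarTree _ (borel PlanarTree) f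
  rw [isTopologicalBasis_cylinders.borel_eq_generateFrom]
  refine measurable_generateFrom ?_
  rintro _ ⟨n, T₀, rfl⟩
  exact h n T₀

theorem measurable_of_width_of_parent {α : Type*} [MeasurableSpace α] {f : α → PlanarTree}
    (hw : ∀ r k, MeasurableSet {x | (f x).width r = k})
    (hp : ∀ r j k, MeasurableSet {x | (f x).parent r j = k}) : Measurable f := by
  refine measurable_of_cylinder fun n T₀ => ?_
  simp only [cylinder, Set.mem_ofPred_eq, ball_eq_ball_iff, funext_iff]
  refine MeasurableSet.inter (s₁ := {x | ∀ s ≤ max (n + 1) 1, (f x).width s = T₀.width s})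
    (s₂ := {x | ∀ s < max (n + 1) 1, ∀ j, (f x).parent s j = T₀.parent s j}) ?_ ?_
  · simp only [Set.ofPred_forall]
    exact MeasurableSet.iInter fun s => MeasurableSet.iInter fun _ => hw s _
  · simp only [Set.ofPred_forall]
    exact MeasurableSet.iInter fun s => MeasurableSet.iInter fun _ =>
      MeasurableSet.iInter fun j => hp s j _

end PlanarTree

open PlanarTree

theorem measurable_markedTree : Measurable markedTree := by
  refine measurable_of_cylinder fun n T₀ => ?_
  obtain ⟨A, hA⟩ := exists_markedTree_mem_cylinder_iff n T₀
  simp only [hA]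
  exact measurable_markedHistory n (MeasurableSet.of_discrete (s := {h : MarkedHistory | h.1 ∈ A}))

theorem PlanarTree.IsLocalLimit.unique {μ : ℝ} {ν ν' : Measure PlanarTree}
    (h : IsLocalLimit μ ν) (h' : IsLocalLimit μ ν') : ν = ν' := by
  have := h.1
  have := h'.1
  exact ext_of_forall_integral_eq_of_IsFiniteMeasure
    fun f => tendsto_nhds_unique (h.2 f) (h'.2 f)

theorem isLocalLimit_map_markedTree {a : ℝ≥0} (ha : 0 < a) :
    IsLocalLimit a ((markedTreeMeasure a).map markedTree) := by
  have hP : IsProbabilityMeasure ((markedTreeMeasure a).map markedTree) :=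
    Measure.isProbabilityMeasure_map measurable_markedTree.aemeasurable
  refine ⟨hP, fun F => ?_⟩
  rw [← tendsto_add_atTop_iff_nat 1]
  have ha' : (0 : ℝ) < a := ha
  let ν' : ℕ → ProbabilityMeasure PlanarTree := fun N =>
    ⟨finiteSizeMeasure a (N + 1), isProbabilityMeasure_finiteSizeMeasure ha' N⟩
  let ν : ProbabilityMeasure PlanarTree := ⟨(markedTreeMeasure a).map markedTree, hP⟩
  have hconv : Tendsto ν' atTop (𝓝 ν) := by
    refine isPiSystem_cylinders.tendsto_probabilityMeasure_of_tendsto_of_mem ?_ ?_ ?_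
    · rintro _ ⟨n, T₀, rfl⟩
      exact measurableSet_cylinder n T₀
    · intro U hU T hT
      obtain ⟨n, hn⟩ := exists_cylinder_subset hU hT
      exact ⟨_, ⟨n, T, rfl⟩, (isOpen_cylinder n T).mem_nhds (mem_cylinder_self n T), hn⟩
    · rintro _ ⟨n, T₀, rfl⟩
      rw [← ENNReal.tendsto_coe]
      simp only [ProbabilityMeasure.ennreal_coeFn_eq_coeFn_toMeasure]
      have hlim := (tendsto_add_atTop_iff_nat 1).2 (tendsto_finiteSizeMeasure_cylinder ha' n T₀)
      rw [← markedTreeMeasure_cylinder a n T₀] at hlim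
      have hmap : (ν : Measure PlanarTree) (cylinder n T₀) =
          markedTreeMeasure a {ω | markedTree ω ∈ cylinder n T₀} :=
        Measure.map_apply measurable_markedTree (measurableSet_cylinder n T₀)
      rwa [hmap]
  exact ProbabilityMeasure.tendsto_iff_forall_integral_tendsto.1 hconv F

end LocalLimit

section InfiniteType

open scoped NNReal ENNReal

theorem exists_getElem?_flatten {α : Type*} {e : List (List α)} {i : ℕ} {w : List α} {b : α}
    (hi : e[i]? = some w) (hb : b ∈ w) :
    ∃ j, e.flatten[j]? = some b ∧ blockIndex (e.map List.length) j = i := by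
  induction e generalizing i with
  | nil => simp at hi
  | cons v e ih =>
    cases i with
    | zero =>
      obtain rfl : v = w := by simpa using hi
      obtain ⟨k, hk⟩ := List.mem_iff_getElem?.1 hb
      have hk' : k < v.length := (List.getElem?_eq_some_iff.1 hk).1
      exact ⟨k, by rw [List.flatten_cons, List.getElem?_append_left hk', hk],
        by rw [List.map_cons, blockIndex, if_pos hk']⟩
    | succ i =>
      obtain ⟨j, hget, hblock⟩ := ih (by simpa using hi)
      refine ⟨v.length + j, ?_, ?_⟩
      · rw [List.flatten_cons, List.getElem?_append_right (by omega), Nat.add_sub_cancel_left,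
          hget]
      · rw [List.map_cons, blockIndex, if_neg (by omega), Nat.add_sub_cancel_left, hblock]

theorem PlanarTree.size_eq_top {T : PlanarTree} (h : ∀ r, T.width (r + 1) ≠ 0) : T.size = ⊤ := by
  refine Set.encard_eq_top_iff.2 ((Set.infinite_range_of_injective
    (f := fun r : ℕ => (r, 0)) fun a b h => (Prod.mk.inj h).1).mono ?_)
  rintro _ ⟨r, rfl⟩
  exact Nat.pos_of_ne_zero (h r)

theorem width_markedTree_pos (ω : ℕ → OffspringInput) (n : ℕ) :
    0 < (markedTree ω).width (n + 1) := by
  rw [width_markedTree_succ]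
  exact (markedLevel ω n).2.trans_le List.count_le_length

theorem size_markedTree (ω : ℕ → OffspringInput) : (markedTree ω).size = ⊤ :=
  PlanarTree.size_eq_top fun n => (width_markedTree_pos ω n).ne'

theorem parent_markedTree (ω : ℕ → OffspringInput) {n j : ℕ}
    (hj : j < (markedTree ω).width (n + 2)) :
    (markedTree ω).parent (n + 1) j = blockIndex ((markedChildren ω n).map List.length) j := by
  rw [PlanarTree.parent_eq_blockIndex _ hj, code_markedTree_succ]

theorem exists_marked_descendant {ω : ℕ → OffspringInput} {n i : ℕ}
    (hi : (markedLevel ω n).1[i]? = some true) (k : ℕ) :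
    ∃ j, (markedLevel ω (n + k)).1[j]? = some true ∧
      (markedTree ω).ancestor (n + 1) k j = i := by
  induction k with
  | zero => exact ⟨i, hi, rfl⟩
  | succ k ih =>
    obtain ⟨j, hmarked, hancestor⟩ := ih
    rw [← parentMarks_markedChildren, parentMarks, List.getElem?_map,
      Option.map_eq_some_iff] at hmarked
    obtain ⟨w, hw, hany⟩ := hmarked
    obtain ⟨j', hchild, hparent⟩ := exists_getElem?_flatten hw
      (List.count_pos_iff.1 ((any_eq_true_iff_count_pos w).1 hany))
    rw [← markedLevel_succ] at hchild
    refine ⟨j', hchild, ?_⟩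
    have hj' : j' < (markedTree ω).width (n + k + 2) := by
      rw [width_markedTree_succ]
      exact (List.getElem?_eq_some_iff.1 hchild).1
    rw [PlanarTree.ancestor, show n + 1 + k = n + k + 1 by ring, parent_markedTree ω hj',
      hparent, hancestor]

theorem isInfType_of_marked {ω : ℕ → OffspringInput} {n i : ℕ}
    (hi : (markedLevel ω n).1[i]? = some true) : (markedTree ω).IsInfType (n + 1) i := by
  choose f hmarked hancestor using exists_marked_descendant hi
  refine (Set.infinite_range_of_injective (f := fun k : ℕ => (k, f (k + 1)))
    fun a b h => (Prod.mk.inj h).1).mono ?_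
  rintro _ ⟨k, rfl⟩
  refine ⟨?_, hancestor (k + 1)⟩
  change f (k + 1) < (markedTree ω).width (n + 1 + (k + 1))
  rw [show n + 1 + (k + 1) = n + (k + 1) + 1 by ring, width_markedTree_succ]
  exact (List.getElem?_eq_some_iff.1 (hmarked (k + 1))).1

/-- The flags of the vertices of a generation, split into the families `e` of children, when every
child inherits its flag from the list `c` of flags of the parents. It follows the descendants of a
set of vertices through the generations. -/
def inheritFlags {α : Type*} : List Bool → List (List α) → List Bool
  | d :: c, w :: e => List.replicate w.length d ++ inheritFlags c e
  | _, _ => []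

theorem count_inheritFlags {α : Type*} (c : List Bool) (e : List (List α)) :
    (inheritFlags c e).count true = flaggedChildren c e := by
  induction c generalizing e with
  | nil => rfl
  | cons d c ih =>
    cases e with
    | nil => rfl
    | cons w e =>
      rw [inheritFlags, flaggedChildren, List.count_append, ih, List.count_replicate]
      cases d <;> simp

theorem flaggedChildren_eq_zero {α : Type*} {c : List Bool} (hc : c.count true = 0)
    (e : List (List α)) : flaggedChildren c e = 0 := by
  induction c generalizing e with
  | nil => rfl
  | cons d c ih =>
    cases e with
    | nil => rfl
    | cons w e =>
      cases d
      · rw [flaggedChildren, ih (by simpa using hc)]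
        simp
      · simp at hc

theorem forall₂_inheritFlags {c : List Bool} {e : List (List Bool)}
    (h : List.Forall₂ (fun d b => d = true → b = false) c (parentMarks e)) :
    List.Forall₂ (fun d b => d = true → b = false) (inheritFlags c e) e.flatten := by
  induction e generalizing c with
  | nil =>
    cases h
    exact List.Forall₂.nil
  | cons w e ih =>
    rw [parentMarks, List.map_cons] at h
    obtain ⟨d, c, hd, hc, rfl⟩ := List.forall₂_cons_right_iff.1 h
    rw [inheritFlags, List.flatten_cons]
    refine List.rel_append ?_ (ih hc)
    rw [List.forall₂_iff_get]
    refine ⟨List.length_replicate, fun k _ hk hflag => ?_⟩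
    simp only [List.get_eq_getElem, List.getElem_replicate] at hflag
    have hunmarked := List.any_eq_false.1 (hd hflag)
    simpa using hunmarked _ (List.get_mem w ⟨k, hk⟩)

theorem getElem?_inheritFlags {α : Type*} {b : List Bool} {e : List (List α)}
    (h : b.length = e.length) {j : ℕ} (hj : j < e.flatten.length) :
    (inheritFlags b e)[j]? = b[blockIndex (e.map List.length) j]? := by
  induction e generalizing b j with
  | nil => simp at hj
  | cons w e ih =>
    obtain ⟨d, b, rfl⟩ := List.exists_cons_of_length_eq_add_one h
    rw [inheritFlags, List.map_cons, blockIndex]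
    by_cases hw : j < w.length
    · rw [if_pos hw, List.getElem?_append_left (by simpa using hw)]
      simp [hw]
    · rw [if_neg hw, List.getElem?_append_right (by simpa using hw), List.length_replicate,
        ih (by simpa using h), List.getElem?_cons_succ]
      rw [List.flatten_cons, List.length_append] at hj
      omega

/-- The descendants of the unmarked vertices of the generation `n + 1`, as a list of flags on the
generation `n + 1 + k`. They form a critical branching process with geometric offspring. -/
def unmarkedDescendants (ω : ℕ → OffspringInput) (n : ℕ) : ℕ → List Bool
  | 0 => (markedLevel ω n).1.map not
  | k + 1 => inheritFlags (unmarkedDescendants ω n k) (markedChildren ω (n + k))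

theorem forall₂_unmarkedDescendants (ω : ℕ → OffspringInput) (n k : ℕ) :
    List.Forall₂ (fun d b => d = true → b = false) (unmarkedDescendants ω n k)
      (markedLevel ω (n + k)).1 := by
  induction k with
  | zero =>
    rw [unmarkedDescendants, List.forall₂_map_left_iff]
    exact List.forall₂_same.2 fun b _ h => by simpa using h
  | succ k ih =>
    rw [← parentMarks_markedChildren] at ih
    exact forall₂_inheritFlags ih

theorem unmarkedDescendants_of_ancestor {ω : ℕ → OffspringInput} {n i : ℕ}
    (hi : (markedLevel ω n).1[i]? = some false) (k : ℕ) {j : ℕ}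
    (hj : j < (markedTree ω).width (n + 1 + k))
    (hancestor : (markedTree ω).ancestor (n + 1) k j = i) :
    (unmarkedDescendants ω n k)[j]? = some true := by
  induction k generalizing j with
  | zero =>
    obtain rfl : j = i := hancestor
    rw [unmarkedDescendants, List.getElem?_map, hi]
    rfl
  | succ k ih =>
    have hj' := (markedTree ω).parent_lt _ _ hj
    have hparent :
        (unmarkedDescendants ω n k)[(markedTree ω).parent (n + 1 + k) j]? = some true :=
      ih hj' hancestor
    rw [show n + 1 + (k + 1) = n + k + 2 by ring] at hj
    rw [show n + 1 + k = n + k + 1 by ring, parent_markedTree ω hj] at hparent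
    rw [width_markedTree_succ, markedLevel_succ] at hj
    rw [unmarkedDescendants, getElem?_inheritFlags _ hj, hparent]
    rw [(forall₂_unmarkedDescendants ω n k).length_eq, length_markedChildren]

theorem count_unmarkedDescendants_eq_zero {ω : ℕ → OffspringInput} {n k m : ℕ} (hkm : k ≤ m)
    (h : (unmarkedDescendants ω n k).count true = 0) :
    (unmarkedDescendants ω n m).count true = 0 := by
  induction m, hkm using Nat.le_induction with
  | base => exact h
  | succ m _ ih => rw [unmarkedDescendants, count_inheritFlags, flaggedChildren_eq_zero ih]

theorem not_isInfType_of_unmarked {ω : ℕ → OffspringInput} {n k i : ℕ}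
    (hk : (unmarkedDescendants ω n k).count true = 0)
    (hi : (markedLevel ω n).1[i]? = some false) : ¬ (markedTree ω).IsInfType (n + 1) i := by
  intro hinf
  refine hinf ((((Finset.range k).sigma fun m => Finset.range ((markedTree ω).width
    (n + 1 + (m + 1)))).map (Equiv.sigmaEquivProd ℕ ℕ).toEmbedding).finite_toSet.subset ?_)
  rintro ⟨m, j⟩ ⟨hj, hancestor⟩
  have hflag := unmarkedDescendants_of_ancestor hi (m + 1) hj hancestor
  have hm : m < k := by
    by_contra hm
    have hextinct := count_unmarkedDescendants_eq_zero (show k ≤ m + 1 by omega) hk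
    exact (List.count_eq_zero.1 hextinct) (List.mem_of_getElem? hflag)
  simpa using ⟨hm, hj⟩

end InfiniteType

section Extinction

open ProbabilityTheory
open scoped NNReal ENNReal

theorem exists_markedLevel_eq (n : ℕ) : ∃ Φ : List (List (List Bool)) → List Bool,
    ∀ ω, (markedLevel ω n).1 = Φ (markedHistory ω n).1 := by
  cases n with
  | zero => exact ⟨fun _ => [true], fun _ => rfl⟩
  | succ n => exact ⟨fun x => (x.headD []).flatten, fun _ => rfl⟩

theorem exists_unmarkedDescendants_eq (n k : ℕ) : ∃ Φ : List (List (List Bool)) → List Bool,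
    ∀ ω, unmarkedDescendants ω n k = Φ (markedHistory ω (n + k)).1 := by
  induction k with
  | zero =>
    obtain ⟨Φ, hΦ⟩ := exists_markedLevel_eq n
    exact ⟨fun x => (Φ x).map not, fun ω => by rw [unmarkedDescendants, hΦ]; rfl⟩
  | succ k ih =>
    obtain ⟨Φ, hΦ⟩ := ih
    exact ⟨fun x => inheritFlags (Φ x.tail) (x.headD []), fun ω => by
      rw [unmarkedDescendants, hΦ]; rfl⟩

theorem measurable_count_unmarkedDescendants (n k : ℕ) :
    Measurable fun ω => (unmarkedDescendants ω n k).count true := by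
  obtain ⟨Φ, hΦ⟩ := exists_unmarkedDescendants_eq n k
  simp only [hΦ]
  exact (measurable_from_top (f := fun h : MarkedHistory => (Φ h.1).count true)).comp
    (measurable_markedHistory (n + k))

theorem lintegral_pow_count_unmarkedDescendants_succ (a : ℝ≥0) (n k : ℕ) (t : ℝ≥0∞) :
    ∫⁻ ω, t ^ (unmarkedDescendants ω n (k + 1)).count true ∂(markedTreeMeasure a) =
      ∫⁻ ω, (2⁻¹ * (1 - t / 2)⁻¹) ^ (unmarkedDescendants ω n k).count true
        ∂(markedTreeMeasure a) := by
  obtain ⟨Φ, hΦ⟩ := exists_unmarkedDescendants_eq n k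
  have hindep := lintegral_markedHistory a (n + k)
    (F := fun h w => t ^ flaggedChildren (Φ h.1) (chosenOffspring h.2 w).1)
    fun h => measurable_comp_chosenOffspring h.2 fun e => t ^ flaggedChildren (Φ h.1) e
  have hcount : ∀ ω, t ^ (unmarkedDescendants ω n (k + 1)).count true =
      t ^ flaggedChildren (Φ (markedHistory ω (n + k)).1)
        (chosenOffspring (markedHistory ω (n + k)).2 (ω (n + k))).1 := by
    intro ω
    rw [unmarkedDescendants, count_inheritFlags, hΦ]
    rfl
  rw [lintegral_congr hcount, hindep]
  refine lintegral_congr fun ω => ?_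
  have hflags : List.Forall₂ (fun d b => d = true → b = false) (Φ (markedHistory ω (n + k)).1)
      (markedHistory ω (n + k)).2.1 := by
    rw [← hΦ]
    exact forall₂_unmarkedDescendants ω n k
  rw [lintegral_chosenOffspring a (markedHistory ω (n + k)).2
    fun e => t ^ flaggedChildren (Φ (markedHistory ω (n + k)).1) e]
  have hstep (p : ℕ) := tsum_offspringWeight_mul t ((markedHistory ω (n + k)).2, p) hflags
  rw [lintegral_congr hstep, lintegral_const, measure_univ, mul_one, hΦ]

/-- The probability that a critical branching process with geometric offspring, started from one
vertex, is extinct after `m` steps: the iterates at `0` of the generating function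
`t ↦ 1 / (2 - t)`. -/
noncomputable def extinctionProbability (m : ℕ) : ℝ≥0∞ := ENNReal.ofReal (m / (m + 1))

theorem extinctionProbability_succ (m : ℕ) :
    2⁻¹ * (1 - extinctionProbability m / 2)⁻¹ = extinctionProbability (m + 1) := by
  have hsub : 1 - (m : ℝ) / (m + 1) / 2 = (m + 2) / (2 * (m + 1)) := by
    field_simp
    ring
  have hpos : (0 : ℝ) < 1 - m / (m + 1) / 2 := by
    rw [hsub]
    positivity
  rw [extinctionProbability, extinctionProbability, ← ENNReal.ofReal_ofNat 2,
    ← ENNReal.ofReal_div_of_pos two_pos, ← ENNReal.ofReal_one,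
    ← ENNReal.ofReal_sub _ (by positivity), ← ENNReal.ofReal_inv_of_pos hpos,
    ← ENNReal.ofReal_inv_of_pos two_pos, ← ENNReal.ofReal_mul (by positivity), hsub]
  congr 1
  push_cast
  field_simp
  ring

theorem tendsto_extinctionProbability : Tendsto extinctionProbability atTop (𝓝 1) := by
  rw [← ENNReal.ofReal_one]
  exact ENNReal.tendsto_ofReal (tendsto_natCast_div_add_atTop 1)

theorem lintegral_pow_extinctionProbability (a : ℝ≥0) (n k m : ℕ) :
    ∫⁻ ω, extinctionProbability m ^ (unmarkedDescendants ω n k).count true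
      ∂(markedTreeMeasure a) =
    ∫⁻ ω, extinctionProbability (m + k) ^ (unmarkedDescendants ω n 0).count true
      ∂(markedTreeMeasure a) := by
  induction k generalizing m with
  | zero => rfl
  | succ k ih =>
    rw [lintegral_pow_count_unmarkedDescendants_succ, extinctionProbability_succ, ih,
      show m + 1 + k = m + (k + 1) by ring]

theorem markedTreeMeasure_count_unmarkedDescendants_eq_zero (a : ℝ≥0) (n k : ℕ) :
    markedTreeMeasure a {ω | (unmarkedDescendants ω n k).count true = 0} =
      ∫⁻ ω, extinctionProbability k ^ (unmarkedDescendants ω n 0).count true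
        ∂(markedTreeMeasure a) := by
  have hgen := lintegral_pow_extinctionProbability a n k 0
  rw [zero_add] at hgen
  have hmeas : MeasurableSet {ω | (unmarkedDescendants ω n k).count true = 0} :=
    measurable_count_unmarkedDescendants n k (measurableSet_singleton 0)
  rw [← hgen, ← lintegral_indicator_one hmeas]
  refine lintegral_congr fun ω => ?_
  rw [show extinctionProbability 0 = 0 by simp [extinctionProbability], zero_pow_eq]
  simp [Set.indicator_apply]

theorem tendsto_markedTreeMeasure_count_unmarkedDescendants_eq_zero (a : ℝ≥0) (n : ℕ) :
    Tendsto (fun k => markedTreeMeasure a {ω | (unmarkedDescendants ω n k).count true = 0})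
      atTop (𝓝 1) := by
  simp only [markedTreeMeasure_count_unmarkedDescendants_eq_zero]
  rw [show (1 : ℝ≥0∞) = ∫⁻ _, 1 ∂(markedTreeMeasure a) by simp]
  refine tendsto_lintegral_of_dominated_convergence (fun _ => 1) (fun k => ?_) (fun k => ?_)
    (by simp) (Eventually.of_forall fun ω => ?_)
  · exact (measurable_from_top (f := fun c : ℕ => extinctionProbability k ^ c)).comp
      (measurable_count_unmarkedDescendants n 0)
  · refine Eventually.of_forall fun ω => pow_le_one₀ (by positivity) ?_
    rw [extinctionProbability, ENNReal.ofReal_le_one, div_le_one (by positivity)]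
    linarith
  · have hpow := (ENNReal.continuous_pow ((unmarkedDescendants ω n 0).count true)).tendsto 1
    rw [one_pow] at hpow
    exact hpow.comp tendsto_extinctionProbability

theorem ae_exists_count_unmarkedDescendants_eq_zero (a : ℝ≥0) (n : ℕ) :
    ∀ᵐ ω ∂(markedTreeMeasure a), ∃ k, (unmarkedDescendants ω n k).count true = 0 := by
  have hmeas : MeasurableSet {ω | ∃ k, (unmarkedDescendants ω n k).count true = 0} := by
    rw [Set.ofPred_exists]
    exact MeasurableSet.iUnion fun k =>
      measurable_count_unmarkedDescendants n k (measurableSet_singleton 0)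
  refine (mem_ae_iff_prob_eq_one hmeas).2 (le_antisymm prob_le_one (le_of_tendsto'
    (tendsto_markedTreeMeasure_count_unmarkedDescendants_eq_zero a n) fun k => ?_))
  exact measure_mono fun ω hω => ⟨k, hω⟩

theorem count_length_eq_count_true {p : ℕ → Prop} [DecidablePred p] {l : List Bool}
    (h : ∀ i < l.length, p i ↔ l[i]? = some true) : Nat.count p l.length = l.count true := by
  induction l using List.reverseRecOn with
  | nil => simp
  | append_singleton l b ih =>
    have hlast := h l.length (by simp)
    rw [List.getElem?_append_right le_rfl, Nat.sub_self, List.getElem?_cons_zero] at hlast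
    rw [List.length_append, List.length_singleton, Nat.count_succ, List.count_append, ih]
    · cases b <;> simp [hlast]
    · intro i hi
      rw [h i (by simp; omega), List.getElem?_append_left hi]

open Classical in
theorem PlanarTree.width_spine {T : PlanarTree} (hT : T.size = ⊤) (r : ℕ) :
    T.spine.width r = Nat.count (T.IsInfType r) (T.width r) := by
  rw [spine, dif_pos hT]
  rfl

theorem ae_width_spine_markedTree (a : ℝ≥0) : ∀ᵐ ω ∂(markedTreeMeasure a), ∀ n,
    (markedTree ω).spine.width (n + 1) = 1 + ∑ i ∈ Finset.range n, (ω i).1 := by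
  classical
  rw [ae_all_iff]
  intro n
  filter_upwards [ae_exists_count_unmarkedDescendants_eq_zero a n] with ω hω
  obtain ⟨k, hk⟩ := hω
  rw [PlanarTree.width_spine (size_markedTree ω), ← count_markedLevel, width_markedTree_succ]
  refine count_length_eq_count_true fun i hi => ⟨fun hinf => ?_, isInfType_of_marked⟩
  rw [List.getElem?_eq_getElem hi]
  by_contra hunmarked
  refine not_isInfType_of_unmarked hk ?_ hinf
  rw [List.getElem?_eq_getElem hi]
  simpa using hunmarked

end Extinction

section SpineMeasurable

theorem measurable_apply_of_countable {α β ι : Type*} [MeasurableSpace α] [MeasurableSpace β]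
    [MeasurableSpace ι] [Countable ι] [MeasurableSingletonClass ι] {f : α → ι → β} {g : α → ι}
    (hf : ∀ i, Measurable fun x => f x i) (hg : Measurable g) : Measurable fun x => f x (g x) := by
  have hf' : Measurable fun p : α × ι => f p.1 p.2 := measurable_from_prod_countable_left hf
  exact hf'.comp (measurable_id.prodMk hg)

open Classical in
theorem measurable_natCount {α : Type*} [MeasurableSpace α] {p : α → ℕ → Prop}
    (hp : ∀ n, MeasurableSet {x | p x n}) (m : ℕ) : Measurable fun x => Nat.count (p x) m := by
  induction m with
  | zero => exact measurable_const
  | succ m ih =>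
    simp only [Nat.count_succ]
    exact ih.add (Measurable.ite (hp m) measurable_const measurable_const)

open Classical in
theorem nth_eq_succ_iff {p : ℕ → Prop} {j n : ℕ} :
    Nat.nth p j = n + 1 ↔ p (n + 1) ∧ Nat.count p (n + 1) = j := by
  constructor
  · intro h
    have hj : ∀ hf : (Set.ofPred p).Finite, j < hf.toFinset.card := by
      intro hf
      by_contra hle
      rw [Nat.nth_of_card_le hf (not_lt.1 hle)] at h
      exact (Nat.succ_ne_zero n) h.symm
    rw [← h]
    exact ⟨Nat.nth_mem j hj, Nat.count_nth hj⟩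
  · rintro ⟨hp, rfl⟩
    exact Nat.nth_count hp

theorem measurable_natNth {α : Type*} [MeasurableSpace α] {p : α → ℕ → Prop}
    (hp : ∀ n, MeasurableSet {x | p x n}) (j : ℕ) : Measurable fun x => Nat.nth (p x) j := by
  classical
  have hsucc : ∀ n, MeasurableSet {x | Nat.nth (p x) j = n + 1} := by
    intro n
    simp only [nth_eq_succ_iff]
    exact (hp (n + 1)).inter (measurable_natCount hp (n + 1) (measurableSet_singleton j))
  refine measurable_to_countable' fun n => ?_
  cases n with
  | succ n => exact hsucc n
  | zero =>
    convert (MeasurableSet.iUnion hsucc).compl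
    ext x
    simpa using ⟨fun h n => by omega, fun h => Nat.eq_zero_of_not_pos fun hpos =>
      h _ (Nat.succ_pred_eq_of_pos hpos).symm⟩

namespace PlanarTree

theorem isOpen_of_cylinder_subset {U : Set PlanarTree} (h : ∀ T ∈ U, ∃ n, cylinder n T ⊆ U) :
    IsOpen U := by
  rw [isOpen_iff_mem_nhds]
  intro T hT
  obtain ⟨n, hn⟩ := h T hT
  exact mem_of_superset ((isOpen_cylinder n T).mem_nhds (mem_cylinder_self n T)) hn

theorem measurable_width (r : ℕ) : Measurable fun T : PlanarTree => T.width r := by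
  refine measurable_to_countable' fun k => (isOpen_of_cylinder_subset fun T hT => ?_).measurableSet
  refine ⟨r, fun T' hT' => ?_⟩
  rw [Set.mem_preimage, width_eq_of_ball_eq hT' (Nat.le_succ r)]
  exact hT

theorem measurable_parent (r j : ℕ) : Measurable fun T : PlanarTree => T.parent r j := by
  refine measurable_to_countable' fun k => (isOpen_of_cylinder_subset fun T hT => ?_).measurableSet
  refine ⟨r, fun T' hT' => ?_⟩
  rw [Set.mem_preimage, ((ball_eq_ball_iff _ _ _).1 hT').2 r (by omega)]
  exact hT

theorem measurable_ancestor (r k j : ℕ) : Measurable fun T : PlanarTree => T.ancestor r k j := by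
  induction k generalizing j with
  | zero => exact measurable_const
  | succ k ih =>
    exact measurable_apply_of_countable (f := fun T j => T.ancestor r k j) ih
      (measurable_parent (r + k) j)

theorem measurableSet_isInfType (r i : ℕ) : MeasurableSet {T : PlanarTree | T.IsInfType r i} := by
  have hinfinite : {T : PlanarTree | T.IsInfType r i} =
      ⋂ F : Finset (ℕ × ℕ), ⋃ v : ℕ × ℕ, ⋃ _ : v ∉ F,
        {T : PlanarTree | v ∈ T.descendants r i} := by
    ext T
    simp only [Set.mem_iInter, Set.mem_iUnion, Set.mem_ofPred_eq, exists_prop]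
    constructor
    · intro h F
      obtain ⟨v, hv, hvF⟩ := h.exists_notMem_finset F
      exact ⟨v, hvF, hv⟩
    · intro h hfin
      obtain ⟨v, hvF, hv⟩ := h hfin.toFinset
      exact hvF (hfin.mem_toFinset.2 hv)
  rw [hinfinite]
  refine MeasurableSet.iInter fun F => MeasurableSet.iUnion fun v =>
    MeasurableSet.iUnion fun _ => ?_
  exact (measurable_width _ (measurableSet_Ioi (a := v.2))).inter
    (measurable_ancestor r (v.1 + 1) v.2 (measurableSet_singleton i))

theorem size_eq_top_iff (T : PlanarTree) : T.size = ⊤ ↔ T.IsInfType 0 0 := by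
  refine ⟨isInfType_zero, fun h => Set.encard_eq_top_iff.2 (h.mono ?_)⟩
  rintro v ⟨hv, -⟩
  rwa [zero_add] at hv

theorem measurableSet_size_eq_top : MeasurableSet {T : PlanarTree | T.size = ⊤} := by
  simp only [size_eq_top_iff]
  exact measurableSet_isInfType 0 0

open Classical in
theorem spine_parent {T : PlanarTree} (hT : T.size = ⊤) (r j : ℕ) :
    T.spine.parent r j = if j < Nat.count (T.IsInfType (r + 1)) (T.width (r + 1)) then
      Nat.count (T.IsInfType r) (T.parent r (Nat.nth (T.IsInfType (r + 1)) j)) else 0 := by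
  rw [spine, dif_pos hT]
  rfl

open Classical in
theorem measurable_count_isInfType_width (r : ℕ) :
    Measurable fun T : PlanarTree => Nat.count (T.IsInfType r) (T.width r) :=
  measurable_apply_of_countable (measurable_natCount (measurableSet_isInfType r))
    (measurable_width r)

open Classical in
theorem measurable_width_spine (r : ℕ) : Measurable fun T : PlanarTree => T.spine.width r := by
  have hspine : (fun T : PlanarTree => T.spine.width r) = fun T =>
      if T.size = ⊤ then Nat.count (T.IsInfType r) (T.width r) else T.width r := by
    funext T
    split_ifs with hT
    · exact width_spine hT r
    · rw [spine, dif_neg hT]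
  rw [hspine]
  exact Measurable.ite measurableSet_size_eq_top (measurable_count_isInfType_width r)
    (measurable_width r)

open Classical in
theorem measurable_parent_spine (r j : ℕ) :
    Measurable fun T : PlanarTree => T.spine.parent r j := by
  have hspine : (fun T : PlanarTree => T.spine.parent r j) = fun T =>
      if T.size = ⊤ then if j < Nat.count (T.IsInfType (r + 1)) (T.width (r + 1)) then
        Nat.count (T.IsInfType r) (T.parent r (Nat.nth (T.IsInfType (r + 1)) j)) else 0
      else T.parent r j := by
    funext T
    by_cases hT : T.size = ⊤
    · rw [if_pos hT, spine_parent hT]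
    · rw [if_neg hT, spine, dif_neg hT]
  have hparent : Measurable fun T : PlanarTree =>
      T.parent r (Nat.nth (T.IsInfType (r + 1)) j) :=
    measurable_apply_of_countable (measurable_parent r)
      (measurable_natNth (measurableSet_isInfType (r + 1)) j)
  rw [hspine]
  exact Measurable.ite measurableSet_size_eq_top
    (Measurable.ite (measurable_count_isInfType_width (r + 1) (measurableSet_Ioi (a := j)))
      (measurable_apply_of_countable (measurable_natCount (measurableSet_isInfType r)) hparent)
      measurable_const)
    (measurable_parent r j)

theorem measurable_spine : Measurable spine :=
  measurable_of_width_of_parent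
    (fun r k => measurable_width_spine r (measurableSet_singleton k))
    fun r j k => measurable_parent_spine r j (measurableSet_singleton k)

end PlanarTree

end SpineMeasurable

section SpineLaw

open ProbabilityTheory
open scoped NNReal

theorem hasSum_poisson_mean (a : ℝ≥0) :
    HasSum (fun n : ℕ => Real.exp (-a) * a ^ n / n.factorial * n) a := by
  have hshift := (hasSum_one_poissonMeasure a).mul_left (a : ℝ)
  have hterm : ∀ n : ℕ, a * (Real.exp (-a) * a ^ n / n.factorial) =
      Real.exp (-a) * a ^ (n + 1) / (n + 1).factorial * ((n + 1 : ℕ) : ℝ) := by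
    intro n
    rw [Nat.factorial_succ]
    push_cast
    field_simp
    rw [pow_succ, mul_comm]
  refine (hasSum_nat_add_iff' 1).1 ?_
  simpa only [hterm, mul_one, Finset.range_one, Finset.sum_singleton, Nat.cast_zero, mul_zero,
    sub_zero] using hshift

theorem integrable_natCast_poissonMeasure (a : ℝ≥0) :
    Integrable (fun n : ℕ => (n : ℝ)) (poissonMeasure a) := by
  rw [integrable_poissonMeasure_iff]
  simpa using (hasSum_poisson_mean a).summable

theorem integral_natCast_poissonMeasure (a : ℝ≥0) : ∫ n : ℕ, (n : ℝ) ∂(poissonMeasure a) = a := by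
  rw [integral_poissonMeasure]
  simpa using (hasSum_poisson_mean a).tsum_eq

/-- The number of additional marks that the step `i` creates, as a real random variable: these are
independent Poisson variables, and their partial sums give the widths of the spine. -/
def extraMarks (i : ℕ) (ω : ℕ → OffspringInput) : ℝ := (ω i).1

theorem measurePreserving_eval_fst (a : ℝ≥0) (i : ℕ) :
    MeasurePreserving (fun ω : ℕ → OffspringInput => (ω i).1) (markedTreeMeasure a)
      (poissonMeasure a) :=
  (measurePreserving_fst (μ := poissonMeasure a)
    (ν := Measure.infinitePi fun i => (offspringPMF i).toMeasure)).comp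
      (measurePreserving_eval_markedTreeMeasure a i)

theorem integrable_extraMarks (a : ℝ≥0) (i : ℕ) :
    Integrable (extraMarks i) (markedTreeMeasure a) :=
  (measurePreserving_eval_fst a i).integrable_comp_of_integrable
    (integrable_natCast_poissonMeasure a)

theorem integral_extraMarks (a : ℝ≥0) (i : ℕ) :
    ∫ ω, extraMarks i ω ∂(markedTreeMeasure a) = a := by
  rw [← integral_natCast_poissonMeasure a, ← (measurePreserving_eval_fst a i).map_eq,
    integral_map (measurePreserving_eval_fst a i).measurable.aemeasurable
      measurable_from_top.aestronglyMeasurable]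
  rfl

theorem identDistrib_extraMarks (a : ℝ≥0) (i j : ℕ) :
    IdentDistrib (extraMarks i) (extraMarks j) (markedTreeMeasure a) (markedTreeMeasure a) := by
  have hident : IdentDistrib (fun ω : ℕ → OffspringInput => (ω i).1) (fun ω => (ω j).1)
      (markedTreeMeasure a) (markedTreeMeasure a) :=
    ⟨(measurePreserving_eval_fst a i).measurable.aemeasurable,
      (measurePreserving_eval_fst a j).measurable.aemeasurable, by
        rw [(measurePreserving_eval_fst a i).map_eq, (measurePreserving_eval_fst a j).map_eq]⟩
  exact hident.comp (u := fun n : ℕ => (n : ℝ)) measurable_from_top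

theorem iIndepFun_extraMarks (a : ℝ≥0) : iIndepFun extraMarks (markedTreeMeasure a) :=
  iIndepFun_infinitePi (X := fun _ (w : OffspringInput) => (w.1 : ℝ)) fun _ =>
    (measurable_from_top (f := fun n : ℕ => (n : ℝ))).comp measurable_fst

theorem ae_tendsto_sum_extraMarks_div (a : ℝ≥0) : ∀ᵐ ω ∂(markedTreeMeasure a),
    Tendsto (fun n : ℕ => (∑ i ∈ Finset.range n, extraMarks i ω) / n) atTop (𝓝 a) := by
  simpa only [integral_extraMarks] using strong_law_ae_real extraMarks (integrable_extraMarks a 0)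
    (fun i j hij => (iIndepFun_extraMarks a).indepFun hij) fun i => identDistrib_extraMarks a i 0

theorem sum_range_natCast_add_one (n : ℕ) :
    ∑ i ∈ Finset.range n, ((i : ℝ) + 1) = n * (n + 1) / 2 := by
  induction n with
  | zero => simp
  | succ n ih =>
    rw [Finset.sum_range_succ, ih]
    push_cast
    ring

theorem isLittleO_sum_sub_mul_of_tendsto_div {u : ℕ → ℝ} {a : ℝ}
    (h : Tendsto (fun n : ℕ => u n / n) atTop (𝓝 a)) :
    (fun n : ℕ => ∑ i ∈ Finset.Icc 1 n, u i - a * (n * (n + 1) / 2)) =o[atTop]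
      fun n : ℕ => (n : ℝ) * (n + 1) / 2 := by
  have hterm : (fun i : ℕ => u (i + 1) - a * (i + 1)) =o[atTop] fun i : ℕ => (i : ℝ) + 1 := by
    refine Asymptotics.isLittleO_of_tendsto (fun i hi => absurd hi (by positivity)) ?_
    have hdiff := ((tendsto_add_atTop_iff_nat 1).2 h).sub_const a
    rw [sub_self] at hdiff
    refine hdiff.congr fun i => ?_
    push_cast
    field_simp
  have hdiverges : Tendsto (fun n => ∑ i ∈ Finset.range n, ((i : ℝ) + 1)) atTop atTop := by
    refine tendsto_atTop_mono (fun n => ?_) (tendsto_natCast_atTop_atTop (R := ℝ))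
    calc (n : ℝ) = ∑ _i ∈ Finset.range n, (1 : ℝ) := by simp
      _ ≤ ∑ i ∈ Finset.range n, ((i : ℝ) + 1) :=
        Finset.sum_le_sum fun i _ => le_add_of_nonneg_left i.cast_nonneg
  have hsum := hterm.sum_range (fun i => by positivity) hdiverges
  simp only [Finset.sum_sub_distrib, ← Finset.mul_sum, sum_range_natCast_add_one] at hsum
  refine hsum.congr_left fun n => ?_
  rw [Finset.range_eq_Ico, Finset.sum_Ico_add' u 0 n 1]
  rfl

theorem tendsto_sum_div_sq_of_tendsto_div {u : ℕ → ℝ} {a : ℝ}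
    (h : Tendsto (fun n : ℕ => u n / n) atTop (𝓝 a)) :
    Tendsto (fun n : ℕ => (∑ i ∈ Finset.Icc 1 n, u i) / (n : ℝ) ^ 2) atTop (𝓝 (a / 2)) := by
  have hremainder := (isLittleO_sum_sub_mul_of_tendsto_div h).tendsto_div_nhds_zero
  have hratio : Tendsto (fun n : ℕ => (1 + 1 / (n : ℝ)) / 2) atTop (𝓝 (1 / 2)) := by
    simpa using ((tendsto_one_div_atTop_nhds_zero_nat (𝕜 := ℝ)).const_add 1).div_const 2
  have hlim := (hremainder.mul hratio).add (hratio.const_mul a)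
  rw [zero_mul, zero_add, mul_one_div] at hlim
  refine hlim.congr' ?_
  filter_upwards [eventually_gt_atTop 0] with n hn
  have : (0 : ℝ) < n := by exact_mod_cast hn
  field_simp
  ring

theorem PlanarTree.measurable_generationSize (r : ℕ) : Measurable (generationSize r) :=
  (measurable_from_top (f := fun n : ℕ => (n : ℝ))).comp (measurable_width r)

theorem PlanarTree.ballSize_eq_sum {r : ℕ} (hr : 1 ≤ r) :
    ballSize r = fun T => ∑ s ∈ Finset.Icc 1 r, generationSize s T := by
  funext T
  rw [ballSize, size_ball r hr, ENat.toNat_natCast]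
  push_cast
  rfl

open PlanarTree

theorem ae_generationSize_spine (a : ℝ≥0) : ∀ᵐ ω ∂(markedTreeMeasure a), ∀ n,
    generationSize (n + 1) (markedTree ω).spine = 1 + ∑ i ∈ Finset.range n, extraMarks i ω := by
  filter_upwards [ae_width_spine_markedTree a] with ω hω n
  rw [generationSize, hω n]
  push_cast
  rfl

theorem spineMeasure_map_markedTree (a : ℝ≥0) :
    spineMeasure ((markedTreeMeasure a).map markedTree) =
      (markedTreeMeasure a).map fun ω => (markedTree ω).spine :=
  Measure.map_map measurable_spine measurable_markedTree

theorem measurable_spine_markedTree : Measurable fun ω => (markedTree ω).spine :=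
  measurable_spine.comp measurable_markedTree

theorem ae_size_eq_top_map_markedTree (a : ℝ≥0) :
    ∀ᵐ T ∂((markedTreeMeasure a).map markedTree), T.size = ⊤ := by
  rw [ae_map_iff measurable_markedTree.aemeasurable measurableSet_size_eq_top]
  exact Eventually.of_forall size_markedTree

theorem integrable_generationSize (a : ℝ≥0) {r : ℕ} (hr : 1 ≤ r) : Integrable (generationSize r)
    (spineMeasure ((markedTreeMeasure a).map markedTree)) := by
  obtain ⟨n, rfl⟩ := Nat.exists_eq_add_of_le' hr
  rw [spineMeasure_map_markedTree, integrable_map_measure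
    (measurable_generationSize _).aestronglyMeasurable measurable_spine_markedTree.aemeasurable]
  have hsum : Integrable (fun ω => 1 + ∑ i ∈ Finset.range n, extraMarks i ω)
      (markedTreeMeasure a) :=
    (integrable_const 1).add (integrable_finsetSum _ fun i _ => integrable_extraMarks a i)
  refine hsum.congr ?_
  filter_upwards [ae_generationSize_spine a] with ω hω
  exact (hω n).symm

theorem integral_generationSize (a : ℝ≥0) {r : ℕ} (hr : 1 ≤ r) : ∫ T, generationSize r T
    ∂(spineMeasure ((markedTreeMeasure a).map markedTree)) = a * (r - 1) + 1 := by
  obtain ⟨n, rfl⟩ := Nat.exists_eq_add_of_le' hr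
  have hsize : ∀ᵐ ω ∂(markedTreeMeasure a), generationSize (n + 1) (markedTree ω).spine =
      1 + ∑ i ∈ Finset.range n, extraMarks i ω := by
    filter_upwards [ae_generationSize_spine a] with ω hω
    exact hω n
  rw [spineMeasure_map_markedTree, integral_map measurable_spine_markedTree.aemeasurable
    (measurable_generationSize _).aestronglyMeasurable, integral_congr_ae hsize,
    integral_add (integrable_const 1)
      (integrable_finsetSum _ fun i _ => integrable_extraMarks a i),
    integral_finsetSum _ fun i _ => integrable_extraMarks a i]
  simp only [integral_extraMarks, integral_const, Finset.sum_const, Finset.card_range,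
    probReal_univ, nsmul_eq_mul, smul_eq_mul]
  push_cast
  ring

theorem integrable_ballSize (a : ℝ≥0) {r : ℕ} (hr : 1 ≤ r) : Integrable (ballSize r)
    (spineMeasure ((markedTreeMeasure a).map markedTree)) := by
  rw [ballSize_eq_sum hr]
  exact integrable_finsetSum _ fun s hs => integrable_generationSize a (Finset.mem_Icc.1 hs).1

theorem sum_Icc_mul_sub_one_add_one (a : ℝ) (r : ℕ) :
    ∑ s ∈ Finset.Icc 1 r, (a * ((s : ℝ) - 1) + 1) = a * r * (r - 1) / 2 + r := by
  induction r with
  | zero => simp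
  | succ r ih =>
    rw [Finset.sum_Icc_succ_top (by omega), ih]
    push_cast
    ring

theorem integral_ballSize (a : ℝ≥0) {r : ℕ} (hr : 1 ≤ r) : ∫ T, ballSize r T
    ∂(spineMeasure ((markedTreeMeasure a).map markedTree)) = a * r * (r - 1) / 2 + r := by
  rw [ballSize_eq_sum hr, integral_finsetSum _ fun s hs =>
    integrable_generationSize a (Finset.mem_Icc.1 hs).1, ← sum_Icc_mul_sub_one_add_one]
  exact Finset.sum_congr rfl fun s hs => integral_generationSize a (Finset.mem_Icc.1 hs).1

theorem ae_tendsto_generationSize_div (a : ℝ≥0) :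
    ∀ᵐ T ∂(spineMeasure ((markedTreeMeasure a).map markedTree)),
      Tendsto (fun r : ℕ => generationSize r T / r) atTop (𝓝 a) := by
  rw [spineMeasure_map_markedTree, ae_map_iff measurable_spine_markedTree.aemeasurable
    (measurableSet_tendsto_fun (fun r => (measurable_generationSize r).div_const _)
      measurable_const)]
  filter_upwards [ae_generationSize_spine a, ae_tendsto_sum_extraMarks_div a] with ω hsize hmean
  rw [← tendsto_add_atTop_iff_nat 1]
  have hlim := (hmean.mul (tendsto_natCast_div_add_atTop (1 : ℝ))).add
    (tendsto_one_div_add_atTop_nhds_zero_nat (𝕜 := ℝ))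
  rw [mul_one, add_zero] at hlim
  refine hlim.congr' ?_
  filter_upwards [eventually_gt_atTop 0] with n hn
  have : (0 : ℝ) < n := by exact_mod_cast hn
  rw [hsize n]
  push_cast
  field_simp
  ring

theorem ae_tendsto_ballSize_div_sq (a : ℝ≥0) :
    ∀ᵐ T ∂(spineMeasure ((markedTreeMeasure a).map markedTree)),
      Tendsto (fun r : ℕ => ballSize r T / (r : ℝ) ^ 2) atTop (𝓝 (a / 2)) := by
  filter_upwards [ae_tendsto_generationSize_div a] with T hT
  refine (tendsto_sum_div_sq_of_tendsto_div hT).congr' ?_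
  filter_upwards [eventually_ge_atTop 1] with r hr
  rw [ballSize_eq_sum hr]

end SpineLaw

theorem mainTheorem10 (μ : ℝ) (hμ : 0 < μ) :
    (∃! ν : Measure PlanarTree, PlanarTree.IsLocalLimit μ ν) ∧
    ∀ ν : Measure PlanarTree, PlanarTree.IsLocalLimit μ ν →
      (∀ᵐ T ∂ν, T.size = ⊤) ∧
      AEMeasurable PlanarTree.spine ν ∧
      (∀ r : ℕ, 1 ≤ r →
        Integrable (PlanarTree.generationSize r) (PlanarTree.spineMeasure ν) ∧
        ∫ T, PlanarTree.generationSize r T ∂(PlanarTree.spineMeasure ν) = μ * (r - 1) + 1) ∧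
      (∀ r : ℕ, 1 ≤ r →
        Integrable (PlanarTree.ballSize r) (PlanarTree.spineMeasure ν) ∧
        ∫ T, PlanarTree.ballSize r T ∂(PlanarTree.spineMeasure ν) = μ * r * (r - 1) / 2 + r) ∧
      (∀ᵐ T ∂(PlanarTree.spineMeasure ν),
        Tendsto (fun r : ℕ => PlanarTree.generationSize r T / r) atTop (𝓝 μ)) ∧
      (∀ᵐ T ∂(PlanarTree.spineMeasure ν),
        Tendsto (fun r : ℕ => PlanarTree.ballSize r T / (r : ℝ) ^ 2) atTop (𝓝 (μ / 2))) := by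
  lift μ to NNReal using hμ.le
  have hlim := isLocalLimit_map_markedTree (a := μ) hμ
  refine ⟨⟨_, hlim, fun ν hν => hν.unique hlim⟩, fun ν hν => ?_⟩
  obtain rfl := hν.unique hlim
  exact ⟨ae_size_eq_top_map_markedTree μ, PlanarTree.measurable_spine.aemeasurable,
    fun _ hr => ⟨integrable_generationSize μ hr, integral_generationSize μ hr⟩,
    fun _ hr => ⟨integrable_ballSize μ hr, integral_ballSize μ hr⟩,
    ae_tendsto_generationSize_div μ, ae_tendsto_ballSize_div_sq μ⟩
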